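/- Let $n\ge 1$ be an integer, let $I,J\subseteq\mathbb R$ be nonempty open intervals and let $f$ be a smooth real function on $J$. A smooth vector field $X=\xi(x,y)\partial_x+\eta(x,y)\partial_y$ on $I\times J$ is a Lie point symmetry generator of $F:=y^{(2n)}+f(y)=0$ if its $2n$-th extension $\xi\partial_x+\eta\partial_y+\sum_{k=1}^{2n}\zeta_k\partial_{y^{(k)}}$, with $\zeta_0=\eta$, $\zeta_{k+1}=D\zeta_k-y^{(k+1)}D\xi$ and $D$ the total derivative, satisfies $XF=\alpha F$ for some smooth function $\alpha$ of $x,y,y',\dots,y^{(2n)}$. The generators form a real vector space. Let $X_1=\partial_x$. The vector fields that are generators for every $f$ are exactly the multiples of $X_1$. Call $f$ *equivalent* to $\bar f$ if $\bar f(b_1y+b_2)=(b_1/a_1^{2n})f(y)$ on $J$ for some constants with $a_1b_1\ne0$. For a given $f$, the space of generators is spanned by $X_1$ alone unless $f$ is equivalent to one of the functions $\lambda e^{\alpha y}$ ($\lambda\alpha\neq0$), $\lambda y^p$ ($\lambda\ne0$, $p\neq0,1$), $\lambda$, $\lambda y$ ($\lambda\ne0$) or, when $n=1$ only, $\kappa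 y+\lambda y^{-3}$ ($\kappa\lambda\ne0$); in all these cases it is larger. Moreover, a basis of the space of generators is given as follows, where $y^p$ means a real branch of the power function: $y^p$ if $J\subseteq(0,\infty)$, $\pm(-y)^p$ if $J\subseteq(-\infty,0)$, and $y^m$ on any $J$ if $p=m$ is a natural number. 1. If $f(y)=\lambda e^{\alpha y}$, $\lambda\alpha\ne0$: $X_1$ and $D_1=x\partial_x-\frac{2n}{\alpha}\partial_y$. 2. If $f(y)=\lambda y^p$, $\lambda\neq0$, $p\ne0,1$: $D_p=x\partial_x+\frac{2n}{1-p}y\partial_y$ is a generator, and $X_1,D_p$ is a basis if $p\neq\frac{1+2n}{1-2n}$. 3. If $f(y)=\lambda y^{\frac{1+2n}{1-2n}}$, $\lambda\ne0$: $X_1$, $X_2=x\partial_x+\frac{2n-1}{2}y\partial_y$ and $X_3=x^2\partial_x+(2n-1)xy\partial_y$. 4. If $f(y)=\lambda$, $\lambda\in\mathbb R$: for $n>1$, the fields $X_1$, $$Y_1=x\partial_x+\tfrac{2n-1}{2}\Big[y-\lambda\tfrac{2n+1}{2n-1}\tfrac{x^{2n}}{(2n)!}\Big]\partial_y,\quad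 Y_2=x^2\partial_x+x\Big[(2n-1)y-\lambda\tfrac{x^{2n}}{(2n)!}\Big]\partial_y,\quad Y_3=\Big(y+\lambda\tfrac{x^{2n}}{(2n)!}\Big)\partial_y$$ and $Z_j=\frac{x^j}{j!}\partial_y$, $0\le j\le 2n-1$. For $n=1$, the same fields together with $$Y_4=\Big(xy+\tfrac{\lambda}{2}x^3\Big)\partial_x+\Big(y^2-\tfrac{\lambda^2}{4}x^4\Big)\partial_y,\qquad Y_5=\Big(y+\tfrac32\lambda x^2\Big)\partial_x-\lambda^2x^3\partial_y.$$ 5. If $f(y)=\lambda y$, $\lambda\neq0$: for $n>1$, the fields $X_1$, $V_1=y\partial_y$ and $V_\beta=\beta(x)\partial_y$, with $\beta$ running over a basis of the solutions of $\beta^{(2n)}+\lambda\beta=0$ on $I$. For $n=1$ and $\lambda>0$, the same fields together with $$V_2=\sin(2\sqrt\lambda x)\partial_x+\sqrt\lambda\,y\cos(2\sqrt\lambda x)\partial_y,\quad V_3=\cos(2\sqrt\lambda x)\partial_x-\sqrt\lambda\,y\sin(2\sqrt\lambda x)\partial_y,$$ $$V_4=y\sin(\sqrt\lambda x)\partial_x+\sqrt\lambda\,y^2\cos(\sqrt\lambda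 x)\partial_y,\quad V_5=y\cos(\sqrt\lambda x)\partial_x-\sqrt\lambda\,y^2\sin(\sqrt\lambda x)\partial_y.$$ For $n=1$ and $\lambda<0$, with $\omega=\sqrt{-\lambda}$, these four are replaced by their real forms $\sinh(2\omega x)\partial_x+\omega y\cosh(2\omega x)\partial_y$, $\cosh(2\omega x)\partial_x+\omega y\sinh(2\omega x)\partial_y$, $y\sinh(\omega x)\partial_x+\omega y^2\cosh(\omega x)\partial_y$ and $y\cosh(\omega x)\partial_x+\omega y^2\sinh(\omega x)\partial_y$. -/

import Mathlib

open scoped ContDiff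

noncomputable section

namespace LieSym

/-- A vector field `ξ(x,y) ∂/∂x + η(x,y) ∂/∂y` in the plane, as the map `(x, y) ↦ (ξ, η)`. -/
abbrev VField : Type := ℝ × ℝ → ℝ × ℝ

/-- Functions on the jet space: `g x u` is the value at the independent variable `x` and the
jet `u`, where `u 0` stands for `y` and `u k` for the `k`-th derivative of `y`. -/
abbrev JetFun : Type := ℝ → (ℕ → ℝ) → ℝ

/-- The partial derivative with respect to `x`. -/
def dX (g : JetFun) : JetFun := fun x u => deriv (fun t => g t u) x

/-- The partial derivative with respect to the jet variable `u k`. -/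
def dU (k : ℕ) (g : JetFun) : JetFun :=
  fun x u => deriv (fun t => g x (Function.update u k t)) (u k)

/-- The total derivative `D = ∂/∂x + ∑ₖ u (k+1) ∂/∂(u k)`, for functions that depend on
`x, u 0, …, u m` only (the further terms of the formal sum vanish on these). -/
def totalD (m : ℕ) (g : JetFun) : JetFun :=
  fun x u => dX g x u + ∑ k ∈ Finset.range (m + 1), u (k + 1) * dU k g x u

/-- The coefficient `ξ` of a vector field, as a function on the jet space. -/
def xiFun (X : VField) : JetFun := fun x u => (X (x, u 0)).1

/-- The coefficient `η` of a vector field, as a function on the jet space. -/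
def etaFun (X : VField) : JetFun := fun x u => (X (x, u 0)).2

/-- The coefficients of the prolonged vector field:
`ζ₀ = η` and `ζₖ₊₁ = D ζₖ - u (k+1) D ξ`. -/
def zeta (X : VField) : ℕ → JetFun
  | 0 => etaFun X
  | k + 1 => fun x u => totalD k (zeta X k) x u - u (k + 1) * totalD 0 (xiFun X) x u

/-- The `m`-th extension `ξ ∂/∂x + ∑_{k ≤ m} ζₖ ∂/∂(u k)` of `X`, applied to `G`. -/
def prolong (m : ℕ) (X : VField) (G : JetFun) : JetFun :=
  fun x u => xiFun X x u * dX G x u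
    + ∑ k ∈ Finset.range (m + 1), zeta X k x u * dU k G x u

/-- The left-hand side of the equation `y⁽²ⁿ⁾ + f(y) = 0`. -/
def eqn (n : ℕ) (f : ℝ → ℝ) : JetFun := fun _ u => u (2 * n) + f (u 0)

/-- `X` is (on `I × J`) a Lie point symmetry generator of `F := y⁽²ⁿ⁾ + f(y) = 0`: it is smooth
and `X F = α F` holds identically in `x ∈ I`, `y ∈ J` and the derivatives of `y`, for some smooth
function `α` of `x`, `y` and the derivatives of `y` up to the order `2n`. -/
def IsGenerator (n : ℕ) (I J : Set ℝ) (f : ℝ → ℝ) (X : VField) : Prop :=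
  ContDiffOn ℝ ∞ X (I ×ˢ J) ∧
    ∃ α : ℝ × (Fin (2 * n + 1) → ℝ) → ℝ,
      ContDiffOn ℝ ∞ α {q | q.1 ∈ I ∧ q.2 0 ∈ J} ∧
      ∀ x ∈ I, ∀ u : ℕ → ℝ, u 0 ∈ J →
        prolong (2 * n) X (eqn n f) x u = α (x, fun i => u i) * eqn n f x u

/-- The vector fields `v i` form a basis of the real vector space of all Lie point symmetry
generators of `y⁽²ⁿ⁾ + f(y) = 0` on `I × J` (vector fields that agree on `I × J` being
identified). -/
def IsSymmetryBasis (n : ℕ) (I J : Set ℝ) (f : ℝ → ℝ) {ι : Type} (v : ι → VField) : Prop :=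
  LinearIndependent ℝ (fun i => (I ×ˢ J).domRestrict (v i)) ∧
    ∀ X : VField, IsGenerator n I J f X ↔
      ∃ W ∈ Submodule.span ℝ (Set.range v), Set.EqOn X W (I ×ˢ J)

/-- `g` is a real branch of the power function `y ↦ y ^ p` on `J`. -/
def IsPowerBranch (J : Set ℝ) (p : ℝ) (g : ℝ → ℝ) : Prop :=
  (∀ y ∈ J, 0 < y ∧ g y = y ^ p) ∨
  (∃ ε : ℝ, (ε = 1 ∨ ε = -1) ∧ ∀ y ∈ J, y < 0 ∧ g y = ε * (-y) ^ p) ∨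
  (∃ m : ℕ, p = m ∧ ∀ y ∈ J, g y = y ^ m)

/-- The critical exponent `(1+2n)/(1-2n)`. -/
def critExp (n : ℕ) : ℝ := (1 + 2 * (n : ℝ)) / (1 - 2 * (n : ℝ))

/-! The vector fields of the classification. -/

/-- `∂/∂x` -/
def X₁ : VField := fun _ => (1, 0)

/-- The generator for `f(y) = l exp(a y)`. -/
def D₁ (n : ℕ) (a : ℝ) : VField := fun q => (q.1, -(2 * (n : ℝ) / a))

/-- The generator for `f(y) = l y ^ p`. -/
def Dp (n : ℕ) (p : ℝ) : VField := fun q => (q.1, 2 * (n : ℝ) / (1 - p) * q.2)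

def X₂ (n : ℕ) : VField := fun q => (q.1, (2 * (n : ℝ) - 1) / 2 * q.2)

def X₃ (n : ℕ) : VField := fun q => (q.1 ^ 2, (2 * (n : ℝ) - 1) * q.1 * q.2)

def Y₁ (n : ℕ) (l : ℝ) : VField := fun q =>
  (q.1, (2 * (n : ℝ) - 1) / 2 *
    (q.2 - l * ((2 * (n : ℝ) + 1) / (2 * (n : ℝ) - 1))
      * (q.1 ^ (2 * n) / ((2 * n).factorial : ℝ))))

def Y₂ (n : ℕ) (l : ℝ) : VField := fun q =>
  (q.1 ^ 2, q.1 * ((2 * (n : ℝ) - 1) * q.2 - l * (q.1 ^ (2 * n) / ((2 * n).factorial : ℝ))))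

def Y₃ (n : ℕ) (l : ℝ) : VField := fun q =>
  (0, q.2 + l * (q.1 ^ (2 * n) / ((2 * n).factorial : ℝ)))

def Y₄ (l : ℝ) : VField := fun q =>
  (q.1 * q.2 + l / 2 * q.1 ^ 3, q.2 ^ 2 - l ^ 2 / 4 * q.1 ^ 4)

def Y₅ (l : ℝ) : VField := fun q =>
  (q.2 + 3 / 2 * l * q.1 ^ 2, -(l ^ 2 * q.1 ^ 3))

def Z (j : ℕ) : VField := fun q => (0, q.1 ^ j / (j.factorial : ℝ))

def V₁ : VField := fun q => (0, q.2)

def Vβ (β : ℝ → ℝ) : VField := fun q => (0, β q.1)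

/-! The further generators for `f(y) = l y`, `n = 1`, with `w = √l`, `l > 0`. -/

def V₂ (w : ℝ) : VField := fun q =>
  (Real.sin (2 * w * q.1), w * q.2 * Real.cos (2 * w * q.1))

def V₃ (w : ℝ) : VField := fun q =>
  (Real.cos (2 * w * q.1), -(w * q.2 * Real.sin (2 * w * q.1)))

def V₄ (w : ℝ) : VField := fun q =>
  (q.2 * Real.sin (w * q.1), w * q.2 ^ 2 * Real.cos (w * q.1))

def V₅ (w : ℝ) : VField := fun q =>
  (q.2 * Real.cos (w * q.1), -(w * q.2 ^ 2 * Real.sin (w * q.1)))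

/-! Their real forms for `l < 0`, with `w = √(-l)`, so that `√l` is `w` times the imaginary
unit. -/

def H₂ (w : ℝ) : VField := fun q =>
  (Real.sinh (2 * w * q.1), w * q.2 * Real.cosh (2 * w * q.1))

def H₃ (w : ℝ) : VField := fun q =>
  (Real.cosh (2 * w * q.1), w * q.2 * Real.sinh (2 * w * q.1))

def H₄ (w : ℝ) : VField := fun q =>
  (q.2 * Real.sinh (w * q.1), w * q.2 ^ 2 * Real.cosh (w * q.1))

def H₅ (w : ℝ) : VField := fun q =>
  (q.2 * Real.cosh (w * q.1), w * q.2 ^ 2 * Real.sinh (w * q.1))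

/-- `β` is, on `I`, a (smooth) solution of `β⁽²ⁿ⁾ + l β = 0`. -/
def IsLinSolution (n : ℕ) (I : Set ℝ) (l : ℝ) (β : ℝ → ℝ) : Prop :=
  ContDiffOn ℝ ∞ β I ∧ ∀ x ∈ I, iteratedDeriv (2 * n) β x + l * β x = 0

/-- The functions `b j` form a basis of the space of solutions of `β⁽²ⁿ⁾ + l β = 0` on `I`. -/
def IsSolutionBasis (n : ℕ) (I : Set ℝ) (l : ℝ) {ι : Type} (b : ι → ℝ → ℝ) : Prop :=
  LinearIndependent ℝ (fun j => I.domRestrict (b j)) ∧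
    ∀ β : ℝ → ℝ, IsLinSolution n I l β ↔
      ∃ γ ∈ Submodule.span ℝ (Set.range b), Set.EqOn β γ I

/-- The special nonlinearities of the classification, on `J`. -/
def IsListed (J : Set ℝ) (f : ℝ → ℝ) : Prop :=
  (∃ l a : ℝ, l ≠ 0 ∧ a ≠ 0 ∧ ∀ y ∈ J, f y = l * Real.exp (a * y)) ∨
  (∃ (l p : ℝ) (g : ℝ → ℝ), l ≠ 0 ∧ p ≠ 0 ∧ p ≠ 1 ∧ IsPowerBranch J p g ∧
    ∀ y ∈ J, f y = l * g y) ∨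
  (∃ l : ℝ, ∀ y ∈ J, f y = l) ∨
  (∃ l : ℝ, l ≠ 0 ∧ ∀ y ∈ J, f y = l * y)

/-- The nonlinearities `k y + l y⁻³` with `k, l ≠ 0` (Ermakov–Pinney), on `J`. -/
def IsErmakovPinney (J : Set ℝ) (f : ℝ → ℝ) : Prop :=
  ∃ k l : ℝ, k ≠ 0 ∧ l ≠ 0 ∧ ∀ y ∈ J, y ≠ 0 ∧ f y = k * y + l * (y ^ 3)⁻¹

/-- Up to an equivalence transformation `x ↦ a₁ x + a₂`, `y ↦ b₁ y + b₂`,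
`f ↦ (b₁ / a₁²ⁿ) f`, the function `f` on `J` has the property `P`. -/
def UpToEquiv (n : ℕ) (P : Set ℝ → (ℝ → ℝ) → Prop) (J : Set ℝ) (f : ℝ → ℝ) : Prop :=
  ∃ (a₁ b₁ b₂ : ℝ) (g : ℝ → ℝ), a₁ ≠ 0 ∧ b₁ ≠ 0 ∧
    (∀ y ∈ J, g (b₁ * y + b₂) = b₁ / a₁ ^ (2 * n) * f y) ∧
    P ((fun y => b₁ * y + b₂) '' J) g

end LieSym

end

/-! The left-hand side F is affine in u_{2n}, and so is the prolongation coefficient ζ_{2n} = A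
u_{2n} + B, with A and B of order at most 2n-1. Restricting to u_{2n} = -f(u_0) shows that XF = αF
is solvable for α exactly when B + η f' = A f on all jets (`isGenerator_iff_of_zeta_eq`). To find A
and B, the total derivative is treated as the ordinary derivative along the line t ↦ (x + t, u_k + t
u_{k+1}), so that sum and product rules replace manipulations of partial derivatives.

Coefficients of the jet variables are then compared. For 2n ≥ 4 the coefficient of u_{2n-1} gives
ξ_y = 0, η_yy = 0 and 2η_xy = (2n-1)ξ_xx, and that of u_{2n-2} gives ξ_xxx = 0
(`isGenerator_iff_of_two_le`). For n = 1 the identity is cubic in u_1 and leaves ξ = a y + b, η = a'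
y² + c y + d, together with two equations (`isGenerator_one_iff`). If f is not affine, then a = 0,
and both cases merge into the system `AffineSymmetry` for b(x), c(x), d(x): 2c' = (2n-1)b'', c'' y +
d^{(2n)} + (c y + d) f' = (c - 2n b') f, and b''' = 0 unless n = 1.

For fixed x the second equation is a first order linear equation for f. If c vanishes identically, a
nontrivial field makes f exponential. If c(x) ≠ 0 at some x and c'' = 0, then f is a power centred
at -d/c. If n = 1 and c' ≠ 0 somewhere, the x-derivative of the equation makes f a multiple of (y -
y₀)^{-3} plus a linear term, which is the Ermakov–Pinney case or a pure power. Comparing different x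
removes the remaining inhomogeneous terms; this is where non-affinity of f enters. Conversely, each
special f has an explicit field with a nonzero ∂_y component, also after an equivalence
transformation.

For a given special f the system is solved outright. Exponentials and powers are separated from
polynomials in y by differentiating twice in y. For powers one finds c (p - 1) = -2n b', which is
compatible with 2c' = (2n-1)b'' and b'' ≠ 0 only for p = (1+2n)/(1-2n). For f = λ and f = λy the
identities are polynomial in y, and their coefficients are linear equations with constant
coefficients in x. The solutions of β^{(2n)} + λβ = 0 (of β^{(2n)} = 0 for constant f) enter as an
additive family β(x)∂_y, adjoined by `isSymmetryBasis_sumElim`. -/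

noncomputable section

namespace LieSym

/-! ### Smooth functions on jets and the total derivative as a directional derivative -/

section

variable {I J : Set ℝ}

/-- The part of the jet space of order `m` that lies over `I × J`. -/
def jetDom (I J : Set ℝ) (m : ℕ) : Set (ℝ × (Fin (m + 1) → ℝ)) := {q | q.1 ∈ I ∧ q.2 0 ∈ J}

theorem isOpen_jetDom (hI : IsOpen I) (hJ : IsOpen J) (m : ℕ) : IsOpen (jetDom I J m) :=
  (hI.preimage continuous_fst).inter
    (hJ.preimage ((continuous_apply 0).comp continuous_snd))

/-- `g` is, over `I × J`, a smooth function of `x, u 0, …, u m`. -/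
def SmoothJet (I J : Set ℝ) (m : ℕ) (g : JetFun) : Prop :=
  ∃ r : ℝ × (Fin (m + 1) → ℝ) → ℝ, ContDiffOn ℝ ∞ r (jetDom I J m) ∧
    ∀ x ∈ I, ∀ u : ℕ → ℝ, u 0 ∈ J → g x u = r (x, fun i => u i)

/-- `g'` is, over `I × J`, the total derivative of `g`, taken along the lines tangent to the
prolonged curves. -/
def HasTotalD (I J : Set ℝ) (g g' : JetFun) : Prop :=
  ∀ x ∈ I, ∀ u : ℕ → ℝ, u 0 ∈ J →
    HasDerivAt (fun t => g (x + t) (fun k => u k + t * u (k + 1))) (g' x u) 0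

theorem SmoothJet.mono {m M : ℕ} {g : JetFun} (h : SmoothJet I J m g) (hm : m ≤ M) :
    SmoothJet I J M g := by
  obtain ⟨r, hr, hg⟩ := h
  refine ⟨fun q => r (q.1, fun i => q.2 (Fin.castLE (by omega) i)), ?_, fun x hx u hu => ?_⟩
  · refine hr.comp (t := jetDom I J m) ?_ ?_
    · apply ContDiff.contDiffOn
      fun_prop
    · intro q hq
      exact hq
  · simpa using hg x hx u hu

theorem SmoothJet.add {m : ℕ} {g h : JetFun} (hg : SmoothJet I J m g) (hh : SmoothJet I J m h) :
    SmoothJet I J m (fun x u => g x u + h x u) := by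
  obtain ⟨r, hr, hr'⟩ := hg
  obtain ⟨s, hs, hs'⟩ := hh
  exact ⟨fun q => r q + s q, hr.add hs, fun x hx u hu => by simp only [hr' x hx u hu, hs' x hx u hu]⟩

theorem SmoothJet.sub {m : ℕ} {g h : JetFun} (hg : SmoothJet I J m g) (hh : SmoothJet I J m h) :
    SmoothJet I J m (fun x u => g x u - h x u) := by
  obtain ⟨r, hr, hr'⟩ := hg
  obtain ⟨s, hs, hs'⟩ := hh
  exact ⟨fun q => r q - s q, hr.sub hs, fun x hx u hu => by simp only [hr' x hx u hu, hs' x hx u hu]⟩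

theorem SmoothJet.mul {m : ℕ} {g h : JetFun} (hg : SmoothJet I J m g) (hh : SmoothJet I J m h) :
    SmoothJet I J m (fun x u => g x u * h x u) := by
  obtain ⟨r, hr, hr'⟩ := hg
  obtain ⟨s, hs, hs'⟩ := hh
  exact ⟨fun q => r q * s q, hr.mul hs, fun x hx u hu => by simp only [hr' x hx u hu, hs' x hx u hu]⟩

theorem smoothJet_const (m : ℕ) (a : ℝ) : SmoothJet I J m (fun _ _ => a) :=
  ⟨fun _ => a, contDiffOn_const, fun _ _ _ _ => rfl⟩

theorem smoothJet_coord {i m : ℕ} (h : i ≤ m) : SmoothJet I J m (fun _ u => u i) :=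
  ⟨fun q => q.2 ⟨i, by omega⟩, by apply ContDiff.contDiffOn; fun_prop, fun _ _ _ _ => rfl⟩

theorem smoothJet_base {φ : ℝ × ℝ → ℝ} (hφ : ContDiffOn ℝ ∞ φ (I ×ˢ J)) (m : ℕ) :
    SmoothJet I J m (fun x u => φ (x, u 0)) :=
  ⟨fun q => φ (q.1, q.2 0),
    hφ.comp (t := I ×ˢ J) (by apply ContDiff.contDiffOn; fun_prop) (fun _ hq => hq),
    fun _ _ _ _ => rfl⟩

theorem smoothJet_fun {b : ℝ → ℝ} (hb : ContDiffOn ℝ ∞ b I) (m : ℕ) :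
    SmoothJet I J m (fun x _ => b x) :=
  ⟨fun q => b q.1, hb.comp (t := I) contDiff_fst.contDiffOn (fun _ hq => hq.1),
    fun _ _ _ _ => rfl⟩

theorem HasTotalD.add {g h g' h' : JetFun} (hg : HasTotalD I J g g') (hh : HasTotalD I J h h') :
    HasTotalD I J (fun x u => g x u + h x u) (fun x u => g' x u + h' x u) :=
  fun x hx u hu => (hg x hx u hu).add (hh x hx u hu)

theorem HasTotalD.sub {g h g' h' : JetFun} (hg : HasTotalD I J g g') (hh : HasTotalD I J h h') :
    HasTotalD I J (fun x u => g x u - h x u) (fun x u => g' x u - h' x u) :=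
  fun x hx u hu => (hg x hx u hu).sub (hh x hx u hu)

theorem HasTotalD.mul {g h g' h' : JetFun} (hg : HasTotalD I J g g') (hh : HasTotalD I J h h') :
    HasTotalD I J (fun x u => g x u * h x u) (fun x u => g' x u * h x u + g x u * h' x u) := by
  intro x hx u hu
  simpa using (hg x hx u hu).fun_mul (hh x hx u hu)

theorem HasTotalD.const_mul (a : ℝ) {g g' : JetFun} (hg : HasTotalD I J g g') :
    HasTotalD I J (fun x u => a * g x u) (fun x u => a * g' x u) :=
  fun x hx u hu => (hg x hx u hu).const_mul a

theorem hasTotalD_coord (i : ℕ) : HasTotalD I J (fun _ u => u i) (fun _ u => u (i + 1)) := by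
  intro x hx u hu
  simpa using ((hasDerivAt_id (0 : ℝ)).mul_const (u (i + 1))).const_add (u i)

theorem hasTotalD_fun (hI : IsOpen I) {b : ℝ → ℝ} (hb : ContDiffOn ℝ ∞ b I) :
    HasTotalD I J (fun x _ => b x) (fun x _ => deriv b x) := by
  intro x hx u hu
  have h : HasDerivAt b (deriv b x) (x + 0) := by
    rw [add_zero]
    exact ((hb.contDiffAt (hI.mem_nhds hx)).differentiableAt (by simp)).hasDerivAt
  simpa using h.comp_const_add x 0

theorem eventually_line_mem (hI : IsOpen I) (hJ : IsOpen J) {x : ℝ} (hx : x ∈ I) {u : ℕ → ℝ}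
    (hu : u 0 ∈ J) : ∀ᶠ t in nhds (0 : ℝ), x + t ∈ I ∧ u 0 + t * u (0 + 1) ∈ J := by
  refine Filter.Eventually.and ?_ ?_
  · have : ContinuousAt (fun t : ℝ => x + t) 0 := by fun_prop
    exact this.eventually_mem (hI.mem_nhds (by simpa using hx))
  · have : ContinuousAt (fun t : ℝ => u 0 + t * u (0 + 1)) 0 := by fun_prop
    exact this.eventually_mem (hJ.mem_nhds (by simpa using hu))

theorem HasTotalD.congr (hI : IsOpen I) (hJ : IsOpen J) {g h g' : JetFun}
    (hg : HasTotalD I J g g') (e : ∀ x ∈ I, ∀ u : ℕ → ℝ, u 0 ∈ J → h x u = g x u) :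
    HasTotalD I J h g' := by
  intro x hx u hu
  refine (hg x hx u hu).congr_of_eventuallyEq ?_
  filter_upwards [eventually_line_mem hI hJ hx hu] with t ht
  exact e _ ht.1 _ ht.2

section fderiv

variable {m : ℕ} {g : JetFun} {r : ℝ × (Fin (m + 1) → ℝ) → ℝ}

theorem hasFDerivAt_of_jet (hI : IsOpen I) (hJ : IsOpen J) (hr : ContDiffOn ℝ ∞ r (jetDom I J m))
    {x : ℝ} (hx : x ∈ I) {u : ℕ → ℝ} (hu : u 0 ∈ J) :
    HasFDerivAt r (fderiv ℝ r (x, fun i => u i)) (x, fun i : Fin (m + 1) => u i) :=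
  ((hr.contDiffAt ((isOpen_jetDom hI hJ m).mem_nhds ⟨hx, hu⟩)).differentiableAt
    (by simp)).hasFDerivAt

theorem dX_eq_fderiv (hI : IsOpen I) (hJ : IsOpen J) (hr : ContDiffOn ℝ ∞ r (jetDom I J m))
    (hg : ∀ x ∈ I, ∀ u : ℕ → ℝ, u 0 ∈ J → g x u = r (x, fun i => u i))
    {x : ℝ} (hx : x ∈ I) {u : ℕ → ℝ} (hu : u 0 ∈ J) :
    dX g x u = fderiv ℝ r (x, fun i => u i) (1, 0) := by
  have h := (hasFDerivAt_of_jet hI hJ hr hx hu).comp_hasDerivAt x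
    ((hasDerivAt_id x).prodMk (hasDerivAt_const x (fun i : Fin (m + 1) => u i)))
  refine HasDerivAt.deriv (h.congr_of_eventuallyEq ?_)
  filter_upwards [hI.mem_nhds hx] with t ht
  exact hg t ht u hu

theorem dU_eq_fderiv (hI : IsOpen I) (hJ : IsOpen J) (hr : ContDiffOn ℝ ∞ r (jetDom I J m))
    (hg : ∀ x ∈ I, ∀ u : ℕ → ℝ, u 0 ∈ J → g x u = r (x, fun i => u i))
    {x : ℝ} (hx : x ∈ I) {u : ℕ → ℝ} (hu : u 0 ∈ J) (k : ℕ) :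
    dU k g x u = fderiv ℝ r (x, fun i => u i)
      (0, fun i : Fin (m + 1) => if (i : ℕ) = k then 1 else 0) := by
  have hup : HasDerivAt (fun t => fun i : Fin (m + 1) => Function.update u k t i)
      (fun i : Fin (m + 1) => if (i : ℕ) = k then (1 : ℝ) else 0) (u k) := by
    rw [hasDerivAt_pi]
    intro i
    by_cases hi : (i : ℕ) = k
    · simpa [hi] using hasDerivAt_id' (u k)
    · simpa [hi] using hasDerivAt_const (u k) (u i)
  have h0 : (x, fun i : Fin (m + 1) => u i) =
      (x, fun i : Fin (m + 1) => Function.update u k (u k) i) := by simp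
  have h1 := hasFDerivAt_of_jet hI hJ hr hx hu
  have h := HasFDerivAt.comp_hasDerivAt (u k) (h0 ▸ h1 : HasFDerivAt r
    (fderiv ℝ r (x, fun i => u i)) (x, fun i : Fin (m + 1) => Function.update u k (u k) i))
    ((hasDerivAt_const (u k) x).prodMk hup)
  refine HasDerivAt.deriv (h.congr_of_eventuallyEq ?_)
  have hc : ContinuousAt (fun t : ℝ => Function.update u k t 0) (u k) :=
    ((continuous_apply 0).comp (continuous_const.update (f := fun _ => u) k
      continuous_id)).continuousAt
  filter_upwards [hc.eventually_mem (hJ.mem_nhds (by simpa using hu))] with t ht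
  exact hg x hx _ ht

/-- By linearity the coordinate derivatives recombine into one directional derivative along (1, u_1,
…, u_{m+1}). Summands with k > m vanish because the function does not involve u_k, so every
truncation M ≥ m gives the same value. -/
theorem totalD_eq_fderiv (hI : IsOpen I) (hJ : IsOpen J) (hr : ContDiffOn ℝ ∞ r (jetDom I J m))
    (hg : ∀ x ∈ I, ∀ u : ℕ → ℝ, u 0 ∈ J → g x u = r (x, fun i => u i))
    {x : ℝ} (hx : x ∈ I) {u : ℕ → ℝ} (hu : u 0 ∈ J) {M : ℕ} (hM : m ≤ M) :
    totalD M g x u = fderiv ℝ r (x, fun i => u i) (1, fun i => u (i + 1)) := by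
  rw [totalD, dX_eq_fderiv hI hJ hr hg hx hu]
  simp_rw [dU_eq_fderiv hI hJ hr hg hx hu]
  set L := fderiv ℝ r (x, fun i => u i)
  have : ∀ k, u (k + 1) * L (0, fun i : Fin (m + 1) => if (i : ℕ) = k then 1 else 0) =
      L (0, fun i : Fin (m + 1) => if (i : ℕ) = k then u (k + 1) else 0) := by
    intro k
    rw [← smul_eq_mul, ← map_smul]
    congr 1
    ext i <;> simp
  simp_rw [this]
  rw [← map_sum, ← map_add]
  congr 1
  ext i
  · simp [Prod.fst_sum]
  · have := i.2
    simp only [Prod.snd_add, Prod.snd_sum, Pi.add_apply, Finset.sum_apply, Pi.zero_apply, zero_add]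
    rw [Finset.sum_ite_eq, if_pos (Finset.mem_range.2 (by omega))]

end fderiv

/-- Chain rule along the line in the direction (1, u_1, u_2, …). This links the formal sum in
`totalD` to `HasTotalD`, which inherits the rules of one-variable calculus. -/
theorem SmoothJet.hasTotalD (hI : IsOpen I) (hJ : IsOpen J) {m M : ℕ} {g : JetFun}
    (hg : SmoothJet I J m g) (hM : m ≤ M) : HasTotalD I J g (totalD M g) := by
  obtain ⟨r, hr, hg⟩ := hg
  intro x hx u hu
  rw [totalD_eq_fderiv hI hJ hr hg hx hu hM]
  have hl : HasDerivAt (fun t : ℝ => (x + t, fun i : Fin (m + 1) => u i + t * u (i + 1)))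
      (1, fun i : Fin (m + 1) => u (i + 1)) 0 := by
    refine ((hasDerivAt_id (0 : ℝ)).const_add x).prodMk ?_
    rw [hasDerivAt_pi]
    intro i
    simpa using ((hasDerivAt_id (0 : ℝ)).mul_const (u (i + 1))).const_add (u i)
  have h0 : (x, fun i : Fin (m + 1) => u i) =
      (x + 0, fun i : Fin (m + 1) => u i + 0 * u (i + 1)) := by simp
  have h1 := hasFDerivAt_of_jet hI hJ hr hx hu
  have h := HasFDerivAt.comp_hasDerivAt (0 : ℝ) (h0 ▸ h1 : HasFDerivAt r
    (fderiv ℝ r (x, fun i => u i)) (x + 0, fun i : Fin (m + 1) => u i + 0 * u (i + 1))) hl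
  refine h.congr_of_eventuallyEq ?_
  filter_upwards [eventually_line_mem hI hJ hx hu] with t ht
  exact hg _ ht.1 _ ht.2

/-- Uniqueness of derivatives: whatever expression the sum and product rules produce is the formal
total derivative. -/
theorem SmoothJet.totalD_eq (hI : IsOpen I) (hJ : IsOpen J) {m M : ℕ} {g g' : JetFun}
    (hg : SmoothJet I J m g) (hM : m ≤ M) (hg' : HasTotalD I J g g') {x : ℝ} (hx : x ∈ I)
    {u : ℕ → ℝ} (hu : u 0 ∈ J) : totalD M g x u = g' x u :=
  (hg.hasTotalD hI hJ hM x hx u hu).unique (hg' x hx u hu)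

theorem SmoothJet.totalD (hI : IsOpen I) (hJ : IsOpen J) {m M : ℕ} {g : JetFun}
    (hg : SmoothJet I J m g) (hM : m ≤ M) : SmoothJet I J (m + 1) (totalD M g) := by
  obtain ⟨r, hr, hg⟩ := hg
  refine ⟨fun q => fderiv ℝ r (q.1, fun i => q.2 i.castSucc) (1, fun i => q.2 i.succ), ?_,
    fun x hx u hu => ?_⟩
  · have h1 : ContDiffOn ℝ ∞ (fderiv ℝ r) (jetDom I J m) :=
      hr.fderiv_of_isOpen (isOpen_jetDom hI hJ m) (by simp)
    refine ContDiffOn.clm_apply (h1.comp (t := jetDom I J m) ?_ fun q hq => hq) ?_ <;>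
    · apply ContDiff.contDiffOn
      fun_prop
  · rw [totalD_eq_fderiv hI hJ hr hg hx hu hM]
    rfl

end

/-! ### Partial derivatives on the plane, the prolongation recursion and elimination of the top
derivative -/

section

variable {I J : Set ℝ}

/-- Allows a higher jet coordinate to be varied without affecting terms of lower order; this is how
coefficients are extracted later. -/
theorem SmoothJet.eq_of_agree {m : ℕ} {g : JetFun} (hg : SmoothJet I J m g) {x : ℝ} (hx : x ∈ I)
    {u v : ℕ → ℝ} (hu : u 0 ∈ J) (h : ∀ i ≤ m, u i = v i) : g x u = g x v := by
  obtain ⟨r, -, hr⟩ := hg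
  rw [hr x hx u hu, hr x hx v (h 0 (Nat.zero_le _) ▸ hu)]
  congr 2
  ext i
  exact h i (by omega)

/-- The partial derivative in the first variable. -/
def px (φ : ℝ × ℝ → ℝ) : ℝ × ℝ → ℝ := fun q => deriv (fun t => φ (t, q.2)) q.1

/-- The partial derivative in the second variable. -/
def py (φ : ℝ × ℝ → ℝ) : ℝ × ℝ → ℝ := fun q => deriv (fun t => φ (q.1, t)) q.2

theorem hasFDerivAt_of_contDiffOn {E F : Type*} [NormedAddCommGroup E] [NormedSpace ℝ E]
    [NormedAddCommGroup F] [NormedSpace ℝ F] {φ : E → F} {S : Set E} (hS : IsOpen S)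
    (hφ : ContDiffOn ℝ ∞ φ S) {q : E} (hq : q ∈ S) : HasFDerivAt φ (fderiv ℝ φ q) q :=
  ((hφ.contDiffAt (hS.mem_nhds hq)).differentiableAt (by simp)).hasFDerivAt

theorem hasDerivAt_of_contDiffOn {φ : ℝ → ℝ} {S : Set ℝ} (hS : IsOpen S)
    (hφ : ContDiffOn ℝ ∞ φ S) {t : ℝ} (ht : t ∈ S) : HasDerivAt φ (deriv φ t) t :=
  ((hφ.contDiffAt (hS.mem_nhds ht)).differentiableAt (by simp)).hasDerivAt

theorem contDiffOn_deriv {φ : ℝ → ℝ} {S : Set ℝ} (hS : IsOpen S) (hφ : ContDiffOn ℝ ∞ φ S) :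
    ContDiffOn ℝ ∞ (deriv φ) S :=
  hφ.deriv_of_isOpen hS (by simp)

section partials

variable {φ : ℝ × ℝ → ℝ}

theorem hasDerivAt_px_fderiv (hI : IsOpen I) (hJ : IsOpen J) (hφ : ContDiffOn ℝ ∞ φ (I ×ˢ J))
    {q : ℝ × ℝ} (hq : q ∈ I ×ˢ J) :
    HasDerivAt (fun t => φ (t, q.2)) (fderiv ℝ φ q (1, 0)) q.1 :=
  (hasFDerivAt_of_contDiffOn (hI.prod hJ) hφ hq).comp_hasDerivAt q.1
    ((hasDerivAt_id q.1).prodMk (hasDerivAt_const q.1 q.2))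

theorem hasDerivAt_py_fderiv (hI : IsOpen I) (hJ : IsOpen J) (hφ : ContDiffOn ℝ ∞ φ (I ×ˢ J))
    {q : ℝ × ℝ} (hq : q ∈ I ×ˢ J) :
    HasDerivAt (fun t => φ (q.1, t)) (fderiv ℝ φ q (0, 1)) q.2 :=
  (hasFDerivAt_of_contDiffOn (hI.prod hJ) hφ hq).comp_hasDerivAt q.2
    ((hasDerivAt_const q.2 q.1).prodMk (hasDerivAt_id q.2))

theorem px_eq_fderiv (hI : IsOpen I) (hJ : IsOpen J) (hφ : ContDiffOn ℝ ∞ φ (I ×ˢ J))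
    {q : ℝ × ℝ} (hq : q ∈ I ×ˢ J) : px φ q = fderiv ℝ φ q (1, 0) :=
  (hasDerivAt_px_fderiv hI hJ hφ hq).deriv

theorem py_eq_fderiv (hI : IsOpen I) (hJ : IsOpen J) (hφ : ContDiffOn ℝ ∞ φ (I ×ˢ J))
    {q : ℝ × ℝ} (hq : q ∈ I ×ˢ J) : py φ q = fderiv ℝ φ q (0, 1) :=
  (hasDerivAt_py_fderiv hI hJ hφ hq).deriv

theorem hasDerivAt_py (hI : IsOpen I) (hJ : IsOpen J) (hφ : ContDiffOn ℝ ∞ φ (I ×ˢ J))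
    {x y : ℝ} (hx : x ∈ I) (hy : y ∈ J) : HasDerivAt (fun t => φ (x, t)) (py φ (x, y)) y :=
  (hasDerivAt_py_fderiv hI hJ hφ (q := (x, y)) ⟨hx, hy⟩).differentiableAt.hasDerivAt

theorem contDiffOn_px (hI : IsOpen I) (hJ : IsOpen J) (hφ : ContDiffOn ℝ ∞ φ (I ×ˢ J)) :
    ContDiffOn ℝ ∞ (px φ) (I ×ˢ J) :=
  ((hφ.fderiv_of_isOpen (hI.prod hJ) (by simp)).clm_apply contDiffOn_const).congr
    fun _ hq => px_eq_fderiv hI hJ hφ hq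

theorem contDiffOn_py (hI : IsOpen I) (hJ : IsOpen J) (hφ : ContDiffOn ℝ ∞ φ (I ×ˢ J)) :
    ContDiffOn ℝ ∞ (py φ) (I ×ˢ J) :=
  ((hφ.fderiv_of_isOpen (hI.prod hJ) (by simp)).clm_apply contDiffOn_const).congr
    fun _ hq => py_eq_fderiv hI hJ hφ hq

theorem px_py_comm (hI : IsOpen I) (hJ : IsOpen J) (hφ : ContDiffOn ℝ ∞ φ (I ×ˢ J))
    {q : ℝ × ℝ} (hq : q ∈ I ×ˢ J) : px (py φ) q = py (px φ) q := by
  have hS := hI.prod hJ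
  have hd : HasFDerivAt (fderiv ℝ φ) (fderiv ℝ (fderiv ℝ φ) q) q :=
    hasFDerivAt_of_contDiffOn hS (hφ.fderiv_of_isOpen hS (by simp)) hq
  have e : ∀ (ψ : ℝ × ℝ → ℝ) (v : ℝ × ℝ), (∀ p ∈ I ×ˢ J, ψ p = fderiv ℝ φ p v) →
      fderiv ℝ ψ q = (fderiv ℝ (fderiv ℝ φ) q).flip v := by
    intro ψ v hψ
    refine HasFDerivAt.fderiv ?_
    refine HasFDerivAt.congr_of_eventuallyEq (f := fun p => fderiv ℝ φ p v) ?_ ?_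
    · exact (hd.clm_apply (hasFDerivAt_const v q)).congr_fderiv (by ext <;> simp)
    · filter_upwards [hS.mem_nhds hq] with p hp
      exact hψ p hp
  have hsymm : IsSymmSndFDerivAt ℝ φ q :=
    (hφ.contDiffAt (hS.mem_nhds hq)).isSymmSndFDerivAt
      (by simpa using WithTop.coe_le_coe.2 (le_top (a := (2 : ℕ∞))))
  rw [px_eq_fderiv hI hJ (contDiffOn_py hI hJ hφ) hq, py_eq_fderiv hI hJ (contDiffOn_px hI hJ hφ) hq,
    e _ _ fun p hp => py_eq_fderiv hI hJ hφ hp, e _ _ fun p hp => px_eq_fderiv hI hJ hφ hp]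
  exact hsymm _ _

theorem hasTotalD_base (hI : IsOpen I) (hJ : IsOpen J) (hφ : ContDiffOn ℝ ∞ φ (I ×ˢ J)) :
    HasTotalD I J (fun x u => φ (x, u 0)) (fun x u => px φ (x, u 0) + u 1 * py φ (x, u 0)) := by
  intro x hx u hu
  have hl : HasDerivAt (fun t : ℝ => (x + t, u 0 + t * u (0 + 1))) (1, u 1) 0 := by
    refine ((hasDerivAt_id (0 : ℝ)).const_add x).prodMk ?_
    simpa using ((hasDerivAt_id (0 : ℝ)).mul_const (u 1)).const_add (u 0)
  have h0 : (x, u 0) = (x + 0, u 0 + 0 * u (0 + 1)) := by simp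
  have hq : (x, u 0) ∈ I ×ˢ J := ⟨hx, hu⟩
  have h1 := hasFDerivAt_of_contDiffOn (hI.prod hJ) hφ hq
  have h := HasFDerivAt.comp_hasDerivAt (0 : ℝ) (h0 ▸ h1 : HasFDerivAt φ
    (fderiv ℝ φ (x, u 0)) (x + 0, u 0 + 0 * u (0 + 1))) hl
  have e : px φ (x, u 0) + u 1 * py φ (x, u 0) = fderiv ℝ φ (x, u 0) (1, u 1) := by
    rw [px_eq_fderiv hI hJ hφ hq, py_eq_fderiv hI hJ hφ hq, ← smul_eq_mul, ← map_smul, ← map_add]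
    simp
  show HasDerivAt _ (px φ (x, u 0) + u 1 * py φ (x, u 0)) 0
  rw [e]
  exact h

end partials

section zeta

variable {X : VField}

theorem smoothJet_zeta (hI : IsOpen I) (hJ : IsOpen J) (hX : ContDiffOn ℝ ∞ X (I ×ˢ J)) (k : ℕ) :
    SmoothJet I J k (zeta X k) := by
  induction k with
  | zero => exact smoothJet_base (φ := fun q => (X q).2) hX.snd 0
  | succ k ih =>
    exact (ih.totalD hI hJ le_rfl).sub ((smoothJet_coord le_rfl).mul
      (((smoothJet_base (φ := fun q => (X q).1) hX.fst 0).totalD hI hJ le_rfl).mono (by omega)))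

/-- The working form of the recursion: once ζ_k is known on the domain as some expression `g`, its
total derivative may be computed by the rules for `HasTotalD`. -/
theorem zeta_succ_eq (hI : IsOpen I) (hJ : IsOpen J) (hX : ContDiffOn ℝ ∞ X (I ×ˢ J)) {k : ℕ}
    {g g' : JetFun} (e : ∀ x ∈ I, ∀ u : ℕ → ℝ, u 0 ∈ J → zeta X k x u = g x u)
    (hg : HasTotalD I J g g') {x : ℝ} (hx : x ∈ I) {u : ℕ → ℝ} (hu : u 0 ∈ J) :
    zeta X (k + 1) x u = g' x u - u (k + 1) *
      (px (fun q => (X q).1) (x, u 0) + u 1 * py (fun q => (X q).1) (x, u 0)) := by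
  have h1 := (smoothJet_zeta hI hJ hX k).totalD_eq hI hJ le_rfl (hg.congr hI hJ e) hx hu
  have h2 := (smoothJet_base (φ := fun q => (X q).1) hX.fst 0).totalD_eq hI hJ le_rfl
    (hasTotalD_base hI hJ hX.fst) hx hu
  exact congrArg₂ (fun r s => r - u (k + 1) * s) h1 h2

/-- Only u_0 and u_{2n} occur in the equation, and n ≥ 1 makes them distinct coordinates, so two
terms of the prolongation survive. -/
theorem prolong_eqn {n : ℕ} (hn : 1 ≤ n) (f : ℝ → ℝ) (x : ℝ) (u : ℕ → ℝ) :
    prolong (2 * n) X (eqn n f) x u = zeta X (2 * n) x u + (X (x, u 0)).2 * deriv f (u 0) := by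
  have h0 : dX (eqn n f) x u = 0 := by simp [dX, eqn]
  have h1 : dU 0 (eqn n f) x u = deriv f (u 0) := by
    have : 2 * n ≠ 0 := by omega
    simp [dU, eqn, Function.update_of_ne this]
  have h2 : dU (2 * n) (eqn n f) x u = 1 := by
    have : 0 ≠ 2 * n := by omega
    simp [dU, eqn, Function.update_of_ne this]
  have h3 : ∀ k ∈ Finset.range (2 * n + 1), k ≠ 0 ∧ k ≠ 2 * n →
      zeta X k x u * dU k (eqn n f) x u = 0 := by
    intro k _ hk
    simp [dU, eqn, Function.update_of_ne hk.1.symm, Function.update_of_ne hk.2.symm]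
  rw [prolong, h0, Finset.sum_eq_add 0 (2 * n) (by omega) h3 (by simp) (by simp), h1, h2]
  simp [zeta, etaFun, add_comm]

/-- On the jets with u_{2n} = -f(u_0) the right-hand side αF vanishes, while `A` and `B` do not
notice the change of u_{2n}; this gives the condition. Conversely the condition says precisely that
XF = A F, so `A` itself serves as the multiplier α. -/
theorem isGenerator_iff_of_zeta_eq {n : ℕ} (hn : 1 ≤ n)
    (hX : ContDiffOn ℝ ∞ X (I ×ˢ J)) {A B : JetFun} (hA : SmoothJet I J (2 * n - 1) A)
    (hB : SmoothJet I J (2 * n - 1) B)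
    (e : ∀ x ∈ I, ∀ u : ℕ → ℝ, u 0 ∈ J → zeta X (2 * n) x u = A x u * u (2 * n) + B x u)
    (f : ℝ → ℝ) :
    IsGenerator n I J f X ↔ ∀ x ∈ I, ∀ u : ℕ → ℝ, u 0 ∈ J →
      B x u + (X (x, u 0)).2 * deriv f (u 0) = A x u * f (u 0) := by
  constructor
  · rintro ⟨-, α, -, hα⟩ x hx u hu
    have h0 : 0 ≠ 2 * n := by omega
    set v := Function.update u (2 * n) (-f (u 0)) with hv
    have hv0 : v 0 = u 0 := Function.update_of_ne h0 _ _
    have hvN : v (2 * n) = -f (u 0) := Function.update_self _ _ _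
    have hag : ∀ i ≤ 2 * n - 1, v i = u i := fun i hi =>
      Function.update_of_ne (by omega) _ _
    have hvJ : v 0 ∈ J := hv0 ▸ hu
    have h := hα x hx v hvJ
    rw [prolong_eqn hn, e x hx v hvJ, hA.eq_of_agree hx hvJ hag, hB.eq_of_agree hx hvJ hag,
      eqn, hvN, hv0] at h
    linear_combination h
  · intro h
    obtain ⟨r, hr, hr'⟩ := hA.mono (M := 2 * n) (by omega)
    refine ⟨hX, r, hr, fun x hx u hu => ?_⟩
    rw [prolong_eqn hn, e x hx u hu, ← hr' x hx u hu, eqn]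
    linear_combination h x hx u hu

end zeta

end

/-! ### Leading terms of the prolongation of a general vector field -/

section

variable {I J : Set ℝ} {X : VField}

theorem zeta_one_eq (hI : IsOpen I) (hJ : IsOpen J) (hX : ContDiffOn ℝ ∞ X (I ×ˢ J))
    {ξ η : ℝ × ℝ → ℝ} (hξ : (fun q => (X q).1) = ξ) (hη : (fun q => (X q).2) = η)
    {x : ℝ} (hx : x ∈ I) {u : ℕ → ℝ} (hu : u 0 ∈ J) :
    zeta X 1 x u = px η (x, u 0) + u 1 * py η (x, u 0)
      - u 1 * (px ξ (x, u 0) + u 1 * py ξ (x, u 0)) := by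
  subst hξ hη
  exact zeta_succ_eq (k := 0) hI hJ hX (fun _ _ _ _ => rfl) (hasTotalD_base hI hJ hX.snd) hx hu

theorem zeta_two_eq (hI : IsOpen I) (hJ : IsOpen J) (hX : ContDiffOn ℝ ∞ X (I ×ˢ J))
    {ξ η : ℝ × ℝ → ℝ} (hξ : (fun q => (X q).1) = ξ) (hη : (fun q => (X q).2) = η)
    {x : ℝ} (hx : x ∈ I) {u : ℕ → ℝ} (hu : u 0 ∈ J) :
    zeta X 2 x u = (py η (x, u 0) - 2 * px ξ (x, u 0) - 3 * (u 1 * py ξ (x, u 0))) * u 2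
      + (px (px η) (x, u 0) + u 1 * (2 * px (py η) (x, u 0) - px (px ξ) (x, u 0))
        + u 1 * (u 1 * (py (py η) (x, u 0) - 2 * px (py ξ) (x, u 0)))
        - u 1 * (u 1 * (u 1 * py (py ξ) (x, u 0)))) := by
  have hξs : ContDiffOn ℝ ∞ ξ (I ×ˢ J) := hξ ▸ hX.fst
  have hηs : ContDiffOn ℝ ∞ η (I ×ˢ J) := hη ▸ hX.snd
  have bx {φ : ℝ × ℝ → ℝ} (h : ContDiffOn ℝ ∞ φ (I ×ˢ J)) :=
    hasTotalD_base hI hJ (contDiffOn_px hI hJ h)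
  have by' {φ : ℝ × ℝ → ℝ} (h : ContDiffOn ℝ ∞ φ (I ×ˢ J)) :=
    hasTotalD_base hI hJ (contDiffOn_py hI hJ h)
  have h := zeta_succ_eq (k := 1) hI hJ hX (fun x hx u hu => zeta_one_eq hI hJ hX hξ hη hx hu)
    (((bx hηs).add ((hasTotalD_coord 1).mul (by' hηs))).sub
      ((hasTotalD_coord 1).mul ((bx hξs).add ((hasTotalD_coord 1).mul (by' hξs))))) hx hu
  rw [h, hξ, ← px_py_comm hI hJ hηs (show (x, u 0) ∈ I ×ˢ J from ⟨hx, hu⟩),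
    ← px_py_comm hI hJ hξs (show (x, u 0) ∈ I ×ˢ J from ⟨hx, hu⟩)]
  ring

/-- Start of the induction in `zeta_eq`. Order three is separate because u_2 there is both the
second highest derivative and the partner of ξ_y, so the term in u_2² contributes twice to the next
total derivative. -/
theorem zeta_three_eq (hI : IsOpen I) (hJ : IsOpen J) (hX : ContDiffOn ℝ ∞ X (I ×ˢ J))
    {ξ η : ℝ × ℝ → ℝ} (hξ : (fun q => (X q).1) = ξ) (hη : (fun q => (X q).2) = η) :
    ∃ R : JetFun, SmoothJet I J 1 R ∧ ∀ x ∈ I, ∀ u : ℕ → ℝ, u 0 ∈ J →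
    zeta X 3 x u = (py η (x, u 0) - 3 * px ξ (x, u 0) - 4 * (u 1 * py ξ (x, u 0))) * u 3
      + (3 * (px (py η) (x, u 0) + u 1 * py (py η) (x, u 0))
        - 3 * (px (px ξ) (x, u 0) + 2 * (u 1 * px (py ξ) (x, u 0))
          + u 1 * (u 1 * py (py ξ) (x, u 0)))
        - 3 * (u 1 * (px (py ξ) (x, u 0) + u 1 * py (py ξ) (x, u 0)))
        - 3 * (u 2 * py ξ (x, u 0))) * u 2 + R x u := by
  have hξs : ContDiffOn ℝ ∞ ξ (I ×ˢ J) := hξ ▸ hX.fst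
  have hηs : ContDiffOn ℝ ∞ η (I ×ˢ J) := hη ▸ hX.snd
  have cx {φ : ℝ × ℝ → ℝ} (h : ContDiffOn ℝ ∞ φ (I ×ˢ J)) := contDiffOn_px hI hJ h
  have cy {φ : ℝ × ℝ → ℝ} (h : ContDiffOn ℝ ∞ φ (I ×ˢ J)) := contDiffOn_py hI hJ h
  have td {φ : ℝ × ℝ → ℝ} (h : ContDiffOn ℝ ∞ φ (I ×ˢ J)) := hasTotalD_base hI hJ h
  have sm {φ : ℝ × ℝ → ℝ} (h : ContDiffOn ℝ ∞ φ (I ×ˢ J)) := smoothJet_base h 1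
  have sc : SmoothJet I J 1 fun _ u => u 1 := smoothJet_coord le_rfl
  have sd {φ : ℝ × ℝ → ℝ} (h : ContDiffOn ℝ ∞ φ (I ×ˢ J)) :=
    (sm (cx h)).add (sc.mul (sm (cy h)))
  have tc (i : ℕ) : HasTotalD I J (fun _ u => u i) (fun _ u => u (i + 1)) := hasTotalD_coord i
  have s2 := (smoothJet_const (I := I) (J := J) 1 2)
  have t1 := ((td (cy hηs)).sub ((td (cx hξs)).const_mul 2)).sub
    (((tc 1).mul (td (cy hξs))).const_mul 3)
  have t2 := (((td (cx (cx hηs))).add ((tc 1).mul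
    (((td (cx (cy hηs))).const_mul 2).sub (td (cx (cx hξs)))))).add
    ((tc 1).mul ((tc 1).mul ((td (cy (cy hηs))).sub ((td (cx (cy hξs))).const_mul 2))))).sub
    ((tc 1).mul ((tc 1).mul ((tc 1).mul (td (cy (cy hξs))))))
  have s3 := (((sd (cx (cx hηs))).add (sc.mul
    ((s2.mul (sd (cx (cy hηs)))).sub (sd (cx (cx hξs)))))).add
    (sc.mul (sc.mul ((sd (cy (cy hηs))).sub (s2.mul (sd (cx (cy hξs)))))))).sub
    (sc.mul (sc.mul (sc.mul (sd (cy (cy hξs))))))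
  refine ⟨_, s3, fun x hx u hu => ?_⟩
  have h := zeta_succ_eq (k := 2) hI hJ hX (fun x hx u hu => zeta_two_eq hI hJ hX hξ hη hx hu)
    ((t1.mul (tc 2)).add t2) hx hu
  rw [h, hξ, ← px_py_comm hI hJ hξs (show (x, u 0) ∈ I ×ˢ J from ⟨hx, hu⟩)]
  ring

/-- The two highest derivatives in ζ_{m+4} are isolated and all else is put into `R`. The exact
value of `β` is irrelevant: its positivity is what later forces ξ_y = 0 from the term in u_2
u_{m+3}. -/
theorem zeta_eq (hI : IsOpen I) (hJ : IsOpen J) (hX : ContDiffOn ℝ ∞ X (I ×ˢ J))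
    {ξ η : ℝ × ℝ → ℝ} (hξ : (fun q => (X q).1) = ξ) (hη : (fun q => (X q).2) = η) (m : ℕ) :
    ∃ (β : ℝ) (R : JetFun), 0 < β ∧ SmoothJet I J (m + 2) R ∧ ∀ x ∈ I, ∀ u : ℕ → ℝ, u 0 ∈ J →
    zeta X (m + 4) x u =
      (py η (x, u 0) - (m + 4) * px ξ (x, u 0) - (m + 5) * (u 1 * py ξ (x, u 0))) * u (m + 4)
      + ((m + 4) * (px (py η) (x, u 0) + u 1 * py (py η) (x, u 0))
        - (m + 4) * (m + 3) / 2 * (px (px ξ) (x, u 0) + 2 * (u 1 * px (py ξ) (x, u 0))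
          + u 1 * (u 1 * py (py ξ) (x, u 0)))
        - (m + 4) * (u 1 * (px (py ξ) (x, u 0) + u 1 * py (py ξ) (x, u 0)))
        - β * (u 2 * py ξ (x, u 0))) * u (m + 3) + R x u := by
  have hξs : ContDiffOn ℝ ∞ ξ (I ×ˢ J) := hξ ▸ hX.fst
  have hηs : ContDiffOn ℝ ∞ η (I ×ˢ J) := hη ▸ hX.snd
  have cx {φ : ℝ × ℝ → ℝ} (h : ContDiffOn ℝ ∞ φ (I ×ˢ J)) := contDiffOn_px hI hJ h
  have cy {φ : ℝ × ℝ → ℝ} (h : ContDiffOn ℝ ∞ φ (I ×ˢ J)) := contDiffOn_py hI hJ h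
  have td {φ : ℝ × ℝ → ℝ} (h : ContDiffOn ℝ ∞ φ (I ×ˢ J)) := hasTotalD_base hI hJ h
  have sm {φ : ℝ × ℝ → ℝ} (h : ContDiffOn ℝ ∞ φ (I ×ˢ J)) := smoothJet_base h 1
  have sc : SmoothJet I J 1 fun _ u => u 1 := smoothJet_coord le_rfl
  have sk (a : ℝ) := smoothJet_const (I := I) (J := J) 1 a
  have tc (i : ℕ) : HasTotalD I J (fun _ u => u i) (fun _ u => u (i + 1)) := hasTotalD_coord i
  have sp (k l : ℝ) := (((sk k).mul ((sm (cx (cy hηs))).add (sc.mul (sm (cy (cy hηs)))))).sub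
    ((sk l).mul (((sm (cx (cx hξs))).add ((sk 2).mul (sc.mul (sm (cx (cy hξs)))))).add
      (sc.mul (sc.mul (sm (cy (cy hξs)))))))).sub
    ((sk k).mul (sc.mul ((sm (cx (cy hξs))).add (sc.mul (sm (cy (cy hξs)))))))
  have tA (k : ℝ) := ((td (cy hηs)).sub ((td (cx hξs)).const_mul k)).sub
    (((tc 1).mul (td (cy hξs))).const_mul (k + 1))
  induction m with
  | zero =>
    obtain ⟨R, hR, h3⟩ := zeta_three_eq hI hJ hX hξ hη
    have hp := sp 3 3
    have tp := (hp.hasTotalD hI hJ le_rfl).sub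
      (((tc 2).mul (td (cy hξs))).const_mul 3)
    -- 10 = 4 + 3 + 3: from -4 u_1 ξ_y u_3 when u_1 is differentiated, and from the two factors of
    -- -3 u_2² ξ_y.
    refine ⟨10, fun x u => totalD 1 _ x u * u 2
      - 3 * (u 2 * (u 2 * (px (py ξ) (x, u 0) + u 1 * py (py ξ) (x, u 0)))) + totalD 1 R x u,
      by norm_num, (((hp.totalD hI hJ le_rfl).mul (smoothJet_coord le_rfl)).sub
      ((smoothJet_const _ 3).mul ((smoothJet_coord le_rfl).mul ((smoothJet_coord le_rfl).mul
      ((smoothJet_base (cx (cy hξs)) 2).add ((smoothJet_coord (by norm_num)).mul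
        (smoothJet_base (cy (cy hξs)) 2))))))).add (hR.totalD hI hJ le_rfl),
      fun x hx u hu => ?_⟩
    have h := zeta_succ_eq (k := 3) hI hJ hX (g := fun x u =>
      (py η (x, u 0) - 3 * px ξ (x, u 0) - (3 + 1) * (u 1 * py ξ (x, u 0))) * u 3
      + (3 * (px (py η) (x, u 0) + u 1 * py (py η) (x, u 0))
        - 3 * (px (px ξ) (x, u 0) + 2 * (u 1 * px (py ξ) (x, u 0))
          + u 1 * (u 1 * py (py ξ) (x, u 0)))
        - 3 * (u 1 * (px (py ξ) (x, u 0) + u 1 * py (py ξ) (x, u 0)))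
        - 3 * (u 2 * py ξ (x, u 0))) * u 2 + R x u)
      (fun x hx u hu => (h3 x hx u hu).trans (by ring))
      ((((tA 3).mul (tc 3)).add (tp.mul (tc 2))).add (hR.hasTotalD hI hJ le_rfl)) hx hu
    rw [Nat.zero_add, h, hξ, ← px_py_comm hI hJ hξs (show (x, u 0) ∈ I ×ˢ J from ⟨hx, hu⟩)]
    push_cast
    ring
  | succ m ih =>
    obtain ⟨β, R, hβ, hR, ih⟩ := ih
    have hP := ((sp (m + 4) ((m + 4) * (m + 3) / 2)).mono (M := 2) (by norm_num)).sub
      ((smoothJet_const 2 β).mul ((smoothJet_coord (i := 2) le_rfl).mul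
        (smoothJet_base (cy hξs) 2)))
    -- The increment m + 5 comes from differentiating u_1 in the leading term -(m+5) u_1 ξ_y
    -- u_{m+4}.
    refine ⟨β + m + 5, fun x u => totalD 2 _ x u * u (m + 3) + totalD (m + 2) R x u,
      by positivity, (((hP.totalD hI hJ le_rfl).mono (by omega)).mul (smoothJet_coord le_rfl)).add
      (hR.totalD hI hJ le_rfl), fun x hx u hu => ?_⟩
    have h := zeta_succ_eq (k := m + 4) hI hJ hX (g := fun x u =>
      (py η (x, u 0) - (m + 4) * px ξ (x, u 0) - (m + 4 + 1) * (u 1 * py ξ (x, u 0))) * u (m + 4)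
      + ((m + 4) * (px (py η) (x, u 0) + u 1 * py (py η) (x, u 0))
        - (m + 4) * (m + 3) / 2 * (px (px ξ) (x, u 0) + 2 * (u 1 * px (py ξ) (x, u 0))
          + u 1 * (u 1 * py (py ξ) (x, u 0)))
        - (m + 4) * (u 1 * (px (py ξ) (x, u 0) + u 1 * py (py ξ) (x, u 0)))
        - β * (u 2 * py ξ (x, u 0))) * u (m + 3) + R x u)
      (fun x hx u hu => (ih x hx u hu).trans (by ring))
      ((((tA (m + 4)).mul (tc (m + 4))).add ((hP.hasTotalD hI hJ le_rfl).mul (tc (m + 3)))).add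
        (hR.hasTotalD hI hJ le_rfl)) hx hu
    rw [show m + 1 + 4 = m + 4 + 1 by ring, h, hξ,
      ← px_py_comm hI hJ hξs (show (x, u 0) ∈ I ×ˢ J from ⟨hx, hu⟩)]
    push_cast
    ring

/-- For equations of order at least four, the coefficients of a generator satisfy `ξ_y = 0`,
`η_yy = 0` and `2 η_xy = (2n - 1) ξ_xx`. -/
theorem IsGenerator.partials_of_two_le (hI : IsOpen I) (hJ : IsOpen J) {n : ℕ} (hn : 2 ≤ n)
    {f : ℝ → ℝ} (h : IsGenerator n I J f X) {ξ η : ℝ × ℝ → ℝ} (hξ : (fun q => (X q).1) = ξ)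
    (hη : (fun q => (X q).2) = η) :
    ∀ q ∈ I ×ˢ J, py ξ q = 0 ∧ py (py η) q = 0 ∧
      2 * px (py η) q = (2 * (n : ℝ) - 1) * px (px ξ) q := by
  have hX := h.1
  have hξs : ContDiffOn ℝ ∞ ξ (I ×ˢ J) := hξ ▸ hX.fst
  have hηs : ContDiffOn ℝ ∞ η (I ×ˢ J) := hη ▸ hX.snd
  have cx {φ : ℝ × ℝ → ℝ} (h : ContDiffOn ℝ ∞ φ (I ×ˢ J)) := contDiffOn_px hI hJ h
  have cy {φ : ℝ × ℝ → ℝ} (h : ContDiffOn ℝ ∞ φ (I ×ˢ J)) := contDiffOn_py hI hJ h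
  obtain ⟨m, hm⟩ : ∃ m, 2 * n = m + 4 := ⟨2 * n - 4, by omega⟩
  have hmn : (2 * (n : ℝ)) = m + 4 := by exact_mod_cast hm
  obtain ⟨β, R, hβ, hR, hz⟩ := zeta_eq hI hJ hX hξ hη m
  have e1 : 2 * n - 1 = m + 3 := by omega
  have sm {φ : ℝ × ℝ → ℝ} (h : ContDiffOn ℝ ∞ φ (I ×ˢ J)) := smoothJet_base h (2 * n - 1)
  have sc {i : ℕ} (hi : i ≤ m + 3) : SmoothJet I J (2 * n - 1) fun _ u => u i :=
    smoothJet_coord (e1 ▸ hi)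
  have sk (a : ℝ) := smoothJet_const (I := I) (J := J) (2 * n - 1) a
  have c1 := sc (i := 1) (by omega)
  have sp (k l : ℝ) := (((sk k).mul ((sm (cx (cy hηs))).add (c1.mul (sm (cy (cy hηs)))))).sub
    ((sk l).mul (((sm (cx (cx hξs))).add ((sk 2).mul (c1.mul (sm (cx (cy hξs)))))).add
      (c1.mul (c1.mul (sm (cy (cy hξs)))))))).sub
    ((sk k).mul (c1.mul ((sm (cx (cy hξs))).add (c1.mul (sm (cy (cy hξs)))))))
  have hdet := (isGenerator_iff_of_zeta_eq (by omega) hX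
    (((sm (cy hηs)).sub ((sk (m + 4)).mul (sm (cx hξs)))).sub
      ((sk (m + 5)).mul (c1.mul (sm (cy hξs)))))
    ((((sp (m + 4) ((m + 4) * (m + 3) / 2)).sub ((sk β).mul
      ((sc (i := 2) (by omega)).mul (sm (cy hξs))))).mul (sc le_rfl)).add
      (hR.mono (by omega))) (fun x hx u hu => by
        rw [hm, hz x hx u hu]
        ring) f).1 h
  -- This is the coefficient of u_{2n-1} in the determining identity, for arbitrary values of u_1
  -- and u_2.
  have key : ∀ x ∈ I, ∀ y ∈ J, ∀ u1 u2 : ℝ,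
      (m + 4) * (px (py η) (x, y) + u1 * py (py η) (x, y))
        - (m + 4) * (m + 3) / 2 * (px (px ξ) (x, y) + 2 * (u1 * px (py ξ) (x, y))
          + u1 * (u1 * py (py ξ) (x, y)))
        - (m + 4) * (u1 * (px (py ξ) (x, y) + u1 * py (py ξ) (x, y)))
        - β * (u2 * py ξ (x, y)) = 0 := by
    intro x hx y hy u1 u2
    -- Only the coordinate u_{m+3} = w varies; since m + 3 ≥ 3 it is none of u_0, u_1, u_2.
    -- Subtracting the identity at w = 0 from that at w = 1 leaves the coefficient.
    set u : ℝ → ℕ → ℝ := fun w i =>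
      if i = 0 then y else if i = 1 then u1 else if i = 2 then u2 else if i = m + 3 then w else 0
      with hu
    have h0 : ∀ w, u w 0 = y := fun w => by simp [hu]
    have h1 : ∀ w, u w 1 = u1 := fun w => by simp [hu]
    have h2 : ∀ w, u w 2 = u2 := fun w => by simp [hu]
    have h3 : ∀ w, u w (m + 3) = w := fun w => by simp [hu]
    have hRe : R x (u 1) = R x (u 0) := by
      refine hR.eq_of_agree hx ((h0 1).symm ▸ hy) fun i hi => ?_
      have : i ≠ m + 3 := by omega
      simp [hu, this]
    have k1 := hdet x hx (u 1) ((h0 1).symm ▸ hy)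
    have k0 := hdet x hx (u 0) ((h0 0).symm ▸ hy)
    simp only [h0, h1, h2, h3, hRe] at k0 k1
    linear_combination k1 - k0
  have hy0 : ∀ q ∈ I ×ˢ J, py ξ q = 0 := by
    rintro ⟨x, y⟩ ⟨hx, hy⟩
    have k0 := key x hx y hy 0 0
    have k1 := key x hx y hy 0 1
    have : β * py ξ (x, y) = 0 := by linear_combination k0 - k1
    exact (mul_eq_zero.1 this).resolve_left hβ.ne'
  have hxy0 : ∀ q ∈ I ×ˢ J, px (py ξ) q = 0 := by
    rintro ⟨x, y⟩ ⟨hx, hy⟩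
    refine HasDerivAt.deriv ((hasDerivAt_const x (0 : ℝ)).congr_of_eventuallyEq ?_)
    filter_upwards [hI.mem_nhds hx] with t ht
    exact hy0 _ ⟨ht, hy⟩
  rintro ⟨x, y⟩ ⟨hx, hy⟩
  have q0 := hy0 (x, y) ⟨hx, hy⟩
  have qxy := hxy0 (x, y) ⟨hx, hy⟩
  -- With ξ_y = 0 and ξ_xy = 0, the identity is affine in u_1 apart from a ξ_yy term. The odd part
  -- in u_1 gives η_yy, and the value at u_1 = 0 gives the relation between η_xy and ξ_xx.
  have k0 := key x hx y hy 0 0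
  have k1 := key x hx y hy 1 0
  have k2 := key x hx y hy (-1) 0
  rw [q0, qxy] at *
  have hm4 : (m : ℝ) + 4 ≠ 0 := by positivity
  refine ⟨rfl, ?_, ?_⟩
  · apply mul_left_cancel₀ hm4
    linear_combination (k1 - k2) / 2
  · rw [hmn]
    apply mul_left_cancel₀ hm4
    linear_combination 2 * k0

end

/-! ### The determining system of second order equations -/

section

variable {I J : Set ℝ} {X : VField}

theorem eq_of_hasDerivAt_zero {S : Set ℝ} (hS : IsOpen S) (hS' : IsPreconnected S) {g : ℝ → ℝ}
    (h : ∀ t ∈ S, HasDerivAt g 0 t) {s t : ℝ} (hs : s ∈ S) (ht : t ∈ S) : g s = g t :=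
  hS.is_const_of_deriv_eq_zero hS' (fun t ht => (h t ht).differentiableAt.differentiableWithinAt)
    (fun t ht => (h t ht).deriv) hs ht

/-- Two integrations in y at fixed x, with constants read off at `y₀`. With `k = 0` it applies to ξ,
and with k = ξ_xy to η. -/
theorem eq_quadratic_of_pyy (hI : IsOpen I) (hJ : IsOpen J) (hJ' : IsPreconnected J)
    {φ : ℝ × ℝ → ℝ} (hφ : ContDiffOn ℝ ∞ φ (I ×ˢ J)) {x y₀ k : ℝ} (hx : x ∈ I) (hy₀ : y₀ ∈ J)
    (h : ∀ y ∈ J, py (py φ) (x, y) = 2 * k) {y : ℝ} (hy : y ∈ J) :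
    φ (x, y) = k * y ^ 2 + (py φ (x, y₀) - 2 * k * y₀) * y +
      (φ (x, y₀) - py φ (x, y₀) * y₀ + k * y₀ ^ 2) := by
  have h1 : ∀ y ∈ J, py φ (x, y) = py φ (x, y₀) + 2 * k * (y - y₀) := by
    intro y hy
    have hd : ∀ t ∈ J, HasDerivAt (fun t => py φ (x, t) - 2 * k * t) 0 t := by
      intro t ht
      have := (hasDerivAt_py hI hJ (contDiffOn_py hI hJ hφ) hx ht).sub
        ((hasDerivAt_id t).const_mul (2 * k))
      rwa [h t ht, mul_one, sub_self] at this
    have := eq_of_hasDerivAt_zero hJ hJ' hd hy hy₀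
    linear_combination this
  have hd : ∀ t ∈ J, HasDerivAt
      (fun t => φ (x, t) - (k * t ^ 2 + (py φ (x, y₀) - 2 * k * y₀) * t)) 0 t := by
    intro t ht
    have := (hasDerivAt_py hI hJ hφ hx ht).sub ((((hasDerivAt_id t).pow 2).const_mul k).add
      ((hasDerivAt_id t).const_mul (py φ (x, y₀) - 2 * k * y₀)))
    refine this.congr_deriv ?_
    rw [h1 t ht]
    simp
    ring
  have := eq_of_hasDerivAt_zero hJ hJ' hd hy hy₀
  linear_combination this

/-- The function `p₂(x) y² + p₁(x) y + p₀(x)`. -/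
def quad (p₂ p₁ p₀ : ℝ → ℝ) : ℝ × ℝ → ℝ := fun q => p₂ q.1 * q.2 ^ 2 + p₁ q.1 * q.2 + p₀ q.1

theorem contDiffOn_quad {p₂ p₁ p₀ : ℝ → ℝ} (h₂ : ContDiffOn ℝ ∞ p₂ I) (h₁ : ContDiffOn ℝ ∞ p₁ I)
    (h₀ : ContDiffOn ℝ ∞ p₀ I) : ContDiffOn ℝ ∞ (quad p₂ p₁ p₀) (I ×ˢ J) := by
  have hc {p : ℝ → ℝ} (hp : ContDiffOn ℝ ∞ p I) :
      ContDiffOn ℝ ∞ (fun q : ℝ × ℝ => p q.1) (I ×ˢ J) :=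
    hp.comp contDiff_fst.contDiffOn fun q hq => hq.1
  exact (((hc h₂).mul (contDiff_snd.contDiffOn.pow 2)).add
    ((hc h₁).mul contDiff_snd.contDiffOn)).add (hc h₀)

/-- Agreement on the open rectangle is enough to compute derivatives there. In this form the rule,
like `py_quad`, can be iterated to reach second partial derivatives. -/
theorem px_quad (hI : IsOpen I) {p₂ p₁ p₀ : ℝ → ℝ} (h₂ : ContDiffOn ℝ ∞ p₂ I)
    (h₁ : ContDiffOn ℝ ∞ p₁ I) (h₀ : ContDiffOn ℝ ∞ p₀ I) {φ : ℝ × ℝ → ℝ}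
    (h : Set.EqOn φ (quad p₂ p₁ p₀) (I ×ˢ J)) :
    Set.EqOn (px φ) (quad (deriv p₂) (deriv p₁) (deriv p₀)) (I ×ˢ J) := by
  rintro ⟨x, y⟩ ⟨hx, hy⟩
  have hd := (((hasDerivAt_of_contDiffOn hI h₂ hx).mul_const (y ^ 2)).add
    ((hasDerivAt_of_contDiffOn hI h₁ hx).mul_const y)).add (hasDerivAt_of_contDiffOn hI h₀ hx)
  refine HasDerivAt.deriv (hd.congr_of_eventuallyEq ?_)
  filter_upwards [hI.mem_nhds hx] with t ht
  exact h ⟨ht, hy⟩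

theorem py_quad (hJ : IsOpen J) {p₂ p₁ p₀ : ℝ → ℝ} {φ : ℝ × ℝ → ℝ}
    (h : Set.EqOn φ (quad p₂ p₁ p₀) (I ×ˢ J)) :
    Set.EqOn (py φ) (quad (fun _ => 0) (fun x => 2 * p₂ x) p₁) (I ×ˢ J) := by
  rintro ⟨x, y⟩ ⟨hx, hy⟩
  have hd := ((((hasDerivAt_id y).pow 2).const_mul (p₂ x)).add
    ((hasDerivAt_id y).const_mul (p₁ x))).add_const (p₀ x)
  have e : quad (fun _ => 0) (fun x => 2 * p₂ x) p₁ (x, y) =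
      p₂ x * (((2 : ℕ) : ℝ) * id y ^ (2 - 1) * 1) + p₁ x * 1 := by
    simp [quad]
    ring
  rw [e]
  refine HasDerivAt.deriv (hd.congr_of_eventuallyEq ?_)
  filter_upwards [hJ.mem_nhds hy] with t ht
  exact h ⟨hx, ht⟩

/-- The determining system of a second order equation. -/
theorem isGenerator_one_iff_partials (hI : IsOpen I) (hJ : IsOpen J)
    (hX : ContDiffOn ℝ ∞ X (I ×ˢ J)) {f : ℝ → ℝ}
    {ξ η : ℝ × ℝ → ℝ} (hξ : (fun q => (X q).1) = ξ) (hη : (fun q => (X q).2) = η) :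
    IsGenerator 1 I J f X ↔ ∀ x ∈ I, ∀ y ∈ J,
      px (px η) (x, y) + η (x, y) * deriv f y = (py η (x, y) - 2 * px ξ (x, y)) * f y ∧
      2 * px (py η) (x, y) - px (px ξ) (x, y) + 3 * py ξ (x, y) * f y = 0 ∧
      py (py η) (x, y) = 2 * px (py ξ) (x, y) ∧ py (py ξ) (x, y) = 0 := by
  have hξs : ContDiffOn ℝ ∞ ξ (I ×ˢ J) := hξ ▸ hX.fst
  have hηs : ContDiffOn ℝ ∞ η (I ×ˢ J) := hη ▸ hX.snd
  have cx {φ : ℝ × ℝ → ℝ} (h : ContDiffOn ℝ ∞ φ (I ×ˢ J)) := contDiffOn_px hI hJ h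
  have cy {φ : ℝ × ℝ → ℝ} (h : ContDiffOn ℝ ∞ φ (I ×ˢ J)) := contDiffOn_py hI hJ h
  have sm {φ : ℝ × ℝ → ℝ} (h : ContDiffOn ℝ ∞ φ (I ×ˢ J)) := smoothJet_base h (2 * 1 - 1)
  have sk (a : ℝ) := smoothJet_const (I := I) (J := J) (2 * 1 - 1) a
  have c1 : SmoothJet I J (2 * 1 - 1) fun _ u => u 1 := smoothJet_coord le_rfl
  have hη' (q) : (X q).2 = η q := congrFun hη q
  rw [isGenerator_iff_of_zeta_eq le_rfl hX
    (((sm (cy hηs)).sub ((sk 2).mul (sm (cx hξs)))).sub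
      ((sk 3).mul (c1.mul (sm (cy hξs)))))
    ((((sm (cx (cx hηs))).add (c1.mul (((sk 2).mul (sm (cx (cy hηs)))).sub (sm (cx (cx hξs)))))).add
      (c1.mul (c1.mul ((sm (cy (cy hηs))).sub ((sk 2).mul (sm (cx (cy hξs)))))))).sub
      (c1.mul (c1.mul (c1.mul (sm (cy (cy hξs)))))))
    (fun x hx u hu => zeta_two_eq hI hJ hX hξ hη hx hu) f]
  simp only [hη']
  constructor
  · intro h x hx y hy
    -- The identity is a cubic polynomial in u_1 = w; its values at 0, 1, -1 and 2 determine the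
    -- four coefficients.
    have k (w : ℝ) := h x hx (fun i => if i = 0 then y else w) (by simpa using hy)
    simp only [if_true, one_ne_zero, if_false] at k
    have k0 := k 0
    have k1 := k 1
    have k2 := k (-1)
    have k3 := k 2
    refine ⟨by linear_combination k0, by linear_combination k1 - k2 / 3 - k3 / 6 - k0 / 2,
      by linear_combination (k1 + k2) / 2 - k0,
      by linear_combination -(k3 - 3 * k1 + 3 * k0 - k2) / 6⟩
  · intro h x hx u hu
    obtain ⟨h1, h2, h3, h4⟩ := h x hx (u 0) hu
    rw [h3, h4]
    linear_combination h1 + u 1 * h2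

/-- Generators of second order equations. -/
theorem isGenerator_one_iff (hI : IsOpen I) (hJ : IsOpen J) (hJ' : IsConnected J) (f : ℝ → ℝ) :
    IsGenerator 1 I J f X ↔ ∃ a b c d : ℝ → ℝ, ContDiffOn ℝ ∞ a I ∧ ContDiffOn ℝ ∞ b I ∧
      ContDiffOn ℝ ∞ c I ∧ ContDiffOn ℝ ∞ d I ∧
      Set.EqOn X (fun q => (a q.1 * q.2 + b q.1, deriv a q.1 * q.2 ^ 2 + c q.1 * q.2 + d q.1))
        (I ×ˢ J) ∧
      ∀ x ∈ I, ∀ y ∈ J,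
        3 * deriv (deriv a) x * y + 2 * deriv c x - deriv (deriv b) x + 3 * a x * f y = 0 ∧
        deriv (deriv (deriv a)) x * y ^ 2 + deriv (deriv c) x * y + deriv (deriv d) x
          + (deriv a x * y ^ 2 + c x * y + d x) * deriv f y = (c x - 2 * deriv b x) * f y := by
  obtain ⟨y₀, hy₀⟩ := hJ'.nonempty
  have hs {φ : ℝ × ℝ → ℝ} (h : ContDiffOn ℝ ∞ φ (I ×ˢ J)) : ContDiffOn ℝ ∞ (fun x => φ (x, y₀)) I :=
    h.comp (f := fun x => (x, y₀)) (contDiff_id.prodMk contDiff_const).contDiffOn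
      fun x hx => ⟨hx, hy₀⟩
  have hz : ContDiffOn ℝ ∞ (fun _ : ℝ => (0 : ℝ)) I := contDiffOn_const
  -- For a field already of the stated shape, two of the four equations hold automatically, and the
  -- other two are the displayed conditions.
  have hform {a b c d : ℝ → ℝ} (ha : ContDiffOn ℝ ∞ a I) (hb : ContDiffOn ℝ ∞ b I)
      (hc : ContDiffOn ℝ ∞ c I) (hd : ContDiffOn ℝ ∞ d I)
      (e : Set.EqOn X (fun q => (a q.1 * q.2 + b q.1,
        deriv a q.1 * q.2 ^ 2 + c q.1 * q.2 + d q.1)) (I ×ˢ J)) :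
      IsGenerator 1 I J f X ↔ ∀ x ∈ I, ∀ y ∈ J,
        3 * deriv (deriv a) x * y + 2 * deriv c x - deriv (deriv b) x + 3 * a x * f y = 0 ∧
        deriv (deriv (deriv a)) x * y ^ 2 + deriv (deriv c) x * y + deriv (deriv d) x
          + (deriv a x * y ^ 2 + c x * y + d x) * deriv f y = (c x - 2 * deriv b x) * f y := by
    have da := contDiffOn_deriv hI ha
    have eξ : Set.EqOn (fun q => (X q).1) (quad (fun _ => 0) a b) (I ×ˢ J) := fun q hq => by
      simp [quad, e hq]
    have eη : Set.EqOn (fun q => (X q).2) (quad (deriv a) c d) (I ×ˢ J) := fun q hq => by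
      simp [quad, e hq]
    have hX : ContDiffOn ℝ ∞ X (I ×ˢ J) :=
      (((contDiffOn_quad hz ha hb).congr eξ).prodMk ((contDiffOn_quad da hc hd).congr eη))
    have eξx := px_quad hI hz ha hb eξ
    have eξy := py_quad hJ eξ
    have eηx := px_quad hI da hc hd eη
    have eηy := py_quad hJ eη
    have h2 {p : ℝ → ℝ} (hp : ContDiffOn ℝ ∞ p I) : ContDiffOn ℝ ∞ (fun x => 2 * p x) I :=
      contDiffOn_const.mul hp
    have d2 {p : ℝ → ℝ} : deriv (fun x => 2 * p x) = fun x => 2 * deriv p x := by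
      ext x
      exact deriv_const_mul_field _
    have eξxx := px_quad hI (by simpa using hz) (contDiffOn_deriv hI ha) (contDiffOn_deriv hI hb) eξx
    have eξxy := px_quad hI hz (h2 hz) ha eξy
    have eξyy := py_quad hJ eξy
    have eηxx := px_quad hI (contDiffOn_deriv hI da) (contDiffOn_deriv hI hc)
      (contDiffOn_deriv hI hd) eηx
    have eηxy := px_quad hI hz (h2 da) hc eηy
    have eηyy := py_quad hJ eηy
    rw [isGenerator_one_iff_partials hI hJ hX rfl rfl]
    refine forall₂_congr fun x hx => forall₂_congr fun y hy => ?_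
    have hq : (x, y) ∈ I ×ˢ J := ⟨hx, hy⟩
    have eη' : (X (x, y)).2 = _ := eη hq
    rw [eξxx hq, eξxy hq, eξyy hq, eηxx hq, eηxy hq, eηyy hq, eξx hq, eξy hq, eηy hq, eη']
    simp only [quad, d2, deriv_const', deriv_const]
    constructor
    · rintro ⟨k1, k2, -, -⟩
      exact ⟨by linear_combination k2, by linear_combination k1⟩
    · rintro ⟨k1, k2⟩
      exact ⟨by linear_combination k2, by linear_combination k1, by ring, by ring⟩
  constructor
  · intro h
    have hX := h.1
    set ξ : ℝ × ℝ → ℝ := fun q => (X q).1 with hξ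
    set η : ℝ × ℝ → ℝ := fun q => (X q).2 with hη
    have hξs : ContDiffOn ℝ ∞ ξ (I ×ˢ J) := hX.fst
    have hηs : ContDiffOn ℝ ∞ η (I ×ˢ J) := hX.snd
    have hp := (isGenerator_one_iff_partials hI hJ hX hξ.symm hη.symm).1 h
    -- The coefficients are read off on the line y = `y₀`: a is ξ_y there, and b, c, d are the
    -- expansion coefficients of `eq_quadratic_of_pyy`.
    have ha := hs (contDiffOn_py hI hJ hξs)
    have hb : ContDiffOn ℝ ∞ (fun x => ξ (x, y₀) - py ξ (x, y₀) * y₀) I :=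
      (hs hξs).sub (ha.mul contDiffOn_const)
    have da := contDiffOn_deriv hI ha
    have hc : ContDiffOn ℝ ∞ (fun x => py η (x, y₀) -
        2 * deriv (fun x => py ξ (x, y₀)) x * y₀) I :=
      (hs (contDiffOn_py hI hJ hηs)).sub ((contDiffOn_const.mul da).mul contDiffOn_const)
    have hd : ContDiffOn ℝ ∞ (fun x => η (x, y₀) - py η (x, y₀) * y₀ +
        deriv (fun x => py ξ (x, y₀)) x * y₀ ^ 2) I :=
      ((hs hηs).sub ((hs (contDiffOn_py hI hJ hηs)).mul contDiffOn_const)).add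
        (da.mul contDiffOn_const)
    have hξe : ∀ x ∈ I, ∀ y ∈ J, ξ (x, y) = py ξ (x, y₀) * y + (ξ (x, y₀) - py ξ (x, y₀) * y₀) := by
      intro x hx y hy
      rw [eq_quadratic_of_pyy hI hJ hJ'.isPreconnected hξs hx hy₀ (k := 0)
        (fun y hy => by rw [(hp x hx y hy).2.2.2, mul_zero]) hy]
      ring
    -- Since ξ is affine in y, ξ_xy equals a' and does not depend on y; hence η_yy = 2 ξ_xy is
    -- constant in y and η is quadratic with leading coefficient a'.
    have hξxy : ∀ x ∈ I, ∀ y ∈ J, px (py ξ) (x, y) = deriv (fun x => py ξ (x, y₀)) x := by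
      intro x hx y hy
      have e1 : Set.EqOn ξ (quad (fun _ => 0) (fun x => py ξ (x, y₀))
          (fun x => ξ (x, y₀) - py ξ (x, y₀) * y₀)) (I ×ˢ J) := by
        rintro ⟨x, y⟩ ⟨hx, hy⟩
        rw [hξe x hx y hy]
        simp [quad]
      have := px_quad hI hz (by simpa using hz) ha (py_quad hJ e1) (show (x, y) ∈ I ×ˢ J from ⟨hx, hy⟩)
      simpa [quad] using this
    have e : Set.EqOn X (fun q => ((fun x => py ξ (x, y₀)) q.1 * q.2 +
        (fun x => ξ (x, y₀) - py ξ (x, y₀) * y₀) q.1,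
        deriv (fun x => py ξ (x, y₀)) q.1 * q.2 ^ 2 + (fun x => py η (x, y₀) -
        2 * deriv (fun x => py ξ (x, y₀)) x * y₀) q.1 * q.2 +
        (fun x => η (x, y₀) - py η (x, y₀) * y₀ +
        deriv (fun x => py ξ (x, y₀)) x * y₀ ^ 2) q.1)) (I ×ˢ J) := by
      rintro ⟨x, y⟩ ⟨hx, hy⟩
      exact Prod.ext (hξe x hx y hy) (eq_quadratic_of_pyy hI hJ hJ'.isPreconnected hηs hx hy₀
        (fun y hy => by rw [(hp x hx y hy).2.2.1, hξxy x hx y hy]) hy)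
    exact ⟨_, _, _, _, ha, hb, hc, hd, e, (hform ha hb hc hd e).1 h⟩
  · rintro ⟨a, b, c, d, ha, hb, hc, hd, e, h⟩
    exact (hform ha hb hc hd e).2 h

end

/-! ### The determining system of equations of order at least four -/

section

variable {I J : Set ℝ} {X : VField}

theorem contDiffOn_iteratedDeriv (hI : IsOpen I) {d : ℝ → ℝ} (hd : ContDiffOn ℝ ∞ d I) (k : ℕ) :
    ContDiffOn ℝ ∞ (iteratedDeriv k d) I := by
  induction k with
  | zero => simpa using hd
  | succ k ih =>
    rw [iteratedDeriv_succ]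
    exact contDiffOn_deriv hI ih

theorem deriv_eq_zero_of_eqOn (hI : IsOpen I) {g : ℝ → ℝ} (h : ∀ x ∈ I, g x = 0) :
    ∀ x ∈ I, deriv g x = 0 := by
  intro x hx
  refine HasDerivAt.deriv ((hasDerivAt_const x (0 : ℝ)).congr_of_eventuallyEq ?_)
  filter_upwards [hI.mem_nhds hx] with t ht
  exact h t ht

section affine

variable {b c d : ℝ → ℝ}

theorem contDiffOn_of_eqOn_affine (hb : ContDiffOn ℝ ∞ b I) (hc : ContDiffOn ℝ ∞ c I)
    (hd : ContDiffOn ℝ ∞ d I)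
    (e : Set.EqOn X (fun q => (b q.1, c q.1 * q.2 + d q.1)) (I ×ˢ J)) :
    ContDiffOn ℝ ∞ X (I ×ˢ J) := by
  have hp {p : ℝ → ℝ} (hp : ContDiffOn ℝ ∞ p I) :
      ContDiffOn ℝ ∞ (fun q : ℝ × ℝ => p q.1) (I ×ˢ J) :=
    hp.comp contDiff_fst.contDiffOn fun q hq => hq.1
  exact ((hp hb).prodMk (((hp hc).mul contDiff_snd.contDiffOn).add (hp hd))).congr e

theorem zeta_succ_eq_affine (hI : IsOpen I) (hJ : IsOpen J) (hb : ContDiffOn ℝ ∞ b I)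
    (hc : ContDiffOn ℝ ∞ c I) (hd : ContDiffOn ℝ ∞ d I)
    (e : Set.EqOn X (fun q => (b q.1, c q.1 * q.2 + d q.1)) (I ×ˢ J)) {k : ℕ}
    {g g' : JetFun} (hz : ∀ x ∈ I, ∀ u : ℕ → ℝ, u 0 ∈ J → zeta X k x u = g x u)
    (hg : HasTotalD I J g g') {x : ℝ} (hx : x ∈ I) {u : ℕ → ℝ} (hu : u 0 ∈ J) :
    zeta X (k + 1) x u = g' x u - u (k + 1) * deriv b x := by
  have e' : Set.EqOn (fun q => (X q).1) (quad (fun _ => 0) (fun _ => 0) b) (I ×ˢ J) := fun q hq => by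
    simp [quad, e hq]
  have hz0 : ContDiffOn ℝ ∞ (fun _ : ℝ => (0 : ℝ)) I := contDiffOn_const
  have hq : (x, u 0) ∈ I ×ˢ J := ⟨hx, hu⟩
  rw [zeta_succ_eq hI hJ (contDiffOn_of_eqOn_affine hb hc hd e) hz hg hx hu,
    px_quad hI hz0 hz0 hb e' hq, py_quad hJ e' hq]
  simp [quad]

/-- The leading terms of the prolongation of `b(x) ∂/∂x + (c(x) y + d(x)) ∂/∂y`. -/
theorem zeta_eq_affine (hI : IsOpen I) (hJ : IsOpen J) (hb : ContDiffOn ℝ ∞ b I)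
    (hc : ContDiffOn ℝ ∞ c I) (hd : ContDiffOn ℝ ∞ d I)
    (e : Set.EqOn X (fun q => (b q.1, c q.1 * q.2 + d q.1)) (I ×ˢ J)) (m : ℕ) :
    ∃ R : JetFun, SmoothJet I J m R ∧ ∀ x ∈ I, ∀ u : ℕ → ℝ, u 0 ∈ J →
      zeta X (m + 3) x u = (c x - (m + 3) * deriv b x) * u (m + 3)
        + ((m + 3) * deriv c x - (m + 3) * (m + 2) / 2 * deriv (deriv b) x) * u (m + 2)
        + ((m + 3) * (m + 2) / 2 * deriv (deriv c) x
          - (m + 3) * (m + 2) * (m + 1) / 6 * deriv (deriv (deriv b)) x) * u (m + 1) + R x u := by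
  have dv {p : ℝ → ℝ} (hp : ContDiffOn ℝ ∞ p I) := contDiffOn_deriv hI hp
  have td {p : ℝ → ℝ} (hp : ContDiffOn ℝ ∞ p I) : HasTotalD I J _ _ := hasTotalD_fun hI hp
  have tc (i : ℕ) : HasTotalD I J (fun _ u => u i) (fun _ u => u (i + 1)) := hasTotalD_coord i
  induction m with
  | zero =>
    have h0 : ∀ x ∈ I, ∀ u : ℕ → ℝ, u 0 ∈ J → zeta X 0 x u = c x * u 0 + d x :=
      fun x hx u hu => congrArg Prod.snd (e (show (x, u 0) ∈ I ×ˢ J from ⟨hx, hu⟩))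
    have h1 := fun x hx u hu => zeta_succ_eq_affine hI hJ hb hc hd e h0
      (((td hc).mul (tc 0)).add (td hd)) (x := x) hx (u := u) hu
    have h2 := fun x hx u hu => zeta_succ_eq_affine hI hJ hb hc hd e h1
      (((((td (dv hc)).mul (tc 0)).add ((td hc).mul (tc 1))).add (td (dv hd))).sub
        ((tc 1).mul (td (dv hb)))) (x := x) hx (u := u) hu
    have h3 := fun x hx u hu => zeta_succ_eq_affine hI hJ hb hc hd e h2
      ((((((td (dv (dv hc))).mul (tc 0)).add ((td (dv hc)).mul (tc 1))).add
        (((td (dv hc)).mul (tc 1)).add ((td hc).mul (tc 2)))).add (td (dv (dv hd)))).sub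
        (((tc 2).mul (td (dv hb))).add ((tc 1).mul (td (dv (dv hb)))))
        |>.sub ((tc 2).mul (td (dv hb)))) (x := x) hx (u := u) hu
    refine ⟨_, ((smoothJet_fun (dv (dv (dv hc))) 0).mul (smoothJet_coord (i := 0) le_rfl)).add
      (smoothJet_fun (dv (dv (dv hd))) 0), fun x hx u hu => ?_⟩
    rw [Nat.zero_add, h3 x hx u hu]
    push_cast
    ring
  | succ m ih =>
    obtain ⟨R, hR, ih⟩ := ih
    have h := fun x hx u hu => zeta_succ_eq_affine hI hJ hb hc hd e ih
      (((((td hc).sub ((td (dv hb)).const_mul (m + 3))).mul (tc (m + 3))).add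
        ((((td (dv hc)).const_mul (m + 3)).sub
          ((td (dv (dv hb))).const_mul ((m + 3) * (m + 2) / 2))).mul (tc (m + 2)))).add
        ((((td (dv (dv hc))).const_mul ((m + 3) * (m + 2) / 2)).sub
          ((td (dv (dv (dv hb)))).const_mul ((m + 3) * (m + 2) * (m + 1) / 6))).mul (tc (m + 1)))
        |>.add (hR.hasTotalD hI hJ le_rfl)) (x := x) hx (u := u) hu
    refine ⟨_, ((((smoothJet_const (m + 1) ((m + 3) * (m + 2) / 2)).mul
      (smoothJet_fun (dv (dv (dv hc))) (m + 1))).sub ((smoothJet_const (m + 1)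
      ((m + 3) * (m + 2) * (m + 1) / 6)).mul (smoothJet_fun (dv (dv (dv (dv hb)))) (m + 1)))).mul
      (smoothJet_coord (i := m + 1) le_rfl)).add (hR.totalD hI hJ le_rfl), fun x hx u hu => ?_⟩
    rw [show m + 1 + 3 = m + 3 + 1 by ring, h x hx u hu]
    push_cast
    ring

/-- The prolongation of `b(x) ∂/∂x + (c(x) y + d(x)) ∂/∂y` for quadratic `b` and affine `c`. -/
theorem zeta_eq_of_quadratic (hI : IsOpen I) (hJ : IsOpen J) (hb : ContDiffOn ℝ ∞ b I)
    (hc : ContDiffOn ℝ ∞ c I) (hd : ContDiffOn ℝ ∞ d I)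
    (e : Set.EqOn X (fun q => (b q.1, c q.1 * q.2 + d q.1)) (I ×ˢ J))
    (hc2 : ∀ x ∈ I, deriv (deriv c) x = 0) (hb3 : ∀ x ∈ I, deriv (deriv (deriv b)) x = 0) (m : ℕ) :
    ∀ x ∈ I, ∀ u : ℕ → ℝ, u 0 ∈ J →
      zeta X (m + 1) x u = (c x - (m + 1) * deriv b x) * u (m + 1)
        + ((m + 1) * deriv c x - (m + 1) * m / 2 * deriv (deriv b) x) * u m
        + iteratedDeriv (m + 1) d x := by
  have dv {p : ℝ → ℝ} (hp : ContDiffOn ℝ ∞ p I) := contDiffOn_deriv hI hp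
  have td {p : ℝ → ℝ} (hp : ContDiffOn ℝ ∞ p I) : HasTotalD I J _ _ := hasTotalD_fun hI hp
  have tc (i : ℕ) : HasTotalD I J (fun _ u => u i) (fun _ u => u (i + 1)) := hasTotalD_coord i
  induction m with
  | zero =>
    have h0 : ∀ x ∈ I, ∀ u : ℕ → ℝ, u 0 ∈ J → zeta X 0 x u = c x * u 0 + d x :=
      fun x hx u hu => congrArg Prod.snd (e (show (x, u 0) ∈ I ×ˢ J from ⟨hx, hu⟩))
    intro x hx u hu
    rw [zeta_succ_eq_affine hI hJ hb hc hd e h0 (((td hc).mul (tc 0)).add (td hd)) hx hu,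
      Nat.zero_add, iteratedDeriv_one]
    push_cast
    ring
  | succ m ih =>
    intro x hx u hu
    rw [zeta_succ_eq_affine hI hJ hb hc hd e ih
      (((((td hc).sub ((td (dv hb)).const_mul (m + 1))).mul (tc (m + 1))).add
        ((((td (dv hc)).const_mul (m + 1)).sub
          ((td (dv (dv hb))).const_mul ((m + 1) * m / 2))).mul (tc m))).add
        (td (contDiffOn_iteratedDeriv hI hd (m + 1)))) hx hu, iteratedDeriv_succ (n := m + 1),
      hc2 x hx, hb3 x hx]
    push_cast
    ring

end affine

/-- Generators of equations of order at least four. -/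
theorem isGenerator_iff_of_two_le (hI : IsOpen I) (hJ : IsOpen J) (hJ' : IsConnected J) {n : ℕ}
    (hn : 2 ≤ n) (f : ℝ → ℝ) :
    IsGenerator n I J f X ↔ ∃ b c d : ℝ → ℝ, ContDiffOn ℝ ∞ b I ∧
      ContDiffOn ℝ ∞ c I ∧ ContDiffOn ℝ ∞ d I ∧
      Set.EqOn X (fun q => (b q.1, c q.1 * q.2 + d q.1)) (I ×ˢ J) ∧
      ∀ x ∈ I, 2 * deriv c x = (2 * (n : ℝ) - 1) * deriv (deriv b) x ∧
        deriv (deriv (deriv b)) x = 0 ∧ ∀ y ∈ J,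
        iteratedDeriv (2 * n) d x + (c x * y + d x) * deriv f y =
          (c x - 2 * n * deriv b x) * f y := by
  have hN : 2 * n - 1 + 1 = 2 * n := by omega
  have hN' : ((2 * n - 1 : ℕ) : ℝ) + 1 = 2 * n := by exact_mod_cast hN
  -- The x-derivative of the relation between c' and b''; it turns b''' = 0 into c'' = 0.
  have hc2 {b c : ℝ → ℝ} (hc : ContDiffOn ℝ ∞ c I) (hb : ContDiffOn ℝ ∞ b I)
      (h : ∀ x ∈ I, 2 * deriv c x = (2 * (n : ℝ) - 1) * deriv (deriv b) x) :
      ∀ x ∈ I, 2 * deriv (deriv c) x = (2 * (n : ℝ) - 1) * deriv (deriv (deriv b)) x := by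
    intro x hx
    have h1 := ((hasDerivAt_of_contDiffOn hI (contDiffOn_deriv hI hc) hx).const_mul 2).sub
      ((hasDerivAt_of_contDiffOn hI (contDiffOn_deriv hI (contDiffOn_deriv hI hb)) hx).const_mul
        (2 * (n : ℝ) - 1))
    have := deriv_eq_zero_of_eqOn hI (g := fun x => 2 * deriv c x -
      (2 * (n : ℝ) - 1) * deriv (deriv b) x) (fun x hx => by rw [h x hx, sub_self]) x hx
    have h2 := h1.deriv
    linarith [h2.symm.trans this]
  have hform {b c d : ℝ → ℝ} (hb : ContDiffOn ℝ ∞ b I) (hc : ContDiffOn ℝ ∞ c I)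
      (hd : ContDiffOn ℝ ∞ d I)
      (e : Set.EqOn X (fun q => (b q.1, c q.1 * q.2 + d q.1)) (I ×ˢ J))
      (h : ∀ x ∈ I, 2 * deriv c x = (2 * (n : ℝ) - 1) * deriv (deriv b) x)
      (hb3 : ∀ x ∈ I, deriv (deriv (deriv b)) x = 0) :
      IsGenerator n I J f X ↔ ∀ x ∈ I, ∀ y ∈ J,
        iteratedDeriv (2 * n) d x + (c x * y + d x) * deriv f y =
          (c x - 2 * n * deriv b x) * f y := by
    have hz := zeta_eq_of_quadratic hI hJ hb hc hd e
      (fun x hx => by have := hc2 hc hb h x hx; rw [hb3 x hx] at this; linarith) hb3 (2 * n - 1)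
    rw [hN, hN'] at hz
    rw [isGenerator_iff_of_zeta_eq (by omega) (contDiffOn_of_eqOn_affine hb hc hd e)
      (A := fun x _ => c x - 2 * n * deriv b x) (B := fun x _ => iteratedDeriv (2 * n) d x)
      ((smoothJet_fun hc _).sub ((smoothJet_const _ (2 * n)).mul
        (smoothJet_fun (contDiffOn_deriv hI hb) _)))
      (smoothJet_fun (contDiffOn_iteratedDeriv hI hd _) _) (fun x hx u hu => by
        rw [hz x hx u hu]
        have h1 : ((2 * n - 1 : ℕ) : ℝ) = 2 * n - 1 := by linarith
        rw [h1]
        linear_combination n * u (2 * n - 1) * h x hx)]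
    constructor
    · intro H x hx y hy
      have := H x hx (fun _ => y) hy
      rwa [e (show (x, y) ∈ I ×ˢ J from ⟨hx, hy⟩)] at this
    · intro H x hx u hu
      have := H x hx (u 0) hu
      rwa [e (show (x, u 0) ∈ I ×ˢ J from ⟨hx, hu⟩)]
  constructor
  · intro h
    obtain ⟨y₀, hy₀⟩ := hJ'.nonempty
    have hs {φ : ℝ × ℝ → ℝ} (h : ContDiffOn ℝ ∞ φ (I ×ˢ J)) :
        ContDiffOn ℝ ∞ (fun x => φ (x, y₀)) I :=
      h.comp (f := fun x => (x, y₀)) (contDiff_id.prodMk contDiff_const).contDiffOn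
        fun x hx => ⟨hx, hy₀⟩
    have hX := h.1
    set ξ : ℝ × ℝ → ℝ := fun q => (X q).1 with hξ
    set η : ℝ × ℝ → ℝ := fun q => (X q).2 with hη
    have hξs : ContDiffOn ℝ ∞ ξ (I ×ˢ J) := hX.fst
    have hηs : ContDiffOn ℝ ∞ η (I ×ˢ J) := hX.snd
    have hp := h.partials_of_two_le hI hJ hn hξ.symm hη.symm
    have hb := hs hξs
    have hc := hs (contDiffOn_py hI hJ hηs)
    have hd : ContDiffOn ℝ ∞ (fun x => η (x, y₀) - py η (x, y₀) * y₀) I :=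
      (hs hηs).sub (hc.mul contDiffOn_const)
    have e : Set.EqOn X (fun q => ((fun x => ξ (x, y₀)) q.1, (fun x => py η (x, y₀)) q.1 * q.2 +
        (fun x => η (x, y₀) - py η (x, y₀) * y₀) q.1)) (I ×ˢ J) := by
      rintro ⟨x, y⟩ ⟨hx, hy⟩
      refine Prod.ext ?_ ?_
      · exact eq_of_hasDerivAt_zero hJ hJ'.isPreconnected (g := fun t => ξ (x, t)) (fun t ht => by
          simpa [(hp (x, t) ⟨hx, ht⟩).1] using hasDerivAt_py hI hJ hξs hx ht) hy hy₀
      · have := eq_quadratic_of_pyy hI hJ hJ'.isPreconnected hηs hx hy₀ (k := 0)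
          (fun y hy => by rw [(hp (x, y) ⟨hx, hy⟩).2.1, mul_zero]) hy
        show η (x, y) = _
        rw [this]
        ring
    have h1 : ∀ x ∈ I, 2 * deriv (fun x => py η (x, y₀)) x =
        (2 * (n : ℝ) - 1) * deriv (deriv fun x => ξ (x, y₀)) x :=
      fun x hx => (hp (x, y₀) ⟨hx, hy₀⟩).2.2
    have hb3 : ∀ x ∈ I, deriv (deriv (deriv fun x => ξ (x, y₀))) x = 0 := by
      intro x hx
      obtain ⟨m, hm⟩ : ∃ m, 2 * n = m + 4 := ⟨2 * n - 4, by omega⟩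
      have hmn : (2 * (n : ℝ)) = m + 4 := by exact_mod_cast hm
      obtain ⟨R, hR, hz⟩ := zeta_eq_affine hI hJ hb hc hd e (m + 1)
      have e1 : 2 * n - 1 = m + 3 := by omega
      have dv {p : ℝ → ℝ} (hp : ContDiffOn ℝ ∞ p I) := contDiffOn_deriv hI hp
      have sf {p : ℝ → ℝ} (hp : ContDiffOn ℝ ∞ p I) : SmoothJet I J (2 * n - 1) _ :=
        smoothJet_fun hp (2 * n - 1)
      have sk (a : ℝ) := smoothJet_const (I := I) (J := J) (2 * n - 1) a
      have hdet := (isGenerator_iff_of_zeta_eq (by omega) hX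
        ((sf hc).sub ((sk (2 * n)).mul (sf (dv hb))))
        ((((sk ((m + 4) * (m + 3) / 2)).mul (sf (dv (dv hc)))).sub
          ((sk ((m + 4) * (m + 3) * (m + 2) / 6)).mul (sf (dv (dv (dv hb)))))).mul
          (smoothJet_coord (i := m + 2) (by omega)) |>.add (hR.mono (by omega)))
        (fun x hx u hu => by
          rw [hm, show m + 4 = m + 1 + 3 by ring, hz x hx u hu, hmn]
          have := h1 x hx
          rw [hmn] at this
          push_cast
          linear_combination ((m : ℝ) + 4) / 2 * u (m + 1 + 2) * this) f).1 h
      -- Now u_{2n-2} = u_{m+2} is the only coordinate that varies, which isolates its coefficient;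
      -- m + 2 ≥ 2 keeps it apart from u_0.
      set u : ℝ → ℕ → ℝ := fun w i => if i = 0 then y₀ else if i = m + 2 then w else 0 with hu
      have h0 : ∀ w, u w 0 = y₀ := fun w => by simp [hu]
      have h2 : ∀ w, u w (m + 2) = w := fun w => by simp [hu]
      have hRe : R x (u 1) = R x (u 0) := by
        refine hR.eq_of_agree hx ((h0 1).symm ▸ hy₀) fun i hi => ?_
        have : i ≠ m + 2 := by omega
        simp [hu, this]
      have k1 := hdet x hx (u 1) ((h0 1).symm ▸ hy₀)
      have k0 := hdet x hx (u 0) ((h0 0).symm ▸ hy₀)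
      have h3 := hc2 hc hb h1 x hx
      simp only [h0, h2, hRe] at k0 k1
      rw [hmn] at h3
      -- With N = m + 4, the coefficient of u_{N-2} is N(N-1)/2 c'' - N(N-1)(N-2)/6 b'''. Inserting
      -- 2c'' = (N-1) b''' turns it into N(N-1)(N+1)/12 b'''.
      have hpos : ((m : ℝ) + 4) * (m + 3) * (m + 5) / 12 ≠ 0 := by positivity
      apply mul_left_cancel₀ hpos
      linear_combination k1 - k0 - (m + 4) * (m + 3) / 4 * h3
    have H := (hform hb hc hd e h1 hb3).1 h
    exact ⟨_, _, _, hb, hc, hd, e, fun x hx => ⟨h1 x hx, hb3 x hx, H x hx⟩⟩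
  · rintro ⟨b, c, d, hb, hc, hd, e, h⟩
    exact (hform hb hc hd e (fun x hx => (h x hx).1) fun x hx => (h x hx).2.1).2
      fun x hx => (h x hx).2.2

end

/-! ### Elementary differential equations on intervals and the common affine system -/

section

variable {I J : Set ℝ} {X : VField}

/-- The means by which identities holding throughout an open set are differentiated, in x or in y.
-/
theorem _root_.HasDerivAt.unique_of_eqOn {S : Set ℝ} (hS : IsOpen S) {g h : ℝ → ℝ} (e : Set.EqOn g h S)
    {t g' h' : ℝ} (ht : t ∈ S) (hg : HasDerivAt g g' t) (hh : HasDerivAt h h' t) : g' = h' := by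
  refine hg.unique (hh.congr_of_eventuallyEq ?_)
  filter_upwards [hS.mem_nhds ht] with s hs
  exact e hs

theorem deriv_quadratic (β₀ β₁ β₂ : ℝ) :
    deriv (fun x => β₀ + β₁ * x + β₂ * x ^ 2) = fun x => β₁ + 2 * β₂ * x := by
  ext x
  have := (((hasDerivAt_id x).const_mul β₁).const_add β₀).add (((hasDerivAt_id x).pow 2).const_mul β₂)
  refine HasDerivAt.deriv (this.congr_deriv ?_)
  simp
  ring

theorem deriv_affine (β₀ β₁ : ℝ) : deriv (fun x => β₀ + β₁ * x) = fun _ => β₁ := by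
  simp

theorem eq_add_of_deriv_eq (hI : IsOpen I) (hI' : IsConnected I) {g h : ℝ → ℝ}
    (hg : ContDiffOn ℝ ∞ g I) (hh : ContDiffOn ℝ ∞ h I) (e : ∀ x ∈ I, deriv g x = deriv h x) :
    ∃ k, ∀ x ∈ I, g x = h x + k := by
  obtain ⟨x₀, hx₀⟩ := hI'.nonempty
  refine ⟨g x₀ - h x₀, fun x hx => ?_⟩
  have := eq_of_hasDerivAt_zero hI hI'.isPreconnected (g := fun x => g x - h x) (fun t ht => by
    have := (hasDerivAt_of_contDiffOn hI hg ht).sub (hasDerivAt_of_contDiffOn hI hh ht)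
    rwa [e t ht, sub_self] at this) hx hx₀
  linarith

theorem eq_const_of_deriv (hI : IsOpen I) (hI' : IsConnected I) {g : ℝ → ℝ}
    (hg : ContDiffOn ℝ ∞ g I) (e : ∀ x ∈ I, deriv g x = 0) : ∃ k, ∀ x ∈ I, g x = k := by
  obtain ⟨k, hk⟩ := eq_add_of_deriv_eq hI hI' hg (contDiffOn_const (c := 0)) (by simpa using e)
  exact ⟨k, by simpa using hk⟩

theorem eq_affine_of_deriv2 (hI : IsOpen I) (hI' : IsConnected I) {g : ℝ → ℝ}
    (hg : ContDiffOn ℝ ∞ g I) (e : ∀ x ∈ I, deriv (deriv g) x = 0) :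
    ∃ β₀ β₁ : ℝ, ∀ x ∈ I, g x = β₀ + β₁ * x := by
  obtain ⟨k, hk⟩ := eq_const_of_deriv hI hI' (contDiffOn_deriv hI hg) e
  obtain ⟨m, hm⟩ := eq_add_of_deriv_eq hI hI' hg (h := fun x => 0 + k * x)
    (by apply ContDiff.contDiffOn; fun_prop) (by simpa [deriv_affine] using hk)
  exact ⟨m, k, fun x hx => by rw [hm x hx]; ring⟩

theorem eq_quadratic_of_deriv3 (hI : IsOpen I) (hI' : IsConnected I) {g : ℝ → ℝ}
    (hg : ContDiffOn ℝ ∞ g I) (e : ∀ x ∈ I, deriv (deriv (deriv g)) x = 0) :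
    ∃ β₀ β₁ β₂ : ℝ, ∀ x ∈ I, g x = β₀ + β₁ * x + β₂ * x ^ 2 := by
  obtain ⟨k, l, hk⟩ := eq_affine_of_deriv2 hI hI' (contDiffOn_deriv hI hg) e
  obtain ⟨m, hm⟩ := eq_add_of_deriv_eq hI hI' hg (h := fun x => 0 + k * x + l / 2 * x ^ 2)
    (by apply ContDiff.contDiffOn; fun_prop)
    (fun x hx => by rw [hk x hx, deriv_quadratic]; ring)
  exact ⟨m, k, l / 2, fun x hx => by rw [hm x hx]; ring⟩

theorem deriv_congr_of_eqOn (hI : IsOpen I) {g h : ℝ → ℝ} (e : ∀ x ∈ I, g x = h x) :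
    ∀ x ∈ I, deriv g x = deriv h x := by
  intro x hx
  refine Filter.EventuallyEq.deriv_eq ?_
  filter_upwards [hI.mem_nhds hx] with t ht
  exact e t ht

theorem exists_ne_of_isOpen {S : Set ℝ} (hS : IsOpen S) (hne : S.Nonempty) (z : ℝ) :
    ∃ y ∈ S, y ≠ z := by
  obtain ⟨y, hy⟩ := hne
  obtain ⟨ε, hε, hb⟩ := Metric.isOpen_iff.1 hS y hy
  by_cases h : y = z
  · refine ⟨y + ε / 2, hb ?_, ?_⟩
    · rw [Metric.mem_ball, Real.dist_eq]
      rw [add_sub_cancel_left, abs_of_pos (by linarith)]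
      linarith
    · rw [h]
      linarith
  · exact ⟨y, hy, h⟩

/-- An open nonempty set contains two distinct points. Identities in y are split into their
coefficients by this lemma. -/
theorem affine_eq_zero {S : Set ℝ} (hS : IsOpen S) (hne : S.Nonempty) {α β : ℝ}
    (h : ∀ y ∈ S, α * y + β = 0) : α = 0 ∧ β = 0 := by
  obtain ⟨y, hy⟩ := hne
  obtain ⟨z, hz, hzy⟩ := exists_ne_of_isOpen hS ⟨y, hy⟩ y
  have : α * (z - y) = 0 := by linear_combination h z hz - h y hy
  have hα : α = 0 := (mul_eq_zero.1 this).resolve_right (sub_ne_zero.2 hzy)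
  refine ⟨hα, ?_⟩
  simpa [hα] using h y hy

/-- `b(x) ∂/∂x + (c(x) y + d(x)) ∂/∂y` solves the determining system of `y⁽²ⁿ⁾ + f(y) = 0`. -/
structure AffineSymmetry (n : ℕ) (I J : Set ℝ) (f b c d : ℝ → ℝ) : Prop where
  smooth_b : ContDiffOn ℝ ∞ b I
  smooth_c : ContDiffOn ℝ ∞ c I
  smooth_d : ContDiffOn ℝ ∞ d I
  deriv_c : ∀ x ∈ I, 2 * deriv c x = (2 * (n : ℝ) - 1) * deriv (deriv b) x
  deriv_b : n ≠ 1 → ∀ x ∈ I, deriv (deriv (deriv b)) x = 0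
  eqn : ∀ x ∈ I, ∀ y ∈ J, deriv (deriv c) x * y + iteratedDeriv (2 * n) d x
    + (c x * y + d x) * deriv f y = (c x - 2 * n * deriv b x) * f y

theorem iteratedDeriv_two_eq (d : ℝ → ℝ) : iteratedDeriv 2 d = deriv (deriv d) := by
  rw [iteratedDeriv_succ, iteratedDeriv_one]

section AffineSymmetry

variable {n : ℕ} {f b c d : ℝ → ℝ}

theorem AffineSymmetry.deriv2_c (hI : IsOpen I) (h : AffineSymmetry n I J f b c d) :
    ∀ x ∈ I, 2 * deriv (deriv c) x = (2 * (n : ℝ) - 1) * deriv (deriv (deriv b)) x := by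
  intro x hx
  exact HasDerivAt.unique_of_eqOn hI (fun x hx => h.deriv_c x hx) hx
    ((hasDerivAt_of_contDiffOn hI (contDiffOn_deriv hI h.smooth_c) hx).const_mul 2)
    ((hasDerivAt_of_contDiffOn hI (contDiffOn_deriv hI (contDiffOn_deriv hI h.smooth_b)) hx).const_mul
      (2 * (n : ℝ) - 1))

/-- The single system serves all orders: the term c'' y is η_xx for n = 1, and for n ≥ 2 it vanishes
because b''' = 0 forces c'' = 0. -/
theorem AffineSymmetry.isGenerator (hI : IsOpen I) (hJ : IsOpen J) (hJ' : IsConnected J)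
    (hn : 1 ≤ n) (h : AffineSymmetry n I J f b c d)
    (e : Set.EqOn X (fun q => (b q.1, c q.1 * q.2 + d q.1)) (I ×ˢ J)) : IsGenerator n I J f X := by
  rcases hn.eq_or_lt with rfl | hn
  · refine (isGenerator_one_iff hI hJ hJ' f).2 ⟨fun _ => 0, b, c, d, contDiffOn_const, h.smooth_b,
      h.smooth_c, h.smooth_d, e.trans fun q _ => by simp, fun x hx y hy => ?_⟩
    have h1 := h.deriv_c x hx
    have h2 := h.eqn x hx y hy
    rw [mul_one, iteratedDeriv_two_eq] at h2
    simp only [deriv_const', deriv_const]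
    push_cast at h1 h2
    exact ⟨by linear_combination h1, by linear_combination h2⟩
  · refine (isGenerator_iff_of_two_le hI hJ hJ' hn f).2 ⟨b, c, d, h.smooth_b, h.smooth_c, h.smooth_d,
      e, fun x hx => ⟨h.deriv_c x hx, h.deriv_b (by omega) x hx, fun y hy => ?_⟩⟩
    have h1 := h.deriv2_c hI x hx
    rw [h.deriv_b (by omega) x hx] at h1
    linear_combination h.eqn x hx y hy - y / 2 * h1

/-- Only n = 1 needs non-affinity: the equation 3a'' y + 2c' - b'' + 3a f = 0 at a point with a ≠ 0
would express f as an affine function of y. So a = 0, and the y-dependence of ξ and the y² term of η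
disappear. -/
theorem IsGenerator.exists_affineSymmetry (hI : IsOpen I) (hJ : IsOpen J) (hJ' : IsConnected J)
    (hn : 1 ≤ n) (hf : ¬ ∃ α β : ℝ, ∀ y ∈ J, f y = α * y + β) (h : IsGenerator n I J f X) :
    ∃ b c d : ℝ → ℝ, AffineSymmetry n I J f b c d ∧
      Set.EqOn X (fun q => (b q.1, c q.1 * q.2 + d q.1)) (I ×ˢ J) := by
  rcases hn.eq_or_lt with rfl | hn
  · obtain ⟨a, b, c, d, -, hb, hc, hd, e, h⟩ := (isGenerator_one_iff hI hJ hJ' f).1 h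
    have a0 : ∀ x ∈ I, a x = 0 := by
      intro x hx
      by_contra ha
      refine hf ⟨-(deriv (deriv a) x) / a x,
        -(2 * deriv c x - deriv (deriv b) x) / (3 * a x), fun y hy => ?_⟩
      have := (h x hx y hy).1
      field_simp
      linear_combination this
    have a1 := deriv_eq_zero_of_eqOn hI a0
    have a2 := deriv_eq_zero_of_eqOn hI a1
    have a3 := deriv_eq_zero_of_eqOn hI a2
    refine ⟨b, c, d, ⟨hb, hc, hd, fun x hx => ?_, fun h => absurd rfl h, fun x hx y hy => ?_⟩, ?_⟩
    · obtain ⟨y, hy⟩ := hJ'.nonempty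
      have := (h x hx y hy).1
      rw [a0 x hx, a2 x hx] at this
      push_cast
      linear_combination this
    · have := (h x hx y hy).2
      rw [a1 x hx, a3 x hx] at this
      rw [mul_one, iteratedDeriv_two_eq]
      push_cast
      linear_combination this
    · exact e.trans fun q hq => by simp [a0 q.1 hq.1, a1 q.1 hq.1]
  · obtain ⟨b, c, d, hb, hc, hd, e, h⟩ := (isGenerator_iff_of_two_le hI hJ hJ' hn f).1 h
    refine ⟨b, c, d, ⟨hb, hc, hd, fun x hx => (h x hx).1, fun _ x hx => (h x hx).2.1,
      fun x hx y hy => ?_⟩, e⟩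
    have h2 := HasDerivAt.unique_of_eqOn hI (fun x hx => (h x hx).1) hx
      ((hasDerivAt_of_contDiffOn hI (contDiffOn_deriv hI hc) hx).const_mul 2)
      ((hasDerivAt_of_contDiffOn hI (contDiffOn_deriv hI (contDiffOn_deriv hI hb)) hx).const_mul
        (2 * (n : ℝ) - 1))
    rw [(h x hx).2.1] at h2
    linear_combination (h x hx).2.2 y hy + y / 2 * h2

end AffineSymmetry

theorem isSymmetryBasis_of_fintype {n : ℕ} {f : ℝ → ℝ} {ι : Type} [Fintype ι] {v : ι → VField}
    (h0 : ∀ r : ι → ℝ, Set.EqOn (∑ i, r i • v i) 0 (I ×ˢ J) → r = 0)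
    (h : ∀ X, IsGenerator n I J f X ↔ ∃ r : ι → ℝ, Set.EqOn X (∑ i, r i • v i) (I ×ˢ J)) :
    IsSymmetryBasis n I J f v := by
  refine ⟨?_, fun X => ?_⟩
  · rw [Fintype.linearIndependent_iff]
    intro r hr
    refine congrFun (h0 r fun q hq => ?_)
    have := congrFun hr ⟨q, hq⟩
    simpa using this
  · rw [h X]
    constructor
    · rintro ⟨r, hr⟩
      exact ⟨_, (Submodule.mem_span_range_iff_exists_fun ℝ).2 ⟨r, rfl⟩, hr⟩
    · rintro ⟨W, hW, e⟩
      obtain ⟨r, rfl⟩ := (Submodule.mem_span_range_iff_exists_fun ℝ).1 hW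
      exact ⟨r, e⟩

end

/-! ### Exponential nonlinearities, common generators, power nonlinearities -/

section

variable {I J : Set ℝ} {X : VField} {n : ℕ} {f b c d : ℝ → ℝ}

theorem iteratedDeriv_const_eq_zero {N : ℕ} (hN : N ≠ 0) (k : ℝ) :
    iteratedDeriv N (fun _ : ℝ => k) = fun _ => 0 := by
  ext x
  simp [iteratedDeriv_const, hN]

theorem affineSymmetry_const (β : ℝ) :
    AffineSymmetry n I J f (fun _ => β) (fun _ => 0) (fun _ => 0) where
  smooth_b := contDiffOn_const
  smooth_c := contDiffOn_const
  smooth_d := contDiffOn_const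
  deriv_c := by simp
  deriv_b := by simp
  eqn x hx y hy := by
    simp

theorem not_affine_of_deriv2 (hJ : IsOpen J) {y : ℝ} (hy : y ∈ J)
    (h : deriv (deriv f) y ≠ 0) : ¬ ∃ α β : ℝ, ∀ y ∈ J, f y = α * y + β := by
  rintro ⟨α, β, e⟩
  apply h
  have e1 : ∀ y ∈ J, deriv f y = α := by
    intro y hy
    rw [deriv_congr_of_eqOn hJ (h := fun y => β + α * y) (fun y hy => by rw [e y hy]; ring) y hy,
      deriv_affine]
  rw [deriv_congr_of_eqOn hJ e1 y hy, deriv_const]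

section exponential

variable {l a : ℝ}

theorem deriv_exp_mul (l a : ℝ) (y : ℝ) :
    HasDerivAt (fun y => l * Real.exp (a * y)) (a * (l * Real.exp (a * y))) y := by
  have := (((hasDerivAt_id y).const_mul a).exp).const_mul l
  refine this.congr_deriv ?_
  simp
  ring

/-- At fixed x the equation reads (affine in y) · e^{ay} = (affine in y). Two differentiations in y
kill the right side and leave an affine factor times a nonvanishing exponential, so that factor is
zero. -/
theorem AffineSymmetry.of_exp (hJ : IsOpen J) (hJ' : IsConnected J) (hl : l ≠ 0) (ha : a ≠ 0)
    (hf : ∀ y ∈ J, f y = l * Real.exp (a * y)) (h : AffineSymmetry n I J f b c d) :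
    ∀ x ∈ I, c x = 0 ∧ a * d x = -(2 * n * deriv b x) := by
  intro x hx
  have hf' : ∀ y ∈ J, deriv f y = a * (l * Real.exp (a * y)) := fun y hy => by
    rw [deriv_congr_of_eqOn hJ hf y hy, (deriv_exp_mul l a y).deriv]
  set s := a * d x - (c x - 2 * n * deriv b x) with hs
  have h0 : Set.EqOn (fun y => (a * c x * y + s) * (l * Real.exp (a * y)))
      (fun y => -(deriv (deriv c) x * y + iteratedDeriv (2 * n) d x)) J := by
    intro y hy
    have := h.eqn x hx y hy
    rw [hf' y hy, hf y hy] at this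
    simp only [hs]
    linear_combination this
  have hlin (α β y : ℝ) : HasDerivAt (fun y => α * y + β) α y := by
    simpa using ((hasDerivAt_id y).const_mul α).add_const β
  have h1 : Set.EqOn (fun y => (a * (a * c x) * y + (a * c x + a * s)) * (l * Real.exp (a * y)))
      (fun y => -deriv (deriv c) x) J := by
    intro y hy
    have := HasDerivAt.unique_of_eqOn hJ h0 hy
      ((hlin (a * c x) s y).fun_mul (deriv_exp_mul l a y)) (hlin _ _ y).neg
    simp only
    linear_combination this
  have h2 : ∀ y ∈ J, (a * (a * (a * c x))) * y + (a * (a * c x) + a * (a * c x + a * s)) = 0 := by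
    intro y hy
    have := HasDerivAt.unique_of_eqOn hJ h1 hy
      ((hlin (a * (a * c x)) _ y).fun_mul (deriv_exp_mul l a y)) (hasDerivAt_const _ _)
    have hE : l * Real.exp (a * y) ≠ 0 := mul_ne_zero hl (Real.exp_ne_zero _)
    apply mul_right_cancel₀ hE
    linear_combination this
  obtain ⟨k1, k2⟩ := affine_eq_zero hJ hJ'.nonempty h2
  have hc : c x = 0 := by simpa [ha] using k1
  refine ⟨hc, ?_⟩
  rw [hc] at k2
  have : s = 0 := by simpa [ha] using k2
  rw [hs, hc] at this
  linarith

theorem affineSymmetry_exp (hJ : IsOpen J) (hn : 1 ≤ n) (ha : a ≠ 0)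
    (hf : ∀ y ∈ J, f y = l * Real.exp (a * y)) (β₀ β₁ : ℝ) :
    AffineSymmetry n I J f (fun x => β₀ + β₁ * x) (fun _ => 0)
      (fun _ => -(2 * (n : ℝ) / a) * β₁) where
  smooth_b := by apply ContDiff.contDiffOn; fun_prop
  smooth_c := contDiffOn_const
  smooth_d := contDiffOn_const
  deriv_c := by simp
  deriv_b := by simp
  eqn x hx y hy := by
    rw [iteratedDeriv_const_eq_zero (show 2 * n ≠ 0 by omega), deriv_affine,
      deriv_congr_of_eqOn hJ hf y hy, (deriv_exp_mul l a y).deriv, hf y hy]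
    simp
    field_simp

theorem isSymmetryBasis_exp (hI : IsOpen I) (hI' : IsConnected I) (hJ : IsOpen J)
    (hJ' : IsConnected J) (hn : 1 ≤ n) (hl : l ≠ 0) (ha : a ≠ 0)
    (hf : ∀ y ∈ J, f y = l * Real.exp (a * y)) : IsSymmetryBasis n I J f ![X₁, D₁ n a] := by
  refine isSymmetryBasis_of_fintype (fun r hr => ?_) fun X => ⟨fun hX => ?_, ?_⟩
  · obtain ⟨y, hy⟩ := hJ'.nonempty
    have := affine_eq_zero hI hI'.nonempty (α := r 1) (β := r 0) fun x hx => by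
      simpa [X₁, D₁, add_comm] using congrArg Prod.fst (hr (show (x, y) ∈ I ×ˢ J from ⟨hx, hy⟩))
    ext i
    fin_cases i
    · exact this.2
    · exact this.1
  · obtain ⟨y, hy⟩ := hJ'.nonempty
    have hna : ¬ ∃ α β : ℝ, ∀ y ∈ J, f y = α * y + β := by
      refine not_affine_of_deriv2 hJ hy ?_
      have : ∀ y ∈ J, deriv f y = a * l * Real.exp (a * y) := fun y hy => by
        rw [deriv_congr_of_eqOn hJ hf y hy, (deriv_exp_mul l a y).deriv, mul_assoc]
      rw [deriv_congr_of_eqOn hJ this y hy, (deriv_exp_mul _ a y).deriv]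
      simp [ha, hl]
    obtain ⟨b, c, d, h, e⟩ := hX.exists_affineSymmetry hI hJ hJ' hn hna
    have hcd := h.of_exp hJ hJ' hl ha hf
    have hc1 := deriv_eq_zero_of_eqOn hI fun x hx => (hcd x hx).1
    have hn' : 2 * (n : ℝ) - 1 ≠ 0 := by
      have : (1 : ℝ) ≤ n := by exact_mod_cast hn
      linarith
    have hb2 : ∀ x ∈ I, deriv (deriv b) x = 0 := fun x hx => by
      have := h.deriv_c x hx
      rw [hc1 x hx, mul_zero] at this
      exact (mul_eq_zero.1 this.symm).resolve_left hn'
    obtain ⟨β₀, β₁, hb⟩ := eq_affine_of_deriv2 hI hI' h.smooth_b hb2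
    refine ⟨![β₀, β₁], fun q hq => ?_⟩
    have h1 := hcd q.1 hq.1
    rw [deriv_congr_of_eqOn hI hb q.1 hq.1, deriv_affine] at h1
    have hd : d q.1 = -(2 * (n : ℝ) / a) * β₁ := by
      field_simp
      linear_combination h1.2
    rw [e hq]
    simp [X₁, D₁, hb q.1 hq.1, h1.1, hd, mul_comm]
  · rintro ⟨r, hr⟩
    refine (affineSymmetry_exp hJ hn ha hf (r 0) (r 1)).isGenerator hI hJ hJ' hn
      (hr.trans fun q hq => ?_)
    simp [X₁, D₁, mul_comm]

end exponential

/-- The common generators of all equations `y⁽²ⁿ⁾ + f(y) = 0`. -/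
theorem isGenerator_forall_iff (hI : IsOpen I) (hI' : IsConnected I) (hJ : IsOpen J)
    (hJ' : IsConnected J) (hn : 1 ≤ n) :
    (∀ f : ℝ → ℝ, ContDiffOn ℝ ∞ f J → IsGenerator n I J f X) ↔
      ∃ c : ℝ, Set.EqOn X (c • X₁) (I ×ˢ J) := by
  constructor
  · intro h
    -- Exponentials with two different exponents suffice: the fields D₁ for a = 1 and a = 2 share
    -- their ∂_x part but not their ∂_y part, so the coefficient of D₁ must vanish.
    have hexp (a : ℝ) (ha : a ≠ 0) : ∃ r : Fin 2 → ℝ,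
        Set.EqOn X (fun q => (r 0 + r 1 * q.1, -(2 * (n : ℝ) / a) * r 1)) (I ×ˢ J) := by
      obtain ⟨W, hW, e⟩ := ((isSymmetryBasis_exp hI hI' hJ hJ' hn one_ne_zero ha
        (f := fun y => 1 * Real.exp (a * y)) fun _ _ => rfl).2 X).1 (h _
          (by apply ContDiff.contDiffOn; fun_prop))
      obtain ⟨r, rfl⟩ := (Submodule.mem_span_range_iff_exists_fun ℝ).1 hW
      exact ⟨r, e.trans fun q _ => by simp [X₁, D₁, mul_comm]⟩
    obtain ⟨r, hr⟩ := hexp 1 one_ne_zero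
    obtain ⟨s, hs⟩ := hexp 2 two_ne_zero
    obtain ⟨y, hy⟩ := hJ'.nonempty
    obtain ⟨x, hx⟩ := hI'.nonempty
    have hn' : (n : ℝ) ≠ 0 := by
      have : (1 : ℝ) ≤ n := by exact_mod_cast hn
      linarith
    have e1 := affine_eq_zero hI hI'.nonempty (α := r 1 - s 1) (β := r 0 - s 0) fun x hx => by
      have := congrArg Prod.fst ((hr (show (x, y) ∈ I ×ˢ J from ⟨hx, hy⟩)).symm.trans (hs ⟨hx, hy⟩))
      simp only at this
      linear_combination this
    have e2 : (n : ℝ) * r 1 = 0 := by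
      have := congrArg Prod.snd ((hr (show (x, y) ∈ I ×ˢ J from ⟨hx, hy⟩)).symm.trans (hs ⟨hx, hy⟩))
      simp only at this
      linear_combination -this - n * e1.1
    have hr1 := (mul_eq_zero.1 e2).resolve_left hn'
    refine ⟨r 0, hr.trans fun q _ => ?_⟩
    simp [X₁, hr1]
  · rintro ⟨k, hk⟩ f -
    exact (affineSymmetry_const k).isGenerator hI hJ hJ' hn (hk.trans fun q _ => by simp [X₁])

section power

variable {p l : ℝ} {g : ℝ → ℝ}

/-- `f` is a multiple of `y ^ p` as far as the classification is concerned. -/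
structure IsHomogeneous (J : Set ℝ) (p : ℝ) (f : ℝ → ℝ) : Prop where
  smooth : ContDiffOn ℝ ∞ f J
  euler : ∀ y ∈ J, y * deriv f y = p * f y
  ne_zero : ∀ y ∈ J, y ≠ 0 → f y ≠ 0

/-- The classification uses only smoothness, Euler's equation y f' = p f, and f ≠ 0 away from the
origin, so the three kinds of branches need not be distinguished afterwards. The origin is excepted
for natural powers on intervals containing 0. -/
theorem IsPowerBranch.isHomogeneous (hJ : IsOpen J) (hg : IsPowerBranch J p g) (hl : l ≠ 0)
    (hf : ∀ y ∈ J, f y = l * g y) : IsHomogeneous J p f := by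
  rcases hg with hg | ⟨ε, hε, hg⟩ | ⟨m, rfl, hg⟩
  · have hf : ∀ y ∈ J, f y = l * y ^ p := fun y hy => by rw [hf y hy, (hg y hy).2]
    have hy0 : ∀ y ∈ J, y ≠ 0 := fun y hy => (hg y hy).1.ne'
    refine ⟨(contDiffOn_const.mul (contDiffOn_id.rpow_const_of_ne hy0)).congr hf, fun y hy => ?_,
      fun y hy _ => ?_⟩
    · rw [deriv_congr_of_eqOn hJ hf y hy, hf y hy,
        ((Real.hasDerivAt_rpow_const (Or.inl (hy0 y hy))).const_mul l).deriv,
        Real.rpow_sub_one (hy0 y hy)]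
      field_simp [hy0 y hy]
    · rw [hf y hy]
      exact mul_ne_zero hl (Real.rpow_pos_of_pos (hg y hy).1 p).ne'
  · have hf : ∀ y ∈ J, f y = l * ε * (-y) ^ p := fun y hy => by rw [hf y hy, (hg y hy).2, mul_assoc]
    have hy0 : ∀ y ∈ J, -y ≠ 0 := fun y hy => (neg_pos.2 (hg y hy).1).ne'
    have hε0 : ε ≠ 0 := by rcases hε with rfl | rfl <;> norm_num
    refine ⟨(contDiffOn_const.mul (contDiffOn_id.neg.rpow_const_of_ne hy0)).congr hf,
      fun y hy => ?_, fun y hy _ => ?_⟩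
    · have hd := ((hasDerivAt_neg y).rpow_const (p := p) (Or.inl (hy0 y hy))).const_mul (l * ε)
      rw [deriv_congr_of_eqOn hJ hf y hy, hf y hy, hd.deriv, Real.rpow_sub_one (hy0 y hy)]
      have := neg_ne_zero.1 (hy0 y hy)
      field_simp
    · rw [hf y hy]
      exact mul_ne_zero (mul_ne_zero hl hε0) (Real.rpow_pos_of_pos (neg_pos.2 (hg y hy).1) p).ne'
  · have hf : ∀ y ∈ J, f y = l * y ^ m := fun y hy => by rw [hf y hy, hg y hy]
    refine ⟨(contDiffOn_const.mul (contDiffOn_id.pow m)).congr hf, fun y hy => ?_,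
      fun y hy hy0 => ?_⟩
    · rw [deriv_congr_of_eqOn hJ hf y hy, hf y hy, ((hasDerivAt_pow m y).const_mul l).deriv]
      cases m with
      | zero => simp
      | succ m =>
        rw [Nat.add_sub_cancel, pow_succ]
        ring
    · rw [hf y hy]
      exact mul_ne_zero hl (pow_ne_zero m hy0)

theorem IsHomogeneous.deriv (hJ : IsOpen J) (hp : p ≠ 0) (hf : IsHomogeneous J p f) :
    IsHomogeneous J (p - 1) (deriv f) where
  smooth := contDiffOn_deriv hJ hf.smooth
  euler y hy := by
    have := HasDerivAt.unique_of_eqOn hJ hf.euler hy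
      ((hasDerivAt_id y).fun_mul (hasDerivAt_of_contDiffOn hJ (contDiffOn_deriv hJ hf.smooth) hy))
      ((hasDerivAt_of_contDiffOn hJ hf.smooth hy).const_mul p)
    simp only [id] at this
    linear_combination this
  ne_zero y hy hy0 h := by
    have := hf.euler y hy
    rw [h, mul_zero] at this
    exact mul_ne_zero hp (hf.ne_zero y hy hy0) this.symm

theorem IsHomogeneous.not_affine (hJ : IsOpen J) (hJ' : IsConnected J) (hp0 : p ≠ 0) (hp1 : p ≠ 1)
    (hf : IsHomogeneous J p f) : ¬ ∃ α β : ℝ, ∀ y ∈ J, f y = α * y + β := by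
  obtain ⟨y, hy, hy0⟩ := exists_ne_of_isOpen hJ hJ'.nonempty 0
  exact not_affine_of_deriv2 hJ hy
    (((hf.deriv hJ hp0).deriv hJ (sub_ne_zero.2 hp1)).ne_zero y hy hy0)

theorem one_le_cast (hn : 1 ≤ n) : (1 : ℝ) ≤ n := by exact_mod_cast hn

/-- Euler's equation turns the system into d f' = κ f - (polynomial of degree one in y), with κ = c
- 2n b' - c p. Two y-derivatives give d f''' = κ f''; multiplying by y and using y f''' = (p-2) f''
gives κ y = d (p-2), hence κ = 0 and d (p-2) = 0. For p ≠ 2 this yields d = 0 and then c'' = 0. For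
p = 2, κ = 0 reads c = -2n b', which together with 2c' = (2n-1)b'' gives (6n-1) c' = 0. -/
theorem AffineSymmetry.of_isHomogeneous (hI : IsOpen I) (hJ : IsOpen J) (hJ' : IsConnected J)
    (hn : 1 ≤ n) (hp0 : p ≠ 0) (hp1 : p ≠ 1) (hf : IsHomogeneous J p f)
    (h : AffineSymmetry n I J f b c d) :
    ∀ x ∈ I, d x = 0 ∧ c x * (p - 1) = -(2 * n * deriv b x) ∧ deriv (deriv c) x = 0 := by
  have f1 := hf.deriv hJ hp0
  have f2 := f1.deriv hJ (sub_ne_zero.2 hp1)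
  have hd0 {t : ℝ} (ht : t ∈ J) := hasDerivAt_of_contDiffOn hJ hf.smooth ht
  have hd1 {t : ℝ} (ht : t ∈ J) := hasDerivAt_of_contDiffOn hJ f1.smooth ht
  have hd2 {t : ℝ} (ht : t ∈ J) := hasDerivAt_of_contDiffOn hJ f2.smooth ht
  have R1 : ∀ x ∈ I, ∀ y ∈ J, d x * deriv f y =
      (c x - 2 * n * deriv b x - c x * p) * f y +
        -(deriv (deriv c) x * y + iteratedDeriv (2 * n) d x) := by
    intro x hx y hy
    linear_combination h.eqn x hx y hy - c x * hf.euler y hy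
  have hlin (α β y : ℝ) : HasDerivAt (fun y => α * y + β) α y := by
    simpa using ((hasDerivAt_id y).const_mul α).add_const β
  have R2 : ∀ x ∈ I, ∀ y ∈ J, d x * deriv (deriv f) y =
      (c x - 2 * n * deriv b x - c x * p) * deriv f y + -deriv (deriv c) x :=
    fun x hx y hy => HasDerivAt.unique_of_eqOn hJ (R1 x hx) hy ((hd1 hy).const_mul _)
      (((hd0 hy).const_mul _).add (hlin _ _ y).neg)
  have R3 : ∀ x ∈ I, ∀ y ∈ J, d x * deriv (deriv (deriv f)) y =
      (c x - 2 * n * deriv b x - c x * p) * deriv (deriv f) y + 0 :=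
    fun x hx y hy => HasDerivAt.unique_of_eqOn hJ (R2 x hx) hy ((hd2 hy).const_mul _)
      (((hd1 hy).const_mul _).add (hasDerivAt_const _ _))
  have key : ∀ x ∈ I, c x - 2 * n * deriv b x - c x * p = 0 ∧ d x * (p - 2) = 0 := by
    intro x hx
    have hz : ∀ y ∈ J, y ≠ 0 →
        (c x - 2 * n * deriv b x - c x * p) * y + -(d x * (p - 2)) = 0 := by
      intro y hy hy0
      apply mul_right_cancel₀ (f2.ne_zero y hy hy0)
      linear_combination d x * f2.euler y hy - y * R3 x hx y hy
    -- Cancelling f'' is possible only for y ≠ 0, and the punctured set is still open.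
    have hJ0 : IsOpen (J \ {0}) := hJ.sdiff isClosed_singleton
    obtain ⟨y, hy, hy0⟩ := exists_ne_of_isOpen hJ hJ'.nonempty 0
    have := affine_eq_zero hJ0 ⟨y, hy, hy0⟩ fun y hy => hz y hy.1 hy.2
    exact ⟨this.1, neg_eq_zero.1 this.2⟩
  have hn1 := one_le_cast hn
  have hlast : ∀ x ∈ I, deriv (deriv c) x = 0 → d x = 0 := by
    intro x hx h2
    obtain ⟨y, hy, hy0⟩ := exists_ne_of_isOpen hJ hJ'.nonempty 0
    have := R2 x hx y hy
    rw [h2, (key x hx).1, zero_mul, neg_zero, add_zero] at this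
    exact (mul_eq_zero.1 this).resolve_right (f2.ne_zero y hy hy0)
  have h2 : ∀ x ∈ I, deriv (deriv c) x = 0 := by
    by_cases hp2 : p = 2
    · have hb2 : ∀ x ∈ I, deriv c x = 0 := by
        intro x hx
        have e1 := HasDerivAt.unique_of_eqOn hI (g := c) (h := fun x => -(2 * n) * deriv b x)
          (fun x hx => by have := (key x hx).1; rw [hp2] at this; linear_combination -this) hx
          (hasDerivAt_of_contDiffOn hI h.smooth_c hx)
          ((hasDerivAt_of_contDiffOn hI (contDiffOn_deriv hI h.smooth_b) hx).const_mul _)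
        have e2 := h.deriv_c x hx
        have : (6 * (n : ℝ) - 1) * deriv c x = 0 := by
          linear_combination (2 * n - 1) * e1 + 2 * n * e2
        exact (mul_eq_zero.1 this).resolve_left (by linarith)
      exact deriv_eq_zero_of_eqOn hI hb2
    · have hd : ∀ x ∈ I, d x = 0 := fun x hx =>
        (mul_eq_zero.1 (key x hx).2).resolve_right (sub_ne_zero.2 hp2)
      intro x hx
      obtain ⟨y, hy⟩ := hJ'.nonempty
      have := R2 x hx y hy
      rw [hd x hx, (key x hx).1] at this
      linarith
  exact fun x hx => ⟨hlast x hx (h2 x hx), by linear_combination -(key x hx).1, h2 x hx⟩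

theorem affineSymmetry_of_isHomogeneous (hn : 1 ≤ n) (hp1 : p ≠ 1) (hf : IsHomogeneous J p f)
    (β₀ β₁ : ℝ) : AffineSymmetry n I J f (fun x => β₀ + β₁ * x)
      (fun _ => β₁ * (2 * (n : ℝ) / (1 - p))) (fun _ => 0) where
  smooth_b := by apply ContDiff.contDiffOn; fun_prop
  smooth_c := contDiffOn_const
  smooth_d := contDiffOn_const
  deriv_c := by simp
  deriv_b := by simp
  eqn x hx y hy := by
    have h1 : 1 - p ≠ 0 := sub_ne_zero.2 hp1.symm
    rw [iteratedDeriv_const_eq_zero (show 2 * n ≠ 0 by omega), deriv_affine]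
    simp only [deriv_const', zero_mul, zero_add, add_zero]
    have := hf.euler y hy
    field_simp
    linear_combination β₁ * this

theorem isGenerator_Dp (hI : IsOpen I) (hJ : IsOpen J) (hJ' : IsConnected J)
    (hn : 1 ≤ n) (hp1 : p ≠ 1) (hf : IsHomogeneous J p f) : IsGenerator n I J f (Dp n p) :=
  (affineSymmetry_of_isHomogeneous hn hp1 hf 0 1).isGenerator hI hJ hJ' hn fun q _ => by simp [Dp]

/-- Differentiating c (p-1) = -2n b' and combining with 2c' = (2n-1)b'' gives (1 + 2n - (1-2n)p) b''
= 0. The factor vanishes only at the critical exponent, so here b is affine and determines c. -/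
theorem isSymmetryBasis_power (hI : IsOpen I) (hI' : IsConnected I) (hJ : IsOpen J)
    (hJ' : IsConnected J) (hn : 1 ≤ n) (hp0 : p ≠ 0) (hp1 : p ≠ 1) (hf : IsHomogeneous J p f)
    (hp : p ≠ critExp n) : IsSymmetryBasis n I J f ![X₁, Dp n p] := by
  have hn1 := one_le_cast hn
  refine isSymmetryBasis_of_fintype (fun r hr => ?_) fun X => ⟨fun hX => ?_, ?_⟩
  · obtain ⟨y, hy⟩ := hJ'.nonempty
    have := affine_eq_zero hI hI'.nonempty (α := r 1) (β := r 0) fun x hx => by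
      simpa [X₁, Dp, add_comm] using congrArg Prod.fst (hr (show (x, y) ∈ I ×ˢ J from ⟨hx, hy⟩))
    ext i
    fin_cases i
    · exact this.2
    · exact this.1
  · obtain ⟨b, c, d, h, e⟩ := hX.exists_affineSymmetry hI hJ hJ' hn (hf.not_affine hJ hJ' hp0 hp1)
    have hcd := h.of_isHomogeneous hI hJ hJ' hn hp0 hp1 hf
    have hb2 : ∀ x ∈ I, deriv (deriv b) x = 0 := by
      intro x hx
      have e1 := HasDerivAt.unique_of_eqOn hI (g := fun x => c x * (p - 1))
        (h := fun x => -(2 * n * deriv b x)) (fun x hx => (hcd x hx).2.1) hx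
        ((hasDerivAt_of_contDiffOn hI h.smooth_c hx).mul_const _)
        ((hasDerivAt_of_contDiffOn hI (contDiffOn_deriv hI h.smooth_b) hx).const_mul _).neg
      have e2 := h.deriv_c x hx
      have : (1 + 2 * n - (1 - 2 * n) * p) * deriv (deriv b) x = 0 := by
        linear_combination 2 * e1 - (p - 1) * e2
      refine (mul_eq_zero.1 this).resolve_left fun h0 => hp ?_
      rw [critExp, eq_div_iff (by linarith)]
      linarith
    obtain ⟨β₀, β₁, hb⟩ := eq_affine_of_deriv2 hI hI' h.smooth_b hb2
    refine ⟨![β₀, β₁], fun q hq => ?_⟩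
    have h1 := hcd q.1 hq.1
    rw [deriv_congr_of_eqOn hI hb q.1 hq.1, deriv_affine] at h1
    have hc : c q.1 = β₁ * (2 * (n : ℝ) / (1 - p)) := by
      have : 1 - p ≠ 0 := sub_ne_zero.2 hp1.symm
      field_simp
      linear_combination -h1.2.1
    rw [e hq]
    simp [X₁, Dp, hb q.1 hq.1, h1.1, hc, mul_assoc]
  · rintro ⟨r, hr⟩
    refine (affineSymmetry_of_isHomogeneous hn hp1 hf (r 0) (r 1)).isGenerator hI hJ hJ' hn
      (hr.trans fun q hq => ?_)
    simp [X₁, Dp, mul_assoc]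

theorem critExp_eq_iff (hn : 1 ≤ n) : critExp n * (1 - 2 * n) = 1 + 2 * n := by
  have hn1 := one_le_cast hn
  rw [critExp, div_mul_cancel₀]
  linarith

theorem affineSymmetry_critExp (hn : 1 ≤ n) (hf : IsHomogeneous J (critExp n) f)
    (β₀ β₁ β₂ : ℝ) : AffineSymmetry n I J f (fun x => β₀ + β₁ * x + β₂ * x ^ 2)
      (fun x => (2 * (n : ℝ) - 1) / 2 * β₁ + (2 * (n : ℝ) - 1) * β₂ * x) (fun _ => 0) where
  smooth_b := by apply ContDiff.contDiffOn; fun_prop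
  smooth_c := by apply ContDiff.contDiffOn; fun_prop
  smooth_d := contDiffOn_const
  deriv_c x hx := by
    rw [deriv_quadratic, deriv_affine, deriv_affine]
    ring
  deriv_b _ x hx := by
    rw [deriv_quadratic, deriv_affine, deriv_const]
  eqn x hx y hy := by
    rw [iteratedDeriv_const_eq_zero (show 2 * n ≠ 0 by omega), deriv_quadratic, deriv_affine]
    simp only [deriv_const', zero_mul, zero_add, add_zero]
    linear_combination ((2 * (n : ℝ) - 1) / 2 * β₁ + (2 * (n : ℝ) - 1) * β₂ * x) * hf.euler y hy
      - f y * (β₁ / 2 + β₂ * x) * critExp_eq_iff hn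

/-- At the critical exponent b'' is free, but c'' = 0 still forces b''' = 0, for n = 1 as well;
hence b is quadratic and c is determined by b'. -/
theorem isSymmetryBasis_critExp (hI : IsOpen I) (hI' : IsConnected I) (hJ : IsOpen J)
    (hJ' : IsConnected J) (hn : 1 ≤ n) (hf : IsHomogeneous J (critExp n) f) :
    IsSymmetryBasis n I J f ![X₁, X₂ n, X₃ n] := by
  have hn1 := one_le_cast hn
  have hcrit := critExp_eq_iff hn
  have hp0 : critExp n ≠ 0 := fun h => by rw [h] at hcrit; linarith
  have hp1 : critExp n ≠ 1 := fun h => by rw [h] at hcrit; linarith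
  refine isSymmetryBasis_of_fintype (fun r hr => ?_) fun X => ⟨fun hX => ?_, ?_⟩
  · obtain ⟨y, hy⟩ := hJ'.nonempty
    have e0 : ∀ x ∈ I, r 0 + r 1 * x + r 2 * x ^ 2 = 0 := fun x hx => by
      simpa [X₁, X₂, X₃, Fin.sum_univ_succ, add_assoc] using
        congrArg Prod.fst (hr (show (x, y) ∈ I ×ˢ J from ⟨hx, hy⟩))
    have e1 := deriv_eq_zero_of_eqOn hI e0
    rw [deriv_quadratic] at e1
    have e2 := affine_eq_zero hI hI'.nonempty (α := 2 * r 2) (β := r 1)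
      fun x hx => by linarith [e1 x hx]
    obtain ⟨x, hx⟩ := hI'.nonempty
    have h2 : r 2 = 0 := by linarith [e2.1]
    have h0 := e0 x hx
    rw [h2, e2.2] at h0
    ext i
    fin_cases i
    · simpa using h0
    · exact e2.2
    · exact h2
  · obtain ⟨b, c, d, h, e⟩ := hX.exists_affineSymmetry hI hJ hJ' hn (hf.not_affine hJ hJ' hp0 hp1)
    have hcd := h.of_isHomogeneous hI hJ hJ' hn hp0 hp1 hf
    have hb3 : ∀ x ∈ I, deriv (deriv (deriv b)) x = 0 := by
      intro x hx
      have := h.deriv2_c hI x hx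
      rw [(hcd x hx).2.2, mul_zero] at this
      exact (mul_eq_zero.1 this.symm).resolve_left (by linarith)
    obtain ⟨β₀, β₁, β₂, hb⟩ := eq_quadratic_of_deriv3 hI hI' h.smooth_b hb3
    refine ⟨![β₀, β₁, β₂], fun q hq => ?_⟩
    have h1 := hcd q.1 hq.1
    rw [deriv_congr_of_eqOn hI hb q.1 hq.1, deriv_quadratic] at h1
    have hc : c q.1 = (2 * (n : ℝ) - 1) / 2 * β₁ + (2 * (n : ℝ) - 1) * β₂ * q.1 := by
      have : (4 : ℝ) * n ≠ 0 := by positivity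
      apply mul_left_cancel₀ this
      linear_combination (2 * n - 1) * -h1.2.1 - c q.1 * hcrit
    rw [e hq]
    simp [X₁, X₂, X₃, Fin.sum_univ_succ, hb q.1 hq.1, h1.1, hc]
    constructor <;> ring
  · rintro ⟨r, hr⟩
    refine (affineSymmetry_critExp hn hf (r 0) (r 1) (r 2)).isGenerator hI hJ hJ' hn
      (hr.trans fun q hq => ?_)
    simp [X₁, X₂, X₃, Fin.sum_univ_succ]
    constructor <;> ring

end power

end

/-! ### Euler's equation on an interval and recognition of the special nonlinearities -/

section

variable {I J : Set ℝ} {X : VField} {n : ℕ} {f b c d : ℝ → ℝ}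

section euler

variable {p : ℝ} {h : ℝ → ℝ}

/-- Where the continuous φ is nonzero the affine factor vanishes; that set is open, so if nonempty
it would make the factor identically zero. -/
theorem eq_zero_of_affine_mul (hJ : IsOpen J) {φ : ℝ → ℝ} (hφ : ContinuousOn φ J) {α β : ℝ}
    (hαβ : ¬ (α = 0 ∧ β = 0)) (e : ∀ y ∈ J, (α * y + β) * φ y = 0) : ∀ y ∈ J, φ y = 0 := by
  intro y hy
  by_contra h0
  have hS : IsOpen (J ∩ φ ⁻¹' {0}ᶜ) := hφ.isOpen_inter_preimage hJ isOpen_compl_singleton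
  exact hαβ (affine_eq_zero hS ⟨y, hy, h0⟩ fun z hz => (mul_eq_zero.1 (e z hz.1)).resolve_right hz.2)

/-- At the origin the equation gives h(0) = 0. For p < 0, y (h²)' = 2p h² ≤ 0, so h² cannot increase
in moving away from the origin, and it starts at 0. -/
theorem eq_zero_of_euler_neg (hJ : IsOpen J) (hJ' : IsConnected J) (h0 : (0 : ℝ) ∈ J)
    (hh : ContDiffOn ℝ ∞ h J) (e : ∀ y ∈ J, y * deriv h y = p * h y) (hp : p < 0) :
    ∀ y ∈ J, h y = 0 := by
  have hoc := hJ'.isPreconnected.ordConnected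
  have hz : h 0 = 0 := by
    have := e 0 h0
    rw [zero_mul] at this
    exact (mul_eq_zero.1 this.symm).resolve_left hp.ne
  have hd : ∀ y ∈ J, HasDerivAt (fun y => h y ^ 2) (2 * (h y * deriv h y)) y := fun y hy => by
    refine ((hasDerivAt_of_contDiffOn hJ hh hy).fun_pow 2).congr_deriv ?_
    push_cast
    ring
  have hsq : ∀ t ∈ J, ∀ y : ℝ, 0 < t * y → h t * deriv h t * y ≤ 0 := by
    intro t ht y hty
    have ht0 : t ≠ 0 := by
      rintro rfl
      simp at hty
    have : h t * deriv h t * y = p * h t ^ 2 * (t * y) / t ^ 2 := by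
      field_simp
      linear_combination h t * y * e t ht
    rw [this]
    apply div_nonpos_of_nonpos_of_nonneg _ (sq_nonneg t)
    nlinarith [mul_nonneg (sq_nonneg (h t)) hty.le]
  intro y hy
  have hle : h y ^ 2 ≤ 0 := by
    rcases lt_trichotomy y 0 with hlt | rfl | hlt
    · have hsub := hoc.out hy h0
      obtain ⟨t, ht, hs⟩ := exists_hasDerivAt_eq_slope (fun y => h y ^ 2) _ hlt
        (fun z hz => (hd z (hsub hz)).continuousAt.continuousWithinAt)
        (fun z hz => hd z (hsub (Set.Ioo_subset_Icc_self hz)))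
      have := hsq t (hsub (Set.Ioo_subset_Icc_self ht)) y (mul_pos_of_neg_of_neg ht.2 hlt)
      rw [hz, eq_div_iff (by linarith)] at hs
      linarith
    · simp [hz]
    · have hsub := hoc.out h0 hy
      obtain ⟨t, ht, hs⟩ := exists_hasDerivAt_eq_slope (fun y => h y ^ 2) _ hlt
        (fun z hz => (hd z (hsub hz)).continuousAt.continuousWithinAt)
        (fun z hz => hd z (hsub (Set.Ioo_subset_Icc_self hz)))
      have := hsq t (hsub (Set.Ioo_subset_Icc_self ht)) y (mul_pos ht.1 hlt)
      rw [hz, eq_div_iff (by linarith)] at hs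
      linarith
  exact pow_eq_zero_iff (two_ne_zero) |>.1 (le_antisymm hle (sq_nonneg _))

/-- If h has Euler exponent p, then h' has exponent p - 1. Descending until the exponent is
negative, where the solution is zero, shows that smoothness through the origin admits only natural
exponents; `k` bounds the number of steps. -/
theorem eq_pow_of_euler (hJ : IsOpen J) (hJ' : IsConnected J) (h0 : (0 : ℝ) ∈ J) (k : ℕ) :
    ∀ (p : ℝ) (h : ℝ → ℝ), p < k → ContDiffOn ℝ ∞ h J → (∀ y ∈ J, y * deriv h y = p * h y) →
      (∀ y ∈ J, h y = 0) ∨ ∃ m : ℕ, p = m ∧ ∃ K : ℝ, ∀ y ∈ J, h y = K * y ^ m := by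
  induction k with
  | zero =>
    intro p h hp hh e
    exact Or.inl (eq_zero_of_euler_neg hJ hJ' h0 hh e (by simpa using hp))
  | succ k ih =>
    intro p h hp hh e
    have hh' := contDiffOn_deriv hJ hh
    by_cases hp0 : p = 0
    · have := eq_zero_of_affine_mul hJ hh'.continuousOn (α := 1) (β := 0) (by simp)
        fun y hy => by simpa [hp0] using e y hy
      obtain ⟨K, hK⟩ := eq_const_of_deriv hJ hJ' hh this
      exact Or.inr ⟨0, by simpa using hp0, K, by simpa using hK⟩
    · have e' : ∀ y ∈ J, y * deriv (deriv h) y = (p - 1) * deriv h y := by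
        intro y hy
        have := HasDerivAt.unique_of_eqOn hJ e hy
          ((hasDerivAt_id y).fun_mul (hasDerivAt_of_contDiffOn hJ hh' hy))
          ((hasDerivAt_of_contDiffOn hJ hh hy).const_mul p)
        simp only [id] at this
        linear_combination this
      rcases ih (p - 1) (deriv h) (by push_cast at hp; linarith) hh' e' with hz | ⟨m, hm, K, hK⟩
      · refine Or.inl fun y hy => ?_
        have := e y hy
        rw [hz y hy, mul_zero] at this
        exact (mul_eq_zero.1 this.symm).resolve_left hp0
      · refine Or.inr ⟨m + 1, by push_cast; linarith, K / p, fun y hy => ?_⟩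
        have := e y hy
        rw [hK y hy] at this
        field_simp
        linear_combination -this

/-- Away from the origin the interval lies on one side, and h · |y|^{-p} is constant there. Across
the origin `eq_pow_of_euler` applies; when p is not natural only K = 0 remains, and then no branch
is claimed. -/
theorem exists_isPowerBranch_of_euler (hJ : IsOpen J) (hJ' : IsConnected J)
    (hh : ContDiffOn ℝ ∞ h J) (e : ∀ y ∈ J, y * deriv h y = p * h y) :
    ∃ (K : ℝ) (g : ℝ → ℝ), (K = 0 ∨ IsPowerBranch J p g) ∧ ∀ y ∈ J, h y = K * g y := by
  by_cases h0 : (0 : ℝ) ∈ J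
  · obtain ⟨k, hk⟩ := exists_nat_gt p
    rcases eq_pow_of_euler hJ hJ' h0 k p h hk hh e with hz | ⟨m, rfl, K, hK⟩
    · exact ⟨0, fun _ => 0, Or.inl rfl, by simpa using hz⟩
    · exact ⟨K, fun y => y ^ m, Or.inr (Or.inr (Or.inr ⟨m, rfl, fun _ _ => rfl⟩)), hK⟩
  · have hoc := hJ'.isPreconnected.ordConnected
    obtain ⟨y₀, hy₀⟩ := hJ'.nonempty
    rcases lt_or_gt_of_ne (show y₀ ≠ 0 from fun h => h0 (h ▸ hy₀)) with hlt | hgt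
    · have hneg : ∀ y ∈ J, y < 0 := fun y hy => by
        by_contra hy0
        exact h0 (hoc.out hy₀ hy ⟨hlt.le, not_lt.1 hy0⟩)
      refine ⟨h y₀ * (-y₀) ^ (-p), fun y => 1 * (-y) ^ p, Or.inr (Or.inr (Or.inl
        ⟨1, Or.inl rfl, fun y hy => ⟨hneg y hy, rfl⟩⟩)), fun y hy => ?_⟩
      have := eq_of_hasDerivAt_zero hJ hJ'.isPreconnected (g := fun y => h y * (-y) ^ (-p))
        (fun t ht => by
          have ht0 : -t ≠ 0 := (neg_pos.2 (hneg t ht)).ne'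
          refine ((hasDerivAt_of_contDiffOn hJ hh ht).fun_mul
            ((hasDerivAt_neg t).rpow_const (p := -p) (Or.inl ht0))).congr_deriv ?_
          rw [Real.rpow_sub_one ht0]
          have := neg_ne_zero.1 ht0
          field_simp
          linear_combination (-t) ^ (-p) * e t ht) hy₀ hy
      simp only [this, one_mul]
      rw [mul_assoc, ← Real.rpow_add (neg_pos.2 (hneg y hy))]
      simp
    · have hpos : ∀ y ∈ J, 0 < y := fun y hy => by
        by_contra hy0
        exact h0 (hoc.out hy hy₀ ⟨not_lt.1 hy0, hgt.le⟩)
      refine ⟨h y₀ * y₀ ^ (-p), fun y => y ^ p, Or.inr (Or.inl fun y hy => ⟨hpos y hy, rfl⟩),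
        fun y hy => ?_⟩
      have := eq_of_hasDerivAt_zero hJ hJ'.isPreconnected (g := fun y => h y * y ^ (-p))
        (fun t ht => by
          have ht0 : t ≠ 0 := (hpos t ht).ne'
          refine ((hasDerivAt_of_contDiffOn hJ hh ht).fun_mul
            (Real.hasDerivAt_rpow_const (p := -p) (Or.inl ht0))).congr_deriv ?_
          rw [Real.rpow_sub_one ht0]
          field_simp
          linear_combination t ^ (-p) * e t ht) hy₀ hy
      rw [this, mul_assoc, ← Real.rpow_add (hpos y hy)]
      simp

end euler

section image

variable {b₁ b₂ : ℝ}

theorem isOpen_image_affine (hJ : IsOpen J) (hb : b₁ ≠ 0) : IsOpen ((fun y => b₁ * y + b₂) '' J) :=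
  (affineHomeomorph b₁ b₂ hb).isOpenMap J hJ

theorem isConnected_image_affine (hJ' : IsConnected J) :
    IsConnected ((fun y => b₁ * y + b₂) '' J) :=
  hJ'.image _ (by fun_prop)

/-- To reach the listed forms, translations of y are enough, since the forms contain arbitrary
multiplicative constants. -/
theorem UpToEquiv.of_shift {P : Set ℝ → (ℝ → ℝ) → Prop} (y₀ : ℝ)
    (h : P ((fun y => 1 * y + -y₀) '' J) (fun z => f (z + y₀))) : UpToEquiv n P J f :=
  ⟨1, 1, -y₀, fun z => f (z + y₀), one_ne_zero, one_ne_zero, fun y _ => by simp, h⟩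

/-- Solutions of the Euler equation centred at `y₀`. -/
theorem exists_isPowerBranch_of_shifted_euler (hJ : IsOpen J) (hJ' : IsConnected J) {p y₀ : ℝ}
    {h : ℝ → ℝ} (hh : ContDiffOn ℝ ∞ h J) (e : ∀ y ∈ J, (y - y₀) * deriv h y = p * h y) :
    ∃ (K : ℝ) (g : ℝ → ℝ), (K = 0 ∨ IsPowerBranch ((fun y => 1 * y + -y₀) '' J) p g) ∧
      ∀ y ∈ J, h y = K * g (y - y₀) := by
  obtain ⟨K, g, hg, e'⟩ := exists_isPowerBranch_of_euler (p := p) (h := fun z => h (z + y₀))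
    (isOpen_image_affine hJ one_ne_zero) (isConnected_image_affine (b₁ := 1) (b₂ := -y₀) hJ')
    (hh.comp (t := J) (by apply ContDiff.contDiffOn; fun_prop) (by
      rintro _ ⟨y, hy, rfl⟩
      simpa using hy)) (by
      rintro _ ⟨y, hy, rfl⟩
      rw [deriv_comp_add_const]
      have := e y hy
      simpa [← sub_eq_add_neg] using this)
  refine ⟨K, g, hg, fun y hy => ?_⟩
  have := e' (y - y₀) ⟨y, hy, by ring⟩
  simpa using this

end image

theorem upToEquiv_of_power {y₀ p K : ℝ} {g : ℝ → ℝ} (hK : K ≠ 0) (hp0 : p ≠ 0) (hp1 : p ≠ 1)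
    (hg : IsPowerBranch ((fun y => 1 * y + -y₀) '' J) p g) (e : ∀ y ∈ J, f y = K * g (y - y₀)) :
    UpToEquiv n IsListed J f := by
  refine .of_shift y₀ (Or.inr (Or.inl ⟨K, p, g, hK, hp0, hp1, hg, ?_⟩))
  rintro _ ⟨y, hy, rfl⟩
  have := e y hy
  simpa [← sub_eq_add_neg] using this

theorem upToEquiv_of_exp {a K : ℝ} (hK : K ≠ 0) (ha : a ≠ 0)
    (e : ∀ y ∈ J, f y = K * Real.exp (a * y)) : UpToEquiv n IsListed J f := by
  refine .of_shift 0 (Or.inl ⟨K, a, hK, ha, ?_⟩)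
  rintro _ ⟨y, hy, rfl⟩
  simpa using e y hy

theorem upToEquiv_of_affine {α β : ℝ} (e : ∀ y ∈ J, f y = α * y + β) :
    UpToEquiv n IsListed J f := by
  by_cases hα : α = 0
  · refine .of_shift 0 (Or.inr (Or.inr (Or.inl ⟨β, ?_⟩)))
    rintro _ ⟨y, hy, rfl⟩
    simpa [hα] using e y hy
  · refine .of_shift (-β / α) (Or.inr (Or.inr (Or.inr ⟨α, hα, ?_⟩)))
    rintro _ ⟨y, hy, rfl⟩
    simp only [one_mul, neg_add_cancel_right, e y hy]
    field_simp

/-- On the negative side (-z)^{-3} = -z^{-3}, so the sign is absorbed into the constant; the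
natural-power branch is impossible for the exponent -3. -/
theorem upToEquiv_of_ermakovPinney {y₀ r K : ℝ} {g : ℝ → ℝ} (hK : K ≠ 0) (hr : r ≠ 0)
    (hg : IsPowerBranch ((fun y => 1 * y + -y₀) '' J) (-3) g)
    (e : ∀ y ∈ J, f y = r * (y - y₀) + K * g (y - y₀)) : UpToEquiv n IsErmakovPinney J f := by
  rcases hg with hg | ⟨ε, hε, hg⟩ | ⟨m, hm, -⟩
  · refine .of_shift y₀ ⟨r, K, hr, hK, ?_⟩
    rintro _ ⟨y, hy, rfl⟩
    obtain ⟨h1, h2⟩ := hg _ ⟨y, hy, rfl⟩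
    simp only [one_mul, ← sub_eq_add_neg] at h1 h2 ⊢
    refine ⟨h1.ne', ?_⟩
    rw [sub_add_cancel, e y hy, h2, Real.rpow_neg h1.le]
    norm_cast
  · have hε0 : ε ≠ 0 := by rcases hε with rfl | rfl <;> norm_num
    refine .of_shift y₀ ⟨r, -(K * ε), hr, neg_ne_zero.2 (mul_ne_zero hK hε0), ?_⟩
    rintro _ ⟨y, hy, rfl⟩
    obtain ⟨h1, h2⟩ := hg _ ⟨y, hy, rfl⟩
    simp only [one_mul, ← sub_eq_add_neg] at h1 h2 ⊢
    refine ⟨h1.ne, ?_⟩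
    have h3 : (-(y - y₀)) ^ (-3 : ℝ) = -((y - y₀) ^ 3)⁻¹ := by
      rw [Real.rpow_neg (neg_nonneg.2 h1.le), ← inv_neg]
      congr 1
      rw [show (3 : ℝ) = ((3 : ℕ) : ℝ) by norm_num, Real.rpow_natCast]
      ring
    rw [sub_add_cancel, e y hy, h2, h3]
    ring
  · have : (0 : ℝ) ≤ m := m.cast_nonneg
    linarith

end

/-! ### An additional generator forces a special nonlinearity -/

section

variable {I J : Set ℝ} {X : VField} {n : ℕ} {f b c d : ℝ → ℝ}

theorem affine_of_deriv_const (hJ : IsOpen J) (hJ' : IsConnected J) (hf : ContDiffOn ℝ ∞ f J)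
    {α : ℝ} (h : ∀ y ∈ J, deriv f y = α) : ∃ α β : ℝ, ∀ y ∈ J, f y = α * y + β := by
  obtain ⟨β, hβ⟩ := eq_add_of_deriv_eq hJ hJ' hf (h := fun y => 0 + α * y)
    (by apply ContDiff.contDiffOn; fun_prop) (fun y hy => by rw [h y hy, deriv_affine])
  exact ⟨α, β, fun y hy => by rw [hβ y hy]; ring⟩

theorem eq_exp_of_deriv_eq (hJ : IsOpen J) (hJ' : IsConnected J) (hf : ContDiffOn ℝ ∞ f J)
    {a q : ℝ} (ha : a ≠ 0) (h : ∀ y ∈ J, deriv f y = a * f y - q) :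
    ∃ K : ℝ, ∀ y ∈ J, f y = q / a + K * Real.exp (a * y) := by
  obtain ⟨y₀, hy₀⟩ := hJ'.nonempty
  refine ⟨(f y₀ - q / a) * Real.exp (-a * y₀), fun y hy => ?_⟩
  have := eq_of_hasDerivAt_zero hJ hJ'.isPreconnected
    (g := fun y => (f y - q / a) * (1 * Real.exp (-a * y))) (fun t ht => by
      refine (((hasDerivAt_of_contDiffOn hJ hf ht).sub_const (q / a)).fun_mul
        (deriv_exp_mul 1 (-a) t)).congr_deriv ?_
      rw [h t ht]
      field_simp
      ring) hy₀ hy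
  simp only [one_mul] at this
  rw [this, mul_assoc, ← Real.exp_add]
  simp

theorem eq_zero_of_mul_eq_affine (hf : ¬ ∃ α β : ℝ, ∀ y ∈ J, f y = α * y + β) {γ α β : ℝ}
    (h : ∀ y ∈ J, γ * f y = α * y + β) : γ = 0 := by
  by_contra hγ
  refine hf ⟨α / γ, β / γ, fun y hy => ?_⟩
  have := h y hy
  field_simp
  linear_combination this

/-- With c = 0 the relation 2c' = (2n-1)b'' makes b' a constant s, and the equation is d f' = -2ns f
- d^{(2n)}. If d = 0, non-affinity of f gives s = 0 and the field is trivial. Otherwise f' = a f -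
q, and comparing different x shows that d is constant, so q = 0 and f is an exponential. -/
theorem AffineSymmetry.trivial_or_exp (hI : IsOpen I) (hI' : IsConnected I) (hJ : IsOpen J)
    (hJ' : IsConnected J) (hn : 1 ≤ n) (hfs : ContDiffOn ℝ ∞ f J)
    (hf : ¬ ∃ α β : ℝ, ∀ y ∈ J, f y = α * y + β) (h : AffineSymmetry n I J f b c d)
    (hc : ∀ x ∈ I, c x = 0) :
    (∃ k, ∀ x ∈ I, b x = k ∧ c x = 0 ∧ d x = 0) ∨ UpToEquiv n IsListed J f := by
  have hn1 := one_le_cast hn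
  have hc1 := deriv_eq_zero_of_eqOn hI hc
  have hc2 := deriv_eq_zero_of_eqOn hI hc1
  have hb2 : ∀ x ∈ I, deriv (deriv b) x = 0 := fun x hx => by
    have := h.deriv_c x hx
    rw [hc1 x hx, mul_zero] at this
    exact (mul_eq_zero.1 this.symm).resolve_left (by linarith)
  obtain ⟨s, hs⟩ := eq_const_of_deriv hI hI' (contDiffOn_deriv hI h.smooth_b) hb2
  have R : ∀ x ∈ I, ∀ y ∈ J,
      d x * deriv f y = -(2 * n * s) * f y - iteratedDeriv (2 * n) d x := by
    intro x hx y hy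
    have := h.eqn x hx y hy
    rw [hc2 x hx, hc x hx, hs x hx] at this
    linear_combination this
  by_cases hd : ∀ x ∈ I, d x = 0
  · left
    have hs0 : s = 0 := by
      obtain ⟨x, hx⟩ := hI'.nonempty
      have := eq_zero_of_mul_eq_affine hf (γ := 2 * n * s) (α := 0)
        (β := -iteratedDeriv (2 * n) d x) fun y hy => by
          have := R x hx y hy
          rw [hd x hx] at this
          linear_combination this
      exact (mul_eq_zero.1 this).resolve_left (by positivity)
    obtain ⟨k, hk⟩ := eq_const_of_deriv hI hI' h.smooth_b (by simpa [hs0] using hs)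
    exact ⟨k, fun x hx => ⟨hk x hx, hc x hx, hd x hx⟩⟩
  · right
    push Not at hd
    obtain ⟨x₀, hx₀, hd0⟩ := hd
    set a := -(2 * n * s) / d x₀ with ha
    set q := iteratedDeriv (2 * n) d x₀ / d x₀ with hq
    have had : a * d x₀ = -(2 * n * s) := by
      rw [ha]
      field_simp
    have hf' : ∀ y ∈ J, deriv f y = a * f y - q := by
      intro y hy
      have := R x₀ hx₀ y hy
      rw [ha, hq]
      field_simp
      linear_combination this
    have ha0 : a ≠ 0 := fun ha0 => hf (affine_of_deriv_const hJ hJ' hfs (α := -q) fun y hy => by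
      rw [hf' y hy, ha0]; ring)
    -- Eliminating f' between the equations at x and at `x₀` leaves a multiple of f equal to a
    -- constant, so the multiplier a d(x) + 2ns is zero.
    have hda : ∀ x ∈ I, d x = d x₀ := by
      intro x hx
      have := eq_zero_of_mul_eq_affine hf (γ := a * d x + 2 * n * s) (α := 0)
        (β := d x * q - iteratedDeriv (2 * n) d x) fun y hy => by
          linear_combination R x hx y hy - d x * hf' y hy
      apply mul_left_cancel₀ ha0
      linear_combination this - had
    have hq0 : q = 0 := by
      have e1 := deriv_congr_of_eqOn hI (h := fun _ => d x₀) hda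
      have : ∀ k, ∀ x ∈ I, iteratedDeriv (k + 1) d x = 0 := by
        intro k
        induction k with
        | zero =>
          intro x hx
          rw [Nat.zero_add, iteratedDeriv_one, e1 x hx, deriv_const]
        | succ k ih =>
          intro x hx
          rw [iteratedDeriv_succ]
          exact deriv_eq_zero_of_eqOn hI ih x hx
      have h0 := this (2 * n - 1) x₀ hx₀
      rw [show 2 * n - 1 + 1 = 2 * n by omega] at h0
      rw [hq, h0, zero_div]
    obtain ⟨K, hK⟩ := eq_exp_of_deriv_eq hJ hJ' hfs ha0 hf'
    rw [hq0, zero_div] at hK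
    have hK0 : K ≠ 0 := fun h0 => hf ⟨0, 0, fun y hy => by rw [hK y hy, h0]; ring⟩
    exact upToEquiv_of_exp hK0 ha0 fun y hy => by rw [hK y hy, zero_add]

/-- The exponents 0 and 1 would make f affine, and K = 0 would make it zero, so the power solution
is one of the listed ones. -/
theorem upToEquiv_of_shifted_euler (hJ : IsOpen J) (hJ' : IsConnected J) (hfs : ContDiffOn ℝ ∞ f J)
    (hf : ¬ ∃ α β : ℝ, ∀ y ∈ J, f y = α * y + β) {p y₀ : ℝ}
    (e : ∀ y ∈ J, (y - y₀) * deriv f y = p * f y) : UpToEquiv n IsListed J f := by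
  have hf' := contDiffOn_deriv hJ hfs
  have hp0 : p ≠ 0 := by
    rintro rfl
    exact hf (affine_of_deriv_const hJ hJ' hfs (eq_zero_of_affine_mul hJ hf'.continuousOn
      (α := 1) (β := -y₀) (by simp) fun y hy => by linear_combination e y hy))
  have hp1 : p ≠ 1 := by
    rintro rfl
    have e2 : ∀ y ∈ J, (y - y₀) * deriv (deriv f) y = 0 := by
      intro y hy
      have := HasDerivAt.unique_of_eqOn hJ e hy
        (((hasDerivAt_id y).sub_const y₀).fun_mul (hasDerivAt_of_contDiffOn hJ hf' hy))
        ((hasDerivAt_of_contDiffOn hJ hfs hy).const_mul 1)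
      simp only [id] at this
      linear_combination this
    obtain ⟨k, hk⟩ := eq_const_of_deriv hJ hJ' hf' (eq_zero_of_affine_mul hJ
      (contDiffOn_deriv hJ hf').continuousOn (α := 1) (β := -y₀) (by simp)
      fun y hy => by linear_combination e2 y hy)
    exact hf (affine_of_deriv_const hJ hJ' hfs hk)
  obtain ⟨K, g, hg, hK⟩ := exists_isPowerBranch_of_shifted_euler hJ hJ' hfs e
  have hK0 : K ≠ 0 := fun h0 => hf ⟨0, 0, fun y hy => by rw [hK y hy, h0]; ring⟩
  exact upToEquiv_of_power hK0 hp0 hp1 (hg.resolve_left hK0) hK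

theorem iteratedDeriv_eq_zero_of_affine (hI : IsOpen I) {N : ℕ} (hN : 2 ≤ N)
    (hc : ∀ x ∈ I, deriv (deriv d) x = 0) : ∀ x ∈ I, iteratedDeriv N d x = 0 := by
  induction N, hN using Nat.le_induction with
  | base => simpa [iteratedDeriv_two_eq] using hc
  | succ k _ ih =>
    intro x hx
    rw [iteratedDeriv_succ]
    exact deriv_eq_zero_of_eqOn hI ih x hx

/-- Dividing by c(x₀) gives (y - y₀) f' = p f - q with y₀ = -d(x₀)/c(x₀). The centre must be the
same at every x: otherwise subtraction yields a second equation f' = α f + β, and the two together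
make f affine. Then d = -y₀ c, so d'' = 0, and q, a multiple of d^{(2n)}(x₀), vanishes. -/
theorem AffineSymmetry.upToEquiv_of_ne_zero (hI : IsOpen I) (hJ : IsOpen J)
    (hJ' : IsConnected J) (hn : 1 ≤ n) (hfs : ContDiffOn ℝ ∞ f J)
    (hf : ¬ ∃ α β : ℝ, ∀ y ∈ J, f y = α * y + β) (h : AffineSymmetry n I J f b c d)
    (hc2 : ∀ x ∈ I, deriv (deriv c) x = 0) {x₀ : ℝ} (hx₀ : x₀ ∈ I) (hc0 : c x₀ ≠ 0) :
    UpToEquiv n IsListed J f := by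
  have hf' := contDiffOn_deriv hJ hfs
  set y₀ := -d x₀ / c x₀ with hy₀
  set p := (c x₀ - 2 * n * deriv b x₀) / c x₀ with hp
  set q := iteratedDeriv (2 * n) d x₀ / c x₀ with hq
  have R0 : ∀ y ∈ J, (y - y₀) * deriv f y = p * f y - q := by
    intro y hy
    have := h.eqn x₀ hx₀ y hy
    rw [hc2 x₀ hx₀] at this
    rw [hy₀, hp, hq]
    field_simp
    linear_combination this
  have he : ∀ x ∈ I, d x + c x * y₀ = 0 := by
    intro x hx
    by_contra he
    set ε := d x + c x * y₀ with hε
    set α := (c x - 2 * n * deriv b x - c x * p) / ε with hα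
    set β := (c x * q - iteratedDeriv (2 * n) d x) / ε with hβ
    have R1 : ∀ y ∈ J, deriv f y = α * f y + β := by
      intro y hy
      have h1 := h.eqn x hx y hy
      rw [hc2 x hx] at h1
      rw [hα, hβ]
      field_simp
      linear_combination h1 - c x * R0 y hy + deriv f y * hε
    -- The y-derivatives of the two equations are f'' = α f' and (y - y₀) f'' = (p - 1) f';
    -- eliminating f'' gives the product.
    have R2 : ∀ y ∈ J, (α * y + (1 - p - α * y₀)) * deriv f y = 0 := by
      intro y hy
      have hd1 := hasDerivAt_of_contDiffOn hJ hf' hy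
      have hd0 := hasDerivAt_of_contDiffOn hJ hfs hy
      have k1 := HasDerivAt.unique_of_eqOn hJ R1 hy hd1 ((hd0.const_mul α).add_const β)
      have k2 := HasDerivAt.unique_of_eqOn hJ R0 hy
        (((hasDerivAt_id y).sub_const y₀).fun_mul hd1) ((hd0.const_mul p).sub_const q)
      simp only [id] at k2
      linear_combination k2 - (y - y₀) * k1
    by_cases hαp : α = 0 ∧ 1 - p - α * y₀ = 0
    · exact hf (affine_of_deriv_const hJ hJ' hfs (α := β) fun y hy => by
        rw [R1 y hy, hαp.1]; ring)
    · exact hf (affine_of_deriv_const hJ hJ' hfs (eq_zero_of_affine_mul hJ hf'.continuousOn hαp R2))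
  have hd2 : ∀ x ∈ I, deriv (deriv d) x = 0 := by
    have e1 : ∀ x ∈ I, deriv d x = -y₀ * deriv c x := by
      intro x hx
      exact HasDerivAt.unique_of_eqOn hI (g := d) (h := fun x => -y₀ * c x)
        (fun x hx => by linear_combination he x hx) hx
        (hasDerivAt_of_contDiffOn hI h.smooth_d hx)
        ((hasDerivAt_of_contDiffOn hI h.smooth_c hx).const_mul _)
    intro x hx
    have := HasDerivAt.unique_of_eqOn hI e1 hx
      (hasDerivAt_of_contDiffOn hI (contDiffOn_deriv hI h.smooth_d) hx)
      ((hasDerivAt_of_contDiffOn hI (contDiffOn_deriv hI h.smooth_c) hx).const_mul _)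
    rw [this, hc2 x hx, mul_zero]
  have hq0 : q = 0 := by
    rw [hq, iteratedDeriv_eq_zero_of_affine hI (by omega) hd2 x₀ hx₀, zero_div]
  exact upToEquiv_of_shifted_euler hJ hJ' hfs hf fun y hy => by rw [R0 y hy, hq0, sub_zero]

/-- For second order equations and `ξ'' ≠ 0`. -/
theorem AffineSymmetry.upToEquiv_of_deriv_ne_zero (hI : IsOpen I) (hJ : IsOpen J)
    (hJ' : IsConnected J) (hfs : ContDiffOn ℝ ∞ f J)
    (hf : ¬ ∃ α β : ℝ, ∀ y ∈ J, f y = α * y + β) (h : AffineSymmetry 1 I J f b c d)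
    {x₁ : ℝ} (hx₁ : x₁ ∈ I) (hc1 : deriv c x₁ ≠ 0) :
    UpToEquiv 1 IsListed J f ∨ UpToEquiv 1 IsErmakovPinney J f := by
  have hf' := contDiffOn_deriv hJ hfs
  have dc1 := contDiffOn_deriv hI h.smooth_c
  have dc2 := contDiffOn_deriv hI dc1
  have dd1 := contDiffOn_deriv hI h.smooth_d
  have dd2 := contDiffOn_deriv hI dd1
  have db1 := contDiffOn_deriv hI h.smooth_b
  -- The x-derivative of the determining equation. The factor is -3 because c' - 2b'' = c' - 4c', by
  -- b'' = 2c' for n = 1.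
  have R : ∀ x ∈ I, ∀ y ∈ J, deriv (deriv (deriv c)) x * y + deriv (deriv (deriv d)) x
      + (deriv c x * y + deriv d x) * deriv f y = -3 * deriv c x * f y := by
    intro x hx y hy
    have e : ∀ x ∈ I, deriv (deriv c) x * y + deriv (deriv d) x + (c x * y + d x) * deriv f y =
        (c x - 2 * deriv b x) * f y := by
      intro x hx
      have := h.eqn x hx y hy
      rw [mul_one, iteratedDeriv_two_eq] at this
      push_cast at this
      linear_combination this
    have k := HasDerivAt.unique_of_eqOn hI e hx
      ((((hasDerivAt_of_contDiffOn hI dc2 hx).mul_const y).add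
        (hasDerivAt_of_contDiffOn hI dd2 hx)).add
      ((((hasDerivAt_of_contDiffOn hI h.smooth_c hx).mul_const y).add
        (hasDerivAt_of_contDiffOn hI h.smooth_d hx)).mul_const (deriv f y)))
      (((hasDerivAt_of_contDiffOn hI h.smooth_c hx).sub
        ((hasDerivAt_of_contDiffOn hI db1 hx).const_mul 2)).mul_const (f y))
    have hc := h.deriv_c x hx
    push_cast at hc
    linear_combination k + 2 * f y * hc
  set y₀ := -deriv d x₁ / deriv c x₁ with hy₀
  set q := deriv (deriv (deriv d)) x₁ / deriv c x₁ with hq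
  set r := deriv (deriv (deriv c)) x₁ / deriv c x₁ with hr
  have R0 : ∀ y ∈ J, (y - y₀) * deriv f y = -3 * f y - q - r * y := by
    intro y hy
    have := R x₁ hx₁ y hy
    rw [hy₀, hr, hq]
    field_simp
    linear_combination this
  have he : ∀ x ∈ I, deriv d x + deriv c x * y₀ = 0 := by
    intro x hx
    by_contra he
    set ε := deriv d x + deriv c x * y₀ with hε
    set γ := (deriv c x * r - deriv (deriv (deriv c)) x) / ε with hγ
    set β := (deriv c x * q - deriv (deriv (deriv d)) x) / ε with hβ
    have R1 : ∀ y ∈ J, deriv f y = γ * y + β := by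
      intro y hy
      rw [hγ, hβ]
      field_simp
      linear_combination R x hx y hy - deriv c x * R0 y hy + deriv f y * hε
    -- With f' = γ y + β the y-derivative of `R0`, namely (y - y₀) f'' = -4f' - r, becomes an affine
    -- identity in y; its leading coefficient 5γ must vanish, so f would be affine.
    have R2 : ∀ y ∈ J, (5 * γ) * y + (4 * β + r - γ * y₀) = 0 := by
      intro y hy
      have hd1 := hasDerivAt_of_contDiffOn hJ hf' hy
      have hd0 := hasDerivAt_of_contDiffOn hJ hfs hy
      have k1 := HasDerivAt.unique_of_eqOn hJ R1 hy hd1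
        (((hasDerivAt_id y).const_mul γ).add_const β)
      have k2 := HasDerivAt.unique_of_eqOn hJ R0 hy
        (((hasDerivAt_id y).sub_const y₀).fun_mul hd1)
        (((hd0.const_mul (-3)).sub_const q).sub ((hasDerivAt_id y).const_mul r))
      simp only [id] at k2
      linear_combination k2 - (y - y₀) * k1 - 4 * R1 y hy
    have hγ0 : γ = 0 := by linarith [(affine_eq_zero hJ hJ'.nonempty R2).1]
    exact hf (affine_of_deriv_const hJ hJ' hfs (α := β) fun y hy => by
      rw [R1 y hy, hγ0]; ring)
  have e2 : ∀ x ∈ I, deriv (deriv d) x = -y₀ * deriv (deriv c) x := fun x hx =>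
    HasDerivAt.unique_of_eqOn hI (g := deriv d) (h := fun x => -y₀ * deriv c x)
      (fun x hx => by linear_combination he x hx) hx
      (hasDerivAt_of_contDiffOn hI dd1 hx) ((hasDerivAt_of_contDiffOn hI dc1 hx).const_mul _)
  have e3 : deriv (deriv (deriv d)) x₁ = -y₀ * deriv (deriv (deriv c)) x₁ :=
    HasDerivAt.unique_of_eqOn hI e2 hx₁ (hasDerivAt_of_contDiffOn hI dd2 hx₁)
      ((hasDerivAt_of_contDiffOn hI dc2 hx₁).const_mul _)
  -- Consequently (y - y₀) f' = -3f - r (y - y₀), which has the particular solution -(r/4)(y - y₀).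
  -- Adding (r/4)(y - y₀) to f gives an Euler equation with exponent -3.
  have hqr : q = -(r * y₀) := by
    rw [hq, e3, hr]
    ring
  have hpoly (y : ℝ) : HasDerivAt (fun y => r / 4 * (y - y₀)) (r / 4) y := by
    simpa using ((hasDerivAt_id y).sub_const y₀).const_mul (r / 4)
  have hh : ContDiffOn ℝ ∞ (fun y => f y + r / 4 * (y - y₀)) J :=
    hfs.add (by apply ContDiff.contDiffOn; fun_prop)
  obtain ⟨K, g, hg, hK⟩ := exists_isPowerBranch_of_shifted_euler (p := -3) (y₀ := y₀) hJ hJ' hh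
    fun y hy => by
      rw [((hasDerivAt_of_contDiffOn hJ hfs hy).fun_add (hpoly y)).deriv]
      linear_combination R0 y hy - hqr
  have hK0 : K ≠ 0 := fun h0 => hf ⟨-(r / 4), r / 4 * y₀, fun y hy => by
    have := hK y hy
    rw [h0] at this
    linear_combination this⟩
  by_cases hr0 : r = 0
  · refine Or.inl (upToEquiv_of_power hK0 (by norm_num) (by norm_num) (hg.resolve_left hK0)
      fun y hy => ?_)
    have := hK y hy
    rw [hr0] at this
    linear_combination this
  · refine Or.inr (upToEquiv_of_ermakovPinney (r := -(r / 4)) hK0 (by simpa using hr0)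
      (hg.resolve_left hK0) fun y hy => ?_)
    linear_combination hK y hy

theorem AffineSymmetry.trivial_or_listed (hI : IsOpen I) (hI' : IsConnected I) (hJ : IsOpen J)
    (hJ' : IsConnected J) (hn : 1 ≤ n) (hfs : ContDiffOn ℝ ∞ f J)
    (hf : ¬ ∃ α β : ℝ, ∀ y ∈ J, f y = α * y + β) (h : AffineSymmetry n I J f b c d) :
    (∃ k, ∀ x ∈ I, b x = k ∧ c x = 0 ∧ d x = 0) ∨ UpToEquiv n IsListed J f ∨
      (n = 1 ∧ UpToEquiv n IsErmakovPinney J f) := by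
  by_cases hc : ∀ x ∈ I, c x = 0
  · exact (h.trivial_or_exp hI hI' hJ hJ' hn hfs hf hc).imp_right Or.inl
  push Not at hc
  obtain ⟨x₀, hx₀, hc0⟩ := hc
  right
  by_cases hn1 : n = 1
  · subst hn1
    by_cases hc1 : ∀ x ∈ I, deriv c x = 0
    · exact Or.inl (h.upToEquiv_of_ne_zero hI hJ hJ' hn hfs hf (deriv_eq_zero_of_eqOn hI hc1)
        hx₀ hc0)
    · push Not at hc1
      obtain ⟨x₁, hx₁, hc1⟩ := hc1
      exact (h.upToEquiv_of_deriv_ne_zero hI hJ hJ' hfs hf hx₁ hc1).imp_right fun h => ⟨rfl, h⟩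
  · refine Or.inl (h.upToEquiv_of_ne_zero hI hJ hJ' hn hfs hf (fun x hx => ?_) hx₀ hc0)
    have := h.deriv2_c hI x hx
    rw [h.deriv_b hn1 x hx] at this
    linarith

end

/-! ### The special nonlinearities do have additional generators -/

section

variable {I J : Set ℝ} {X : VField} {n : ℕ} {f b c d : ℝ → ℝ}

theorem isSymmetryBasis_X₁_iff (hI' : IsConnected I) (hJ' : IsConnected J) :
    IsSymmetryBasis n I J f ![X₁] ↔
      ∀ X, IsGenerator n I J f X ↔ ∃ k : ℝ, Set.EqOn X (fun _ => (k, 0)) (I ×ˢ J) := by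
  have hspan (X : VField) : (∃ W ∈ Submodule.span ℝ (Set.range ![X₁]), Set.EqOn X W (I ×ˢ J)) ↔
      ∃ k : ℝ, Set.EqOn X (fun _ => (k, 0)) (I ×ˢ J) := by
    have hX (k : ℝ) : (k • X₁ : VField) = fun _ => (k, 0) := by
      ext q <;> simp [X₁]
    constructor
    · rintro ⟨W, hW, e⟩
      rw [Matrix.range_cons, Matrix.range_empty, Set.union_empty,
        Submodule.mem_span_singleton] at hW
      obtain ⟨k, rfl⟩ := hW
      exact ⟨k, hX k ▸ e⟩
    · rintro ⟨k, e⟩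
      exact ⟨k • X₁, Submodule.smul_mem _ _ (Submodule.subset_span ⟨0, rfl⟩), hX k ▸ e⟩
  rw [IsSymmetryBasis]
  simp_rw [hspan]
  refine and_iff_right ?_
  rw [Fintype.linearIndependent_iff]
  intro r hr i
  obtain ⟨x, hx⟩ := hI'.nonempty
  obtain ⟨y, hy⟩ := hJ'.nonempty
  have := congrArg Prod.fst (congrFun hr ⟨(x, y), hx, hy⟩)
  fin_cases i
  simpa [X₁] using this

/-- A generator with nonzero ∂_y component is not a multiple of ∂/∂x, so exhibiting one is enough.
-/
theorem AffineSymmetry.not_isSymmetryBasis (hI : IsOpen I) (hI' : IsConnected I) (hJ : IsOpen J)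
    (hJ' : IsConnected J) (hn : 1 ≤ n) (h : AffineSymmetry n I J f b c d) {x : ℝ} (hx : x ∈ I)
    (hcd : c x ≠ 0 ∨ d x ≠ 0) : ¬ IsSymmetryBasis n I J f ![X₁] := by
  rw [isSymmetryBasis_X₁_iff hI' hJ']
  intro H
  obtain ⟨k, hk⟩ := (H _).1 (h.isGenerator hI hJ hJ' hn fun _ _ => rfl)
  have := affine_eq_zero hJ hJ'.nonempty (α := c x) (β := d x) fun y hy =>
    congrArg Prod.snd (hk (show (x, y) ∈ I ×ˢ J from ⟨hx, hy⟩))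
  exact hcd.elim (fun h => h this.1) (fun h => h this.2)

/-- A scaling centred at y = -s. It serves powers after an affine change of y, and also constant f
with p = 0. -/
theorem affineSymmetry_of_euler_shift (hn : 1 ≤ n) {p s : ℝ} (hp : p ≠ 1)
    (e : ∀ y ∈ J, (y + s) * deriv f y = p * f y) :
    AffineSymmetry n I J f (fun x => 0 + 1 * x) (fun _ => 2 * (n : ℝ) / (1 - p))
      (fun _ => 2 * (n : ℝ) / (1 - p) * s) where
  smooth_b := by apply ContDiff.contDiffOn; fun_prop
  smooth_c := contDiffOn_const
  smooth_d := contDiffOn_const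
  deriv_c := by simp
  deriv_b := by simp
  eqn x hx y hy := by
    have h1 : 1 - p ≠ 0 := sub_ne_zero.2 hp.symm
    rw [iteratedDeriv_const_eq_zero (show 2 * n ≠ 0 by omega), deriv_affine]
    simp only [deriv_const', zero_mul, zero_add]
    have := e y hy
    field_simp
    linear_combination this

theorem affineSymmetry_of_linear_shift (hn : 1 ≤ n) {s : ℝ}
    (e : ∀ y ∈ J, (y + s) * deriv f y = f y) :
    AffineSymmetry n I J f (fun _ => 0) (fun _ => 1) (fun _ => s) where
  smooth_b := contDiffOn_const
  smooth_c := contDiffOn_const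
  smooth_d := contDiffOn_const
  deriv_c := by simp
  deriv_b := by simp
  eqn x hx y hy := by
    rw [iteratedDeriv_const_eq_zero (show 2 * n ≠ 0 by omega)]
    simp only [deriv_const', zero_mul, zero_add]
    linear_combination e y hy

/-- Vector fields `b ∂/∂x + (b'/2) (y + s) ∂/∂y` for the Ermakov–Pinney equation. -/
theorem affineSymmetry_of_ermakovPinney {A s : ℝ} (hb : ContDiffOn ℝ ∞ b I)
    (hI : IsOpen I) (hb3 : ∀ x ∈ I, deriv (deriv (deriv b)) x = -(4 * A) * deriv b x)
    (e : ∀ y ∈ J, (y + s) * deriv f y = -3 * f y + 4 * A * (y + s)) :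
    AffineSymmetry 1 I J f b (fun x => deriv b x * (1 / 2)) (fun x => deriv b x * (s / 2)) := by
  have db := contDiffOn_deriv hI hb
  have ddb := contDiffOn_deriv hI db
  have d1 (t : ℝ) : ∀ x ∈ I, deriv (fun x => deriv b x * t) x = deriv (deriv b) x * t :=
    fun x hx => ((hasDerivAt_of_contDiffOn hI db hx).mul_const t).deriv
  have d2 (t : ℝ) : ∀ x ∈ I, deriv (deriv (fun x => deriv b x * t)) x =
      deriv (deriv (deriv b)) x * t := fun x hx => by
    rw [deriv_congr_of_eqOn hI (d1 t) x hx, ((hasDerivAt_of_contDiffOn hI ddb hx).mul_const t).deriv]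
  refine ⟨hb, db.mul contDiffOn_const, db.mul contDiffOn_const, fun x hx => ?_,
    fun h => absurd rfl h, fun x hx y hy => ?_⟩
  · rw [d1 _ x hx]
    push_cast
    ring
  · rw [mul_one, iteratedDeriv_two_eq, d2 _ x hx, d2 _ x hx, hb3 x hx]
    push_cast
    linear_combination deriv b x / 2 * e y hy

/-- A sinh or sin of frequency 2√|A|, according to the sign of A. A constant b would also solve the
equation but yields only ∂/∂x, hence the demand that b' be nonzero somewhere. -/
theorem exists_third_order_solution (hI : IsOpen I) (hI' : IsConnected I) {A : ℝ} (hA : A ≠ 0) :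
    ∃ b : ℝ → ℝ, ContDiffOn ℝ ∞ b I ∧ (∀ x ∈ I, deriv (deriv (deriv b)) x = -(4 * A) * deriv b x) ∧
      ∃ x ∈ I, deriv b x ≠ 0 := by
  rcases lt_or_gt_of_ne hA with hlt | hgt
  · set w := 2 * √(-A) with hw
    have hw0 : w ≠ 0 := by
      have := Real.sqrt_pos.2 (neg_pos.2 hlt)
      positivity
    have hw2 : w ^ 2 = -(4 * A) := by
      rw [hw, mul_pow, Real.sq_sqrt (by linarith)]
      ring
    have dS (k : ℝ) : deriv (fun x => k * Real.sinh (w * x)) = fun x => k * w * Real.cosh (w * x) := by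
      ext x
      refine HasDerivAt.deriv ((((hasDerivAt_id x).const_mul w).sinh.const_mul k).congr_deriv ?_)
      simp
      ring
    have dC (k : ℝ) : deriv (fun x => k * Real.cosh (w * x)) = fun x => k * w * Real.sinh (w * x) := by
      ext x
      refine HasDerivAt.deriv ((((hasDerivAt_id x).const_mul w).cosh.const_mul k).congr_deriv ?_)
      simp
      ring
    obtain ⟨x, hx⟩ := hI'.nonempty
    refine ⟨fun x => 1 * Real.sinh (w * x), by apply ContDiff.contDiffOn; fun_prop, fun x _ => ?_,
      x, hx, ?_⟩
    · rw [dS, dC, dS, ← hw2]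
      ring
    · rw [dS]
      have := (Real.cosh_pos (w * x)).ne'
      positivity
  · set w := 2 * √A with hw
    have hw0 : w ≠ 0 := by
      have := Real.sqrt_pos.2 hgt
      positivity
    have hw2 : w ^ 2 = 4 * A := by
      rw [hw, mul_pow, Real.sq_sqrt (by linarith)]
      ring
    have dS (k : ℝ) : deriv (fun x => k * Real.sin (w * x)) = fun x => k * w * Real.cos (w * x) := by
      ext x
      refine HasDerivAt.deriv ((((hasDerivAt_id x).const_mul w).sin.const_mul k).congr_deriv ?_)
      simp
      ring
    have dC (k : ℝ) : deriv (fun x => k * Real.cos (w * x)) = fun x => -(k * w) * Real.sin (w * x) := by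
      ext x
      refine HasDerivAt.deriv ((((hasDerivAt_id x).const_mul w).cos.const_mul k).congr_deriv ?_)
      simp
      ring
    refine ⟨fun x => 1 * Real.sin (w * x), by apply ContDiff.contDiffOn; fun_prop, fun x _ => ?_, ?_⟩
    · rw [dS, dC, dS, ← hw2]
      ring
    -- If b' vanished on the open set `I`, so would b''; cosine and sine would then vanish at the
    -- same point.
    · by_contra h0
      push Not at h0
      have h1 := deriv_eq_zero_of_eqOn hI h0
      rw [dS, dC] at h1
      rw [dS] at h0
      obtain ⟨x, hx⟩ := hI'.nonempty
      have e0 := h0 x hx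
      have e1 := h1 x hx
      have : w ^ 4 = 0 := by
        linear_combination w ^ 3 * Real.cos (w * x) * e0 - w ^ 2 * Real.sin (w * x) * e1
          - w ^ 4 * Real.sin_sq_add_cos_sq (w * x)
      exact hw0 (pow_eq_zero_iff (by norm_num) |>.1 this)

section rescale

variable {a₁ b₁ b₂ : ℝ} {g : ℝ → ℝ}

/-- Pulls a formula for the normal form g, and its derivative, back to f. The factor b₁ from the
chain rule cancels in f'. -/
theorem hasDerivAt_rescale (hJ : IsOpen J) (ha : a₁ ≠ 0) (hb : b₁ ≠ 0)
    (hg : ∀ y ∈ J, g (b₁ * y + b₂) = b₁ / a₁ ^ (2 * n) * f y) {h : ℝ → ℝ}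
    (hgh : ∀ z ∈ (fun y => b₁ * y + b₂) '' J, g z = h z) {y : ℝ} (hy : y ∈ J) {h' : ℝ}
    (hh : HasDerivAt h h' (b₁ * y + b₂)) :
    f y = a₁ ^ (2 * n) / b₁ * h (b₁ * y + b₂) ∧ deriv f y = a₁ ^ (2 * n) * h' := by
  have e : ∀ y ∈ J, f y = a₁ ^ (2 * n) / b₁ * h (b₁ * y + b₂) := by
    intro y hy
    rw [← hgh _ ⟨y, hy, rfl⟩, hg y hy]
    field_simp
  refine ⟨e y hy, ?_⟩
  rw [deriv_congr_of_eqOn hJ e y hy]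
  have hin : HasDerivAt (fun y => b₁ * y + b₂) b₁ y := by
    simpa using ((hasDerivAt_id y).const_mul b₁).add_const b₂
  refine HasDerivAt.deriv (((hh.comp y hin).const_mul _).congr_deriv ?_)
  field_simp

theorem euler_rescale (hJ : IsOpen J) (ha : a₁ ≠ 0) (hb : b₁ ≠ 0)
    (hg : ∀ y ∈ J, g (b₁ * y + b₂) = b₁ / a₁ ^ (2 * n) * f y) {p : ℝ}
    (hd : DifferentiableOn ℝ g ((fun y => b₁ * y + b₂) '' J))
    (he : ∀ z ∈ (fun y => b₁ * y + b₂) '' J, z * deriv g z = p * g z) :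
    ∀ y ∈ J, (y + b₂ / b₁) * deriv f y = p * f y := by
  intro y hy
  have hz : b₁ * y + b₂ ∈ (fun y => b₁ * y + b₂) '' J := ⟨y, hy, rfl⟩
  obtain ⟨e1, e2⟩ := hasDerivAt_rescale hJ ha hb hg (fun _ _ => rfl) hy
    ((hd _ hz).differentiableAt ((isOpen_image_affine hJ hb).mem_nhds hz)).hasDerivAt
  have := he _ hz
  rw [e1, e2, show y + b₂ / b₁ = (b₁ * y + b₂) / b₁ by field_simp]
  generalize b₁ * y + b₂ = z at *
  field_simp
  linear_combination this

end rescale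

theorem not_isSymmetryBasis_of_listed (hI : IsOpen I) (hI' : IsConnected I) (hJ : IsOpen J)
    (hJ' : IsConnected J) (hn : 1 ≤ n) (h : UpToEquiv n IsListed J f) :
    ¬ IsSymmetryBasis n I J f ![X₁] := by
  obtain ⟨a₁, b₁, b₂, g, ha, hb, hg, hl⟩ := h
  have hn1 := one_le_cast hn
  have hn0 : (n : ℝ) ≠ 0 := by linarith
  obtain ⟨x, hx⟩ := hI'.nonempty
  have hop := isOpen_image_affine (b₂ := b₂) hJ hb
  rcases hl with ⟨l, a, hl, ha0, e⟩ | ⟨l, p, h, hl, hp0, hp1, hbr, e⟩ | ⟨l, e⟩ | ⟨l, hl, e⟩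
  · have e' : ∀ y ∈ J, f y = (a₁ ^ (2 * n) / b₁ * l * Real.exp (a * b₂)) * Real.exp (a * b₁ * y) := by
      intro y hy
      rw [(hasDerivAt_rescale hJ ha hb hg e hy (deriv_exp_mul l a _)).1,
        show a * (b₁ * y + b₂) = a * b₂ + a * b₁ * y by ring, Real.exp_add]
      ring
    refine (affineSymmetry_exp hJ hn (mul_ne_zero ha0 hb) e' 0 1).not_isSymmetryBasis hI hI' hJ hJ'
      hn hx (Or.inr ?_)
    have : 2 * (n : ℝ) / (a * b₁) ≠ 0 := by positivity
    simpa using this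
  · have hh := hbr.isHomogeneous hop hl e
    refine (affineSymmetry_of_euler_shift hn hp1 (euler_rescale hJ ha hb hg
      (hh.smooth.differentiableOn (by simp)) hh.euler)).not_isSymmetryBasis hI hI' hJ hJ' hn hx
      (Or.inl ?_)
    have : 1 - p ≠ 0 := sub_ne_zero.2 hp1.symm
    positivity
  · refine (affineSymmetry_of_euler_shift (p := 0) (s := 0) hn zero_ne_one fun y hy => ?_)
      |>.not_isSymmetryBasis hI hI' hJ hJ' hn hx (Or.inl ?_)
    · rw [(hasDerivAt_rescale hJ ha hb hg e hy (hasDerivAt_const _ l)).2]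
      ring
    · simpa using hn0
  · refine (affineSymmetry_of_linear_shift (s := b₂ / b₁) hn fun y hy => ?_).not_isSymmetryBasis
      hI hI' hJ hJ' hn hx (Or.inl one_ne_zero)
    obtain ⟨e1, e2⟩ := hasDerivAt_rescale hJ ha hb hg e hy ((hasDerivAt_id _).const_mul l)
    rw [e1, e2]
    simp only [mul_one]
    field_simp

theorem not_isSymmetryBasis_of_ermakovPinney (hI : IsOpen I) (hI' : IsConnected I) (hJ : IsOpen J)
    (hJ' : IsConnected J) (h : UpToEquiv 1 IsErmakovPinney J f) :
    ¬ IsSymmetryBasis 1 I J f ![X₁] := by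
  obtain ⟨a₁, b₁, b₂, g, ha, hb, hg, k, l, hk, hl, e⟩ := h
  -- Undoing the equivalence gives f = A (y + s) + const · (y + s)^{-3} with A = a₁² k and s =
  -- b₂/b₁; this A is the one in the third order equation for b.
  obtain ⟨b, hbs, hb3, x, hx, hbx⟩ := exists_third_order_solution hI hI' (A := a₁ ^ 2 * k)
    (by positivity)
  refine (affineSymmetry_of_ermakovPinney (s := b₂ / b₁) hbs hI hb3 fun y hy => ?_)
    |>.not_isSymmetryBasis hI hI' hJ hJ' le_rfl hx (Or.inl (by simpa using hbx))
  have hz0 := (e _ ⟨y, hy, rfl⟩).1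
  simp only at hz0
  have hd : HasDerivAt (fun z : ℝ => k * z + l * (z ^ 3)⁻¹) _ (b₁ * y + b₂) :=
    ((hasDerivAt_id _).const_mul k).fun_add
      ((HasDerivAt.fun_inv (hasDerivAt_pow 3 (b₁ * y + b₂)) (pow_ne_zero 3 hz0)).const_mul l)
  obtain ⟨e1, e2⟩ := hasDerivAt_rescale (n := 1) hJ ha hb hg (fun z hz => (e z hz).2) hy hd
  rw [e1, e2]
  simp only [mul_one]
  have : y + b₂ / b₁ = (b₁ * y + b₂) / b₁ := by field_simp
  rw [this]
  generalize b₁ * y + b₂ = z at *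
  field_simp
  push_cast
  ring

/-- The generators beyond `∂/∂x` occur exactly for the special nonlinearities. -/
theorem isSymmetryBasis_X₁_iff_not_listed (hI : IsOpen I) (hI' : IsConnected I) (hJ : IsOpen J)
    (hJ' : IsConnected J) (hn : 1 ≤ n) (hfs : ContDiffOn ℝ ∞ f J) :
    IsSymmetryBasis n I J f ![X₁] ↔
      ¬ (UpToEquiv n IsListed J f ∨ (n = 1 ∧ UpToEquiv n IsErmakovPinney J f)) := by
  constructor
  · rintro h (hl | ⟨rfl, hl⟩)
    · exact not_isSymmetryBasis_of_listed hI hI' hJ hJ' hn hl h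
    · exact not_isSymmetryBasis_of_ermakovPinney hI hI' hJ hJ' hl h
  · intro hnl
    rw [isSymmetryBasis_X₁_iff hI' hJ']
    refine fun X => ⟨fun hX => ?_, ?_⟩
    · have hf : ¬ ∃ α β : ℝ, ∀ y ∈ J, f y = α * y + β := fun ⟨α, β, e⟩ =>
        hnl (Or.inl (upToEquiv_of_affine e))
      obtain ⟨b, c, d, h, e⟩ := hX.exists_affineSymmetry hI hJ hJ' hn hf
      obtain ⟨k, hk⟩ := (h.trivial_or_listed hI hI' hJ hJ' hn hfs hf).resolve_right hnl
      refine ⟨k, fun q hq => ?_⟩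
      rw [e hq]
      simp [hk q.1 hq.1]
    · rintro ⟨k, hk⟩
      exact (affineSymmetry_const k).isGenerator hI hJ hJ' hn (hk.trans fun q _ => by simp)

end

/-! ### Superposition fields and linear nonlinearities -/

section

variable {I J : Set ℝ} {X : VField} {n : ℕ} {f b c d : ℝ → ℝ}

theorem iteratedDeriv_add_of_contDiffOn (hI : IsOpen I) {g h : ℝ → ℝ} (hg : ContDiffOn ℝ ∞ g I)
    (hh : ContDiffOn ℝ ∞ h I) (k : ℕ) :
    ∀ x ∈ I, iteratedDeriv k (fun x => g x + h x) x = iteratedDeriv k g x + iteratedDeriv k h x := by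
  induction k with
  | zero => simp
  | succ k ih =>
    simp only [iteratedDeriv_succ]
    intro x hx
    rw [deriv_congr_of_eqOn hI ih x hx]
    exact ((hasDerivAt_of_contDiffOn hI (contDiffOn_iteratedDeriv hI hg k) hx).fun_add
      (hasDerivAt_of_contDiffOn hI (contDiffOn_iteratedDeriv hI hh k) hx)).deriv

/-- Adjoining the fields `β(x) ∂/∂y` to a finite family of generators of a linear equation. -/
theorem isSymmetryBasis_sumElim (hJ' : IsConnected J) {ι κ : Type} [Fintype ι] {v : ι → VField}
    {l : ℝ} {β : κ → ℝ → ℝ} (hβ : IsSolutionBasis n I l β)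
    (h0 : ∀ (r : ι → ℝ) (γ : ℝ → ℝ), Set.EqOn (∑ i, r i • v i) (Vβ γ) (I ×ˢ J) → r = 0)
    (h : ∀ X, IsGenerator n I J f X ↔ ∃ (r : ι → ℝ) (γ : ℝ → ℝ), IsLinSolution n I l γ ∧
      Set.EqOn X (∑ i, r i • v i + Vβ γ) (I ×ˢ J)) :
    IsSymmetryBasis n I J f (Sum.elim v fun j => Vβ (β j)) := by
  classical
  obtain ⟨y₀, hy₀⟩ := hJ'.nonempty
  have hVz : Vβ 0 = 0 := by
    ext q <;> simp [Vβ]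
  constructor
  -- The linear map β ↦ β(x)∂_y on restricted functions is injective, so independence of the
  -- solutions passes to the fields.
  · set L : (I → ℝ) →ₗ[ℝ] (↥(I ×ˢ J) → ℝ × ℝ) :=
      { toFun := fun g q => (0, g ⟨q.1.1, q.2.1⟩)
        map_add' := fun g h => by ext q <;> simp
        map_smul' := fun r g => by ext q <;> simp } with hL
    have hLk : LinearMap.ker L = ⊥ := by
      rw [LinearMap.ker_eq_bot']
      intro g hg
      ext ⟨x, hx⟩
      exact congrArg Prod.snd (congrFun hg ⟨(x, y₀), hx, hy₀⟩)
    have hright := hβ.1.map' L hLk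
    have hleft : LinearIndependent ℝ fun i => (I ×ˢ J).domRestrict (v i) := by
      rw [Fintype.linearIndependent_iff]
      intro r hr
      refine congrFun (h0 r 0 fun q hq => ?_)
      have := congrFun hr ⟨q, hq⟩
      rw [hVz]
      simpa using this
    have := hleft.sum_type hright (by
      rw [Submodule.disjoint_def]
      intro z hz1 hz2
      obtain ⟨r, rfl⟩ := (Submodule.mem_span_range_iff_exists_fun ℝ).1 hz1
      rw [Set.range_comp, ← Submodule.map_span] at hz2
      obtain ⟨g, -, hg⟩ := hz2
      -- An element of both spans is a field g(x)∂_y with g defined only on `I`; extended by zero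
      -- off `I` it fits the hypothesis `h0`, which then kills the coefficients.
      have hr := h0 r (fun x => if hx : x ∈ I then g ⟨x, hx⟩ else 0) fun q hq => by
        have := congrFun hg ⟨q, hq⟩
        simp only [hL, LinearMap.coe_mk, AddHom.coe_mk] at this
        have hq1 : q.1 ∈ I := hq.1
        simp only [Vβ, hq1, dif_pos]
        rw [this]
        simp
      simp [hr])
    have e : (fun i => (I ×ˢ J).domRestrict (Sum.elim v (fun j => Vβ (β j)) i)) =
        Sum.elim (fun i => (I ×ˢ J).domRestrict (v i)) (L ∘ fun j => I.domRestrict (β j)) := by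
      ext (i | j) <;> rfl
    rw [e]
    exact this
  · intro X
    rw [h X]
    have hspan : Submodule.span ℝ (Set.range (Sum.elim v fun j => Vβ (β j))) =
        Submodule.span ℝ (Set.range v) ⊔ Submodule.span ℝ (Set.range fun j => Vβ (β j)) := by
      rw [← Submodule.span_union, Set.Sum.elim_range]
    set V : (ℝ → ℝ) →ₗ[ℝ] VField :=
      { toFun := Vβ
        map_add' := fun g h => by ext q <;> simp [Vβ]
        map_smul' := fun r g => by ext q <;> simp [Vβ] } with hV
    have hV' : Submodule.span ℝ (Set.range fun j => Vβ (β j)) =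
        (Submodule.span ℝ (Set.range β)).map V := by
      rw [Submodule.map_span, ← Set.range_comp]
      rfl
    constructor
    · rintro ⟨r, γ, hγ, e⟩
      obtain ⟨γ', hγ', e'⟩ := (hβ.2 γ).1 hγ
      refine ⟨∑ i, r i • v i + V γ', ?_, e.trans fun q hq => ?_⟩
      · rw [hspan, hV']
        exact Submodule.add_mem_sup ((Submodule.mem_span_range_iff_exists_fun ℝ).2 ⟨r, rfl⟩)
          (Submodule.mem_map_of_mem hγ')
      · simp [hV, Vβ, e' hq.1]
    · rintro ⟨W, hW, e⟩
      rw [hspan, hV', Submodule.mem_sup] at hW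
      obtain ⟨W1, hW1, W2, ⟨γ, hγ, rfl⟩, rfl⟩ := hW
      obtain ⟨r, rfl⟩ := (Submodule.mem_span_range_iff_exists_fun ℝ).1 hW1
      exact ⟨r, γ, (hβ.2 γ).2 ⟨γ, hγ, Set.eqOn_refl _ _⟩, e⟩

section linear

variable {l : ℝ}

theorem deriv_of_eqOn_linear (hJ : IsOpen J) (hf : ∀ y ∈ J, f y = l * y) :
    ∀ y ∈ J, deriv f y = l := by
  intro y hy
  rw [deriv_congr_of_eqOn hJ (h := fun y => 0 + l * y) (fun y hy => by rw [hf y hy]; ring) y hy,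
    deriv_affine]

/-- At fixed x the equation becomes 2nλ b' y + (d^{(2n)} + λ d) = 0, so b is constant because λ ≠ 0,
then c is constant, and d is any solution of the linear equation itself. -/
theorem isSymmetryBasis_linear_of_one_lt (hI : IsOpen I) (hI' : IsConnected I) (hJ : IsOpen J)
    (hJ' : IsConnected J) (hn : 1 < n) (hl : l ≠ 0) (hf : ∀ y ∈ J, f y = l * y) {κ : Type}
    {β : κ → ℝ → ℝ} (hβ : IsSolutionBasis n I l β) :
    IsSymmetryBasis n I J f (Sum.elim ![X₁, V₁] fun j => Vβ (β j)) := by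
  have hn1 := one_le_cast hn.le
  have hf' := deriv_of_eqOn_linear hJ hf
  refine isSymmetryBasis_sumElim hJ' hβ (fun r γ hr => ?_) fun X => ?_
  · obtain ⟨x, hx⟩ := hI'.nonempty
    have key : ∀ y ∈ J, r 0 = 0 ∧ r 1 * y + -γ x = 0 := fun y hy => by
      have := hr (show (x, y) ∈ I ×ˢ J from ⟨hx, hy⟩)
      simp [X₁, V₁, Vβ] at this
      exact ⟨this.1, by linarith [this.2]⟩
    obtain ⟨y, hy⟩ := hJ'.nonempty
    ext i
    fin_cases i
    · exact (key y hy).1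
    · exact (affine_eq_zero hJ ⟨y, hy⟩ fun y hy => (key y hy).2).1
  · rw [isGenerator_iff_of_two_le hI hJ hJ' hn]
    constructor
    · rintro ⟨b, c, d, hb, hc, hd, e, h⟩
      have key : ∀ x ∈ I, deriv b x = 0 ∧ iteratedDeriv (2 * n) d x + l * d x = 0 := by
        intro x hx
        have := affine_eq_zero hJ hJ'.nonempty (α := 2 * n * l * deriv b x)
          (β := iteratedDeriv (2 * n) d x + l * d x) fun y hy => by
            have := (h x hx).2.2 y hy
            rw [hf y hy, hf' y hy] at this
            linear_combination this
        exact ⟨(mul_eq_zero.1 this.1).resolve_left (by positivity), this.2⟩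
      obtain ⟨β₀, hb0⟩ := eq_const_of_deriv hI hI' hb fun x hx => (key x hx).1
      obtain ⟨k, hk⟩ := eq_const_of_deriv hI hI' hc fun x hx => by
        have := (h x hx).1
        rw [deriv_eq_zero_of_eqOn hI (fun x hx => (key x hx).1) x hx] at this
        linarith
      refine ⟨![β₀, k], d, ⟨hd, fun x hx => (key x hx).2⟩, fun q hq => ?_⟩
      rw [e hq]
      simp [X₁, V₁, Vβ, hb0 q.1 hq.1, hk q.1 hq.1]
    · rintro ⟨r, γ, hγ, e⟩
      refine ⟨fun _ => r 0, fun _ => r 1, γ, contDiffOn_const, contDiffOn_const, hγ.1,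
        e.trans fun q hq => by simp [X₁, V₁, Vβ], fun x hx => ⟨by simp, by simp, fun y hy => ?_⟩⟩
      rw [hf y hy, hf' y hy]
      simp only [deriv_const', mul_zero, sub_zero]
      linear_combination hγ.2 x hx

/-- `S, C` behave like sine and cosine (`σ = -1`) or their hyperbolic analogues (`σ = 1`) of
`w x`. -/
structure IsTrigPair (σ w : ℝ) (S C : ℝ → ℝ) : Prop where
  contDiff_S : ContDiff ℝ ∞ S
  contDiff_C : ContDiff ℝ ∞ C
  deriv_S : ∀ x, HasDerivAt S (w * C x) x
  deriv_C : ∀ x, HasDerivAt C (σ * w * S x) x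
  sq_sub : ∀ x, C x ^ 2 - σ * S x ^ 2 = 1
  sq_sign : σ ^ 2 = 1

theorem isTrigPair_sin (w : ℝ) :
    IsTrigPair (-1) w (fun x => Real.sin (w * x)) (fun x => Real.cos (w * x)) where
  contDiff_S := by fun_prop
  contDiff_C := by fun_prop
  deriv_S x := (((hasDerivAt_id x).const_mul w).sin).congr_deriv (by simp; ring)
  deriv_C x := (((hasDerivAt_id x).const_mul w).cos).congr_deriv (by simp; ring)
  sq_sub x := by linear_combination Real.sin_sq_add_cos_sq (w * x)
  sq_sign := by norm_num

theorem isTrigPair_sinh (w : ℝ) :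
    IsTrigPair 1 w (fun x => Real.sinh (w * x)) (fun x => Real.cosh (w * x)) where
  contDiff_S := by fun_prop
  contDiff_C := by fun_prop
  deriv_S x := (((hasDerivAt_id x).const_mul w).sinh).congr_deriv (by simp; ring)
  deriv_C x := (((hasDerivAt_id x).const_mul w).cosh).congr_deriv (by simp; ring)
  sq_sub x := by linear_combination Real.cosh_sq_sub_sinh_sq (w * x)
  sq_sign := by norm_num

variable {σ w : ℝ} {S C S₂ C₂ : ℝ → ℝ}

theorem IsTrigPair.deriv_comb (h : IsTrigPair σ w S C) (r s k : ℝ) :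
    deriv (fun x => r * S x + s * C x + k) = fun x => s * σ * w * S x + r * w * C x + 0 := by
  ext x
  refine HasDerivAt.deriv (((((h.deriv_S x).const_mul r).fun_add ((h.deriv_C x).const_mul s)).add_const
    k).congr_deriv ?_)
  ring

/-- The second derivative removes the constant k; the first and second derivatives then form a
linear system for r and s with determinant C² - σS² = 1. -/
theorem IsTrigPair.eq_zero (hI : IsOpen I) (hI' : IsConnected I) (h : IsTrigPair σ w S C)
    (hw : w ≠ 0) {r s k : ℝ} (e : ∀ x ∈ I, r * S x + s * C x + k = 0) :
    r = 0 ∧ s = 0 ∧ k = 0 := by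
  have e1 := deriv_eq_zero_of_eqOn hI e
  have e2 := deriv_eq_zero_of_eqOn hI e1
  rw [h.deriv_comb] at e1
  rw [h.deriv_comb, h.deriv_comb] at e2
  obtain ⟨x, hx⟩ := hI'.nonempty
  have k1 : r * C x + s * σ * S x = 0 := by
    apply mul_left_cancel₀ hw
    linear_combination e1 x hx
  have k2 : r * S x + s * C x = 0 := by
    have hw2 : w * w ≠ 0 := mul_ne_zero hw hw
    apply mul_left_cancel₀ hw2
    linear_combination σ * e2 x hx - w * w * (r * S x + s * C x) * h.sq_sign
  have q := h.sq_sub x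
  refine ⟨by linear_combination C x * k1 - σ * S x * k2 - r * q,
    by linear_combination C x * k2 - S x * k1 - s * q, by linear_combination e x hx - k2⟩

/-- Solutions of `a'' = σ w² a`. -/
theorem IsTrigPair.eq_of_deriv2 (hI : IsOpen I) (hI' : IsConnected I) (h : IsTrigPair σ w S C)
    (hw : w ≠ 0) {a : ℝ → ℝ} (ha : ContDiffOn ℝ ∞ a I)
    (e : ∀ x ∈ I, deriv (deriv a) x = σ * w ^ 2 * a x) :
    ∃ r s : ℝ, ∀ x ∈ I, a x = r * S x + s * C x := by
  have hd0 {x : ℝ} (hx : x ∈ I) := hasDerivAt_of_contDiffOn hI ha hx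
  have hd1 {x : ℝ} (hx : x ∈ I) := hasDerivAt_of_contDiffOn hI (contDiffOn_deriv hI ha) hx
  obtain ⟨x₀, hx₀⟩ := hI'.nonempty
  -- The two quantities differentiated here are the first integrals from variation of constants;
  -- their constant values are the coefficients of S and C, recovered through C² - σS² = 1.
  have e1 : ∀ x ∈ I, _ = _ := fun x hx => eq_of_hasDerivAt_zero hI hI'.isPreconnected
    (g := fun x => deriv a x / w * C x - σ * (a x * S x)) (fun x hx => by
      refine ((((hd1 hx).div_const w).fun_mul (h.deriv_C x)).fun_sub
        (((hd0 hx).fun_mul (h.deriv_S x)).const_mul σ)).congr_deriv ?_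
      rw [e x hx]
      field_simp
      ring) hx hx₀
  have e2 : ∀ x ∈ I, _ = _ := fun x hx => eq_of_hasDerivAt_zero hI hI'.isPreconnected
    (g := fun x => a x * C x - deriv a x / w * S x) (fun x hx => by
      refine (((hd0 hx).fun_mul (h.deriv_C x)).fun_sub
        (((hd1 hx).div_const w).fun_mul (h.deriv_S x))).congr_deriv ?_
      rw [e x hx]
      field_simp
      ring) hx hx₀
  refine ⟨deriv a x₀ / w * C x₀ - σ * (a x₀ * S x₀), a x₀ * C x₀ - deriv a x₀ / w * S x₀,
    fun x hx => ?_⟩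
  rw [← e1 x hx, ← e2 x hx]
  linear_combination -a x * h.sq_sub x

theorem IsTrigPair.contDiff_comb (h : IsTrigPair σ w S C) (r s k : ℝ) :
    ContDiff ℝ ∞ (fun x => r * S x + s * C x + k) :=
  ((contDiff_const.mul h.contDiff_S).add (contDiff_const.mul h.contDiff_C)).add contDiff_const

/-- Solutions of `b''' = σ w² b'`. -/
theorem IsTrigPair.eq_of_deriv3 (hI : IsOpen I) (hI' : IsConnected I) (h : IsTrigPair σ w S C)
    (hw : w ≠ 0) (hb : ContDiffOn ℝ ∞ b I)
    (e : ∀ x ∈ I, deriv (deriv (deriv b)) x = σ * w ^ 2 * deriv b x) :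
    ∃ r s k : ℝ, ∀ x ∈ I, b x = r * S x + s * C x + k := by
  obtain ⟨r, s, hrs⟩ := h.eq_of_deriv2 hI hI' hw (contDiffOn_deriv hI hb) e
  obtain ⟨k, hk⟩ := eq_add_of_deriv_eq hI hI' hb
    (h.contDiff_comb (s / w) (r * σ / w) 0).contDiffOn fun x hx => by
      rw [hrs x hx, h.deriv_comb]
      field_simp
      linear_combination -r * S x * h.sq_sign
  exact ⟨s / w, r * σ / w, k, fun x hx => by rw [hk x hx, add_zero]⟩

/-- The generators of a linear second order equation other than the fields `β(x) ∂/∂y`. -/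
def trigField (σ w : ℝ) (S C S₂ C₂ : ℝ → ℝ) : Fin 6 → VField :=
  ![X₁, V₁, fun q => (S₂ q.1, w * q.2 * C₂ q.1), fun q => (C₂ q.1, σ * (w * q.2 * S₂ q.1)),
    fun q => (q.2 * S q.1, w * q.2 ^ 2 * C q.1), fun q => (q.2 * C q.1, σ * (w * q.2 ^ 2 * S q.1))]

/-- Brings a combination into the shape (a y + b, a' y² + c y + d) of `isGenerator_one_iff`. The
summands 0 keep the coefficients in the form to which `IsTrigPair.deriv_comb` applies. -/
theorem trigField_comb (r : Fin 6 → ℝ) (γ : ℝ → ℝ) (q : ℝ × ℝ) :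
    (∑ i, r i • trigField σ w S C S₂ C₂ i + Vβ γ) q =
      ((r 4 * S q.1 + r 5 * C q.1 + 0) * q.2 + (r 2 * S₂ q.1 + r 3 * C₂ q.1 + r 0),
        (r 5 * σ * w * S q.1 + r 4 * w * C q.1 + 0) * q.2 ^ 2 +
        (r 3 * σ * w * S₂ q.1 + r 2 * w * C₂ q.1 + r 1) * q.2 + γ q.1) := by
  simp [trigField, Fin.sum_univ_succ, X₁, V₁, Vβ]
  constructor <;> ring

/-- Splitting in powers of y gives a'' = σw² a, 2c' = b'', c'' = 2σw² b' and d'' + λ d = 0. The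
middle two combine to b''' = σ(2w)² b', which is why double frequencies occur in the ∂_x part, and c
= b'/2 + const contributes the multiple of y ∂_y. -/
theorem isSymmetryBasis_linear_one (hI : IsOpen I) (hI' : IsConnected I) (hJ : IsOpen J)
    (hJ' : IsConnected J) (hw : w ≠ 0) (h : IsTrigPair σ w S C) (h₂ : IsTrigPair σ (2 * w) S₂ C₂)
    (hl : l = -(σ * w ^ 2)) (hf : ∀ y ∈ J, f y = l * y) {κ : Type}
    {β : κ → ℝ → ℝ} (hβ : IsSolutionBasis 1 I l β) :
    IsSymmetryBasis 1 I J f (Sum.elim (trigField σ w S C S₂ C₂) fun j => Vβ (β j)) := by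
  have hf' := deriv_of_eqOn_linear hJ hf
  have h2w : 2 * w ≠ 0 := mul_ne_zero two_ne_zero hw
  refine isSymmetryBasis_sumElim hJ' hβ (fun r γ hr => ?_) fun X => ?_
  · have e : ∀ q ∈ I ×ˢ J, (∑ i, r i • trigField σ w S C S₂ C₂ i + Vβ (-γ)) q = 0 := by
      intro q hq
      rw [Pi.add_apply, hr hq]
      simp [Vβ]
    have e1 : ∀ x ∈ I, r 4 * S x + r 5 * C x + 0 = 0 ∧ r 2 * S₂ x + r 3 * C₂ x + r 0 = 0 :=
      fun x hx => affine_eq_zero hJ hJ'.nonempty fun y hy => by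
        have := e (x, y) ⟨hx, hy⟩
        rw [trigField_comb] at this
        exact congrArg Prod.fst this
    obtain ⟨h4, h5, -⟩ := h.eq_zero hI hI' hw fun x hx => (e1 x hx).1
    obtain ⟨h2, h3, h0⟩ := h₂.eq_zero hI hI' h2w fun x hx => (e1 x hx).2
    obtain ⟨x, hx⟩ := hI'.nonempty
    have h1 : r 1 = 0 := (affine_eq_zero hJ hJ'.nonempty (α := r 1) (β := (-γ) x) fun y hy => by
      have := e (x, y) ⟨hx, hy⟩
      rw [trigField_comb] at this
      have := congrArg Prod.snd this
      simpa [h2, h3, h4, h5] using this).1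
    ext i
    fin_cases i <;> assumption
  · rw [isGenerator_one_iff hI hJ hJ']
    constructor
    · rintro ⟨a, b, c, d, ha, hb, hc, hd, e, H⟩
      have k1 : ∀ x ∈ I, deriv (deriv a) x = σ * w ^ 2 * a x ∧
          2 * deriv c x = deriv (deriv b) x := by
        intro x hx
        have := affine_eq_zero hJ hJ'.nonempty (α := 3 * (deriv (deriv a) x + l * a x))
          (β := 2 * deriv c x - deriv (deriv b) x) fun y hy => by
            have := (H x hx y hy).1
            rw [hf y hy] at this
            linear_combination this
        rw [hl] at this
        exact ⟨by linarith [this.1], by linarith [this.2]⟩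
      obtain ⟨r4, r5, ha'⟩ := h.eq_of_deriv2 hI hI' hw ha fun x hx => (k1 x hx).1
      -- This makes the y² terms a''' y² + λ a' y² cancel in the second determining equation.
      have ha3 : ∀ x ∈ I, deriv (deriv (deriv a)) x = σ * w ^ 2 * deriv a x := fun x hx =>
        HasDerivAt.unique_of_eqOn hI (fun x hx => (k1 x hx).1) hx
          (hasDerivAt_of_contDiffOn hI (contDiffOn_deriv hI (contDiffOn_deriv hI ha)) hx)
          ((hasDerivAt_of_contDiffOn hI ha hx).const_mul _)
      have k2 : ∀ x ∈ I, deriv (deriv c) x = 2 * (σ * w ^ 2) * deriv b x ∧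
          deriv (deriv d) x + l * d x = 0 := by
        intro x hx
        have := affine_eq_zero hJ hJ'.nonempty (α := deriv (deriv c) x + 2 * l * deriv b x)
          (β := deriv (deriv d) x + l * d x) fun y hy => by
            have := (H x hx y hy).2
            rw [hf y hy, hf' y hy, ha3 x hx] at this
            linear_combination this - y ^ 2 * deriv a x * hl
        rw [hl] at this
        exact ⟨by linarith [this.1], by rw [hl]; exact this.2⟩
      have k3 : ∀ x ∈ I, deriv (deriv (deriv b)) x = σ * (2 * w) ^ 2 * deriv b x := by
        intro x hx
        have := HasDerivAt.unique_of_eqOn hI (fun x hx => (k1 x hx).2) hx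
          ((hasDerivAt_of_contDiffOn hI (contDiffOn_deriv hI hc) hx).const_mul 2)
          (hasDerivAt_of_contDiffOn hI (contDiffOn_deriv hI (contDiffOn_deriv hI hb)) hx)
        linear_combination -this + 2 * (k2 x hx).1
      obtain ⟨r2, r3, r0, hb'⟩ := h₂.eq_of_deriv3 hI hI' h2w hb k3
      obtain ⟨r1, hc'⟩ := eq_add_of_deriv_eq hI hI' hc (h := fun x => deriv b x * (1 / 2))
        ((contDiffOn_deriv hI hb).mul contDiffOn_const) fun x hx => by
          rw [((hasDerivAt_of_contDiffOn hI (contDiffOn_deriv hI hb) hx).mul_const _).deriv]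
          linear_combination (k1 x hx).2 / 2
      refine ⟨![r0, r1, r2, r3, r4, r5], d, ⟨hd, fun x hx => ?_⟩, fun q hq => ?_⟩
      · rw [mul_one, iteratedDeriv_two_eq]
        exact (k2 x hx).2
      · have hda := deriv_congr_of_eqOn hI (g := a) (h := fun x => r4 * S x + r5 * C x + 0)
          (fun x hx => by rw [ha' x hx, add_zero]) q.1 hq.1
        rw [h.deriv_comb] at hda
        have hdb := deriv_congr_of_eqOn hI hb' q.1 hq.1
        rw [h₂.deriv_comb] at hdb
        rw [e hq, trigField_comb]
        simp only [ha' q.1 hq.1, hb' q.1 hq.1, hc' q.1 hq.1, hda, hdb]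
        refine Prod.ext ?_ ?_
        · simp
        · dsimp
          ring
    · rintro ⟨r, γ, hγ, e⟩
      refine ⟨fun x => r 4 * S x + r 5 * C x + 0, fun x => r 2 * S₂ x + r 3 * C₂ x + r 0,
        fun x => r 3 * σ * w * S₂ x + r 2 * w * C₂ x + r 1, γ, (h.contDiff_comb _ _ _).contDiffOn,
        (h₂.contDiff_comb _ _ _).contDiffOn, (h₂.contDiff_comb _ _ _).contDiffOn, hγ.1,
        e.trans fun q hq => ?_, fun x hx y hy => ?_⟩
      · rw [trigField_comb, h.deriv_comb]
      · have := hγ.2 x hx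
        rw [mul_one, iteratedDeriv_two_eq] at this
        rw [hf y hy, hf' y hy]
        simp only [h.deriv_comb, h₂.deriv_comb]
        subst hl
        refine ⟨by ring, by linear_combination this⟩

end linear

end

/-! ### Constant nonlinearities -/

section

variable {I J : Set ℝ} {n : ℕ} {f : ℝ → ℝ} {l : ℝ}

/-- The polynomial with derivatives `r j` at the origin. -/
def taylorPoly {N : ℕ} (r : Fin N → ℝ) : ℝ → ℝ :=
  fun x => ∑ j, r j * (x ^ (j : ℕ) / ((j : ℕ).factorial : ℝ))

theorem contDiff_taylorPoly {N : ℕ} (r : Fin N → ℝ) : ContDiff ℝ ∞ (taylorPoly r) := by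
  unfold taylorPoly
  fun_prop

theorem taylorPoly_succ {N : ℕ} (r : Fin (N + 1) → ℝ) (x : ℝ) :
    taylorPoly r x = r 0 + ∑ j : Fin N, r j.succ * (x ^ (j + 1 : ℕ) / ((j + 1 : ℕ).factorial : ℝ)) := by
  simp [taylorPoly, Fin.sum_univ_succ]

theorem hasDerivAt_pow_div_factorial (k : ℕ) (x : ℝ) :
    HasDerivAt (fun x : ℝ => x ^ (k + 1) / ((k + 1).factorial : ℝ))
      (x ^ k / (k.factorial : ℝ)) x := by
  refine ((hasDerivAt_pow (k + 1) x).div_const _).congr_deriv ?_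
  have : (k.factorial : ℝ) ≠ 0 := by positivity
  rw [Nat.factorial_succ]
  push_cast
  field_simp

theorem deriv_taylorPoly {N : ℕ} (r : Fin (N + 1) → ℝ) :
    deriv (taylorPoly r) = taylorPoly fun j => r j.succ := by
  ext x
  have e : taylorPoly r = fun x =>
      r 0 + ∑ j : Fin N, r j.succ * (x ^ (j + 1 : ℕ) / ((j + 1 : ℕ).factorial : ℝ)) :=
    funext (taylorPoly_succ r)
  rw [e]
  exact ((HasDerivAt.fun_sum fun (j : Fin N) _ =>
    (hasDerivAt_pow_div_factorial j x).const_mul (r j.succ)).const_add (r 0)).deriv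

theorem taylorPoly_eq_zero (hI : IsOpen I) (hI' : IsConnected I) {N : ℕ} {r : Fin N → ℝ}
    (h : ∀ x ∈ I, taylorPoly r x = 0) : r = 0 := by
  induction N with
  | zero => exact Subsingleton.elim _ _
  | succ N ih =>
    have h1 := deriv_eq_zero_of_eqOn hI h
    rw [deriv_taylorPoly] at h1
    have hr := congrFun (ih h1)
    obtain ⟨x, hx⟩ := hI'.nonempty
    have h0 := h x hx
    rw [taylorPoly_succ] at h0
    ext j
    refine Fin.cases ?_ hr j
    simpa [hr] using h0

/-- Induction by integrating β': a primitive of a Taylor polynomial shifts its coefficients by one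
place, and the integration constant is prepended. -/
theorem iteratedDeriv_eq_zero_iff (hI : IsOpen I) (hI' : IsConnected I) {N : ℕ} {β : ℝ → ℝ}
    (hβ : ContDiffOn ℝ ∞ β I) :
    (∀ x ∈ I, iteratedDeriv N β x = 0) ↔ ∃ r : Fin N → ℝ, ∀ x ∈ I, β x = taylorPoly r x := by
  induction N generalizing β with
  | zero => simp [taylorPoly]
  | succ N ih =>
    rw [iteratedDeriv_succ', ih (contDiffOn_deriv hI hβ)]
    constructor
    · rintro ⟨r, hr⟩
      obtain ⟨k, hk⟩ := eq_add_of_deriv_eq hI hI' hβ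
        (contDiff_taylorPoly (Fin.cons 0 r)).contDiffOn fun x hx => by
          rw [hr x hx, deriv_taylorPoly]
          rfl
      refine ⟨Fin.cons k r, fun x hx => ?_⟩
      rw [hk x hx, taylorPoly_succ, taylorPoly_succ]
      simp [add_comm]
    · rintro ⟨r, hr⟩
      refine ⟨fun j => r j.succ, fun x hx => ?_⟩
      rw [deriv_congr_of_eqOn hI hr x hx, deriv_taylorPoly]

theorem isSolutionBasis_pow (hI : IsOpen I) (hI' : IsConnected I) :
    IsSolutionBasis n I 0
      (fun (j : Fin (2 * n)) x => x ^ (j : ℕ) / ((j : ℕ).factorial : ℝ)) := by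
  constructor
  · rw [Fintype.linearIndependent_iff]
    intro r hr
    refine congrFun (taylorPoly_eq_zero hI hI' fun x hx => ?_)
    simpa [taylorPoly] using congrFun hr ⟨x, hx⟩
  · intro β
    have key : ∀ r : Fin (2 * n) → ℝ,
        (∑ j, r j • fun x : ℝ => x ^ (j : ℕ) / ((j : ℕ).factorial : ℝ)) = taylorPoly r := by
      intro r
      ext x
      simp [taylorPoly]
    constructor
    · rintro ⟨hβ, h⟩
      obtain ⟨r, hr⟩ := (iteratedDeriv_eq_zero_iff hI hI' hβ).1 fun x hx => by simpa using h x hx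
      exact ⟨_, (Submodule.mem_span_range_iff_exists_fun ℝ).2 ⟨r, key r⟩, hr⟩
    · rintro ⟨γ, hγ, e⟩
      obtain ⟨r, rfl⟩ := (Submodule.mem_span_range_iff_exists_fun ℝ).1 hγ
      rw [key] at e
      have hβ := (contDiff_taylorPoly r).contDiffOn.congr e
      exact ⟨hβ, by simpa using (iteratedDeriv_eq_zero_iff hI hI' hβ).2 ⟨r, e⟩⟩

theorem Z_eq_Vβ (N : ℕ) : (fun j : Fin N => Z j) =
    fun j : Fin N => Vβ fun x => x ^ (j : ℕ) / ((j : ℕ).factorial : ℝ) := rfl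

/-- Supplies a particular solution of d^{(N)} = A + Bx, which is all the inhomogeneous part needed
for n > 1. -/
theorem iteratedDeriv_pow_div_factorial (A B : ℝ) (N : ℕ) :
    iteratedDeriv N (fun x : ℝ => A * (x ^ N / (N.factorial : ℝ)) +
      B * (x ^ (N + 1) / ((N + 1).factorial : ℝ))) = fun x => A + B * x := by
  induction N with
  | zero => simp
  | succ N ih =>
    rw [iteratedDeriv_succ', ← ih]
    congr 1
    ext x
    exact (((hasDerivAt_pow_div_factorial N x).const_mul A).fun_add
      ((hasDerivAt_pow_div_factorial (N + 1) x).const_mul B)).deriv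

theorem deriv_eq_zero_of_eqOn_const (hJ : IsOpen J) (hf : ∀ y ∈ J, f y = l) :
    ∀ y ∈ J, deriv f y = 0 := by
  intro y hy
  rw [deriv_congr_of_eqOn hJ hf y hy, deriv_const]

theorem quadratic_eq_zero (hI : IsOpen I) (hI' : IsConnected I) {β₀ β₁ β₂ : ℝ}
    (h : ∀ x ∈ I, β₀ + β₁ * x + β₂ * x ^ 2 = 0) : β₀ = 0 ∧ β₁ = 0 ∧ β₂ = 0 := by
  have h1 := deriv_eq_zero_of_eqOn hI h
  rw [deriv_quadratic] at h1
  obtain ⟨h2, h1⟩ := affine_eq_zero hI hI'.nonempty fun x hx => (add_comm _ _).trans (h1 x hx)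
  obtain ⟨x, hx⟩ := hI'.nonempty
  have h2 : β₂ = 0 := by linarith
  have := h x hx
  exact ⟨by simpa [h1, h2] using this, h1, h2⟩

/-- Writes combinations in the form (b, c y + d). The product x · x^{2n}/(2n)! from Y₂ is expressed
as (2n+1) x^{2n+1}/(2n+1)! to match `iteratedDeriv_pow_div_factorial`. -/
theorem constField_comb (hn : 1 ≤ n) (r : Fin 4 → ℝ) (γ : ℝ → ℝ) (q : ℝ × ℝ) :
    (∑ i, r i • ![X₁, Y₁ n l, Y₂ n l, Y₃ n l] i + Vβ γ) q =
      (r 0 + r 1 * q.1 + r 2 * q.1 ^ 2,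
        ((2 * (n : ℝ) - 1) / 2 * (r 1 + 2 * r 2 * q.1) + r 3) * q.2 +
        ((l * (r 3 - (2 * n + 1) / 2 * r 1) * (q.1 ^ (2 * n) / ((2 * n).factorial : ℝ)) +
          -(l * r 2 * (2 * n + 1)) * (q.1 ^ (2 * n + 1) / ((2 * n + 1).factorial : ℝ))) +
          γ q.1)) := by
  have h1 := one_le_cast hn
  have h2 : 2 * (n : ℝ) - 1 ≠ 0 := by linarith
  have h3 : ((2 * n).factorial : ℝ) ≠ 0 := by positivity
  rw [Nat.factorial_succ]
  simp [Fin.sum_univ_succ, X₁, Y₁, Y₂, Y₃, Vβ]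
  constructor
  · ring
  · field_simp
    ring

/-- Here b is quadratic, c = (2n-1)/2 · b' + k, and d^{(2n)} = λ(c - 2n b') is affine in x.
Subtracting a particular solution from d leaves a polynomial of degree below 2n, that is, a
combination of the fields Z_j. -/
theorem isSymmetryBasis_const_of_one_lt (hI : IsOpen I) (hI' : IsConnected I) (hJ : IsOpen J)
    (hJ' : IsConnected J) (hn : 1 < n) (hf : ∀ y ∈ J, f y = l) :
    IsSymmetryBasis n I J f
      (Sum.elim ![X₁, Y₁ n l, Y₂ n l, Y₃ n l] (fun j : Fin (2 * n) => Z j)) := by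
  have hf' := deriv_eq_zero_of_eqOn_const hJ hf
  rw [Z_eq_Vβ]
  refine isSymmetryBasis_sumElim hJ' (isSolutionBasis_pow hI hI') (fun r γ hr => ?_) fun X => ?_
  · have e : ∀ q ∈ I ×ˢ J,
        (∑ i, r i • ![X₁, Y₁ n l, Y₂ n l, Y₃ n l] i + Vβ (-γ)) q = 0 := by
      intro q hq
      rw [Pi.add_apply, hr hq]
      simp [Vβ]
    obtain ⟨y, hy⟩ := hJ'.nonempty
    obtain ⟨h0, h1, h2⟩ := quadratic_eq_zero hI hI' (β₀ := r 0) (β₁ := r 1) (β₂ := r 2)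
      fun x hx => by
        have := e (x, y) ⟨hx, hy⟩
        rw [constField_comb hn.le] at this
        exact congrArg Prod.fst this
    obtain ⟨x, hx⟩ := hI'.nonempty
    have h3 : r 3 = 0 := (affine_eq_zero hJ hJ'.nonempty (α := r 3)
      (β := l * r 3 * (x ^ (2 * n) / ((2 * n).factorial : ℝ)) + (-γ) x) fun y hy => by
        have := e (x, y) ⟨hx, hy⟩
        rw [constField_comb hn.le] at this
        have := congrArg Prod.snd this
        simpa [h1, h2] using this).1
    ext i
    fin_cases i <;> assumption
  · rw [isGenerator_iff_of_two_le hI hJ hJ' hn]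
    have hD : ∀ A B : ℝ, ContDiffOn ℝ ∞ (fun x : ℝ => A * (x ^ (2 * n) / ((2 * n).factorial : ℝ)) +
        B * (x ^ (2 * n + 1) / ((2 * n + 1).factorial : ℝ))) I := fun A B => by
      apply ContDiff.contDiffOn
      fun_prop
    constructor
    · rintro ⟨b, c, d, hb, hc, hd, e, h⟩
      obtain ⟨β₀, β₁, β₂, hb'⟩ := eq_quadratic_of_deriv3 hI hI' hb fun x hx => (h x hx).2.1
      have hb1 := deriv_congr_of_eqOn hI hb'
      rw [deriv_quadratic] at hb1
      obtain ⟨k, hk⟩ := eq_add_of_deriv_eq hI hI' hc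
        (h := fun x => (2 * (n : ℝ) - 1) / 2 * deriv b x)
        (contDiffOn_const.mul (contDiffOn_deriv hI hb)) fun x hx => by
          rw [((hasDerivAt_of_contDiffOn hI (contDiffOn_deriv hI hb) hx).const_mul _).deriv]
          linear_combination (h x hx).1 / 2
      refine ⟨![β₀, β₁, β₂, k], fun x => d x +
        (-(l * (k - (2 * n + 1) / 2 * β₁)) * (x ^ (2 * n) / ((2 * n).factorial : ℝ)) +
          (l * β₂ * (2 * n + 1)) * (x ^ (2 * n + 1) / ((2 * n + 1).factorial : ℝ))),
        ⟨hd.add (hD _ _), fun x hx => ?_⟩, fun q hq => ?_⟩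
      · rw [iteratedDeriv_add_of_contDiffOn hI hd (hD _ _) _ x hx, iteratedDeriv_pow_div_factorial]
        obtain ⟨y, hy⟩ := hJ'.nonempty
        have := (h x hx).2.2 y hy
        rw [hf y hy, hf' y hy, hk x hx, hb1 x hx] at this
        linear_combination this
      · rw [e hq, constField_comb hn.le]
        dsimp only
        rw [hb' q.1 hq.1, hk q.1 hq.1, hb1 q.1 hq.1]
        exact Prod.ext rfl (by dsimp; ring)
    · rintro ⟨r, γ, hγ, e⟩
      refine ⟨fun x => r 0 + r 1 * x + r 2 * x ^ 2,
        fun x => ((2 * (n : ℝ) - 1) / 2 * r 1 + r 3) + ((2 * (n : ℝ) - 1) * r 2) * x,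
        fun x => (l * (r 3 - (2 * n + 1) / 2 * r 1) * (x ^ (2 * n) / ((2 * n).factorial : ℝ)) +
          -(l * r 2 * (2 * n + 1)) * (x ^ (2 * n + 1) / ((2 * n + 1).factorial : ℝ))) + γ x,
        ?_, ?_, (hD _ _).add hγ.1, e.trans fun q hq => ?_, fun x hx => ?_⟩
      · apply ContDiff.contDiffOn
        fun_prop
      · apply ContDiff.contDiffOn
        fun_prop
      · rw [constField_comb hn.le]
        exact Prod.ext rfl (by dsimp; ring)
      · rw [deriv_quadratic, deriv_affine, deriv_affine, deriv_const,
          iteratedDeriv_add_of_contDiffOn hI (hD _ _) hγ.1 _ x hx, iteratedDeriv_pow_div_factorial]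
        refine ⟨by ring, rfl, fun y hy => ?_⟩
        rw [hf y hy, hf' y hy]
        linear_combination hγ.2 x hx

/-- The derivative is written as a quartic again, with a zero top coefficient, so that the rule can
be applied repeatedly. -/
theorem deriv_quartic (p₀ p₁ p₂ p₃ p₄ : ℝ) :
    deriv (fun x => p₀ + p₁ * x + p₂ * x ^ 2 + p₃ * x ^ 3 + p₄ * x ^ 4) =
      fun x => p₁ + 2 * p₂ * x + 3 * p₃ * x ^ 2 + 4 * p₄ * x ^ 3 + 0 * x ^ 4 := by
  ext x
  refine HasDerivAt.deriv ((((((hasDerivAt_id x).const_mul p₁).const_add p₀).fun_add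
    ((hasDerivAt_pow 2 x).const_mul p₂)).fun_add ((hasDerivAt_pow 3 x).const_mul p₃)).fun_add
    ((hasDerivAt_pow 4 x).const_mul p₄) |>.congr_deriv ?_)
  norm_num
  ring

theorem contDiffOn_quartic (p₀ p₁ p₂ p₃ p₄ : ℝ) :
    ContDiffOn ℝ ∞ (fun x => p₀ + p₁ * x + p₂ * x ^ 2 + p₃ * x ^ 3 + p₄ * x ^ 4) I := by
  apply ContDiff.contDiffOn
  fun_prop

theorem constField_one_comb (r : Fin 6 → ℝ) (γ : ℝ → ℝ) (q : ℝ × ℝ) :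
    (∑ i, r i • ![X₁, Y₁ 1 l, Y₂ 1 l, Y₃ 1 l, Y₄ l, Y₅ l] i + Vβ γ) q =
      ((r 5 + r 4 * q.1) * q.2 +
          (r 0 + r 1 * q.1 + (r 2 + 3 / 2 * l * r 5) * q.1 ^ 2 + l / 2 * r 4 * q.1 ^ 3 +
            0 * q.1 ^ 4),
        r 4 * q.2 ^ 2 + (r 1 / 2 + r 3 + r 2 * q.1) * q.2 +
        (0 + 0 * q.1 + (l * r 3 / 2 - 3 / 4 * l * r 1) * q.1 ^ 2 +
          -(l * r 2 / 2 + l ^ 2 * r 5) * q.1 ^ 3 + -(l ^ 2 / 4 * r 4) * q.1 ^ 4 + γ q.1)) := by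
  simp [Fin.sum_univ_succ, X₁, Y₁, Y₂, Y₃, Y₄, Y₅, Vβ]
  constructor <;> ring

/-- The powers of y give a'' = 0, c'' = 0, b'' = 2c' + 3λ a and d'' = λ(c - 2b'). Successive
integration makes a and c affine, b cubic and d a quartic plus a free affine function; the two
coefficients of a account for Y₄ and Y₅. -/
theorem isSymmetryBasis_const_one (hI : IsOpen I) (hI' : IsConnected I) (hJ : IsOpen J)
    (hJ' : IsConnected J) (hf : ∀ y ∈ J, f y = l) :
    IsSymmetryBasis 1 I J f
      (Sum.elim ![X₁, Y₁ 1 l, Y₂ 1 l, Y₃ 1 l, Y₄ l, Y₅ l] (fun j : Fin 2 => Z j)) := by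
  have hf' := deriv_eq_zero_of_eqOn_const hJ hf
  rw [Z_eq_Vβ]
  refine isSymmetryBasis_sumElim hJ' (isSolutionBasis_pow (n := 1) hI hI') (fun r γ hr => ?_)
    fun X => ?_
  · have e : ∀ q ∈ I ×ˢ J,
        (∑ i, r i • ![X₁, Y₁ 1 l, Y₂ 1 l, Y₃ 1 l, Y₄ l, Y₅ l] i + Vβ (-γ)) q = 0 := by
      intro q hq
      rw [Pi.add_apply, hr hq]
      simp [Vβ]
    have e1 : ∀ x ∈ I, r 5 + r 4 * x = 0 ∧ r 0 + r 1 * x + (r 2 + 3 / 2 * l * r 5) * x ^ 2 +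
        l / 2 * r 4 * x ^ 3 + 0 * x ^ 4 = 0 := fun x hx =>
      affine_eq_zero hJ hJ'.nonempty fun y hy => by
        have := e (x, y) ⟨hx, hy⟩
        rw [constField_one_comb] at this
        exact congrArg Prod.fst this
    obtain ⟨h4, h5⟩ := affine_eq_zero hI hI'.nonempty fun x hx => (add_comm _ _).trans (e1 x hx).1
    obtain ⟨h0, h1, h2⟩ := quadratic_eq_zero hI hI' (β₀ := r 0) (β₁ := r 1) (β₂ := r 2)
      fun x hx => by simpa [h4, h5] using (e1 x hx).2
    obtain ⟨x, hx⟩ := hI'.nonempty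
    have h3 : r 3 = 0 := (affine_eq_zero hJ hJ'.nonempty (α := r 3)
      (β := l * r 3 / 2 * x ^ 2 + (-γ) x) fun y hy => by
        have := e (x, y) ⟨hx, hy⟩
        rw [constField_one_comb] at this
        have := congrArg Prod.snd this
        simpa [h1, h2, h4, h5] using this).1
    ext i
    fin_cases i <;> assumption
  · rw [isGenerator_one_iff hI hJ hJ']
    constructor
    · rintro ⟨a, b, c, d, ha, hb, hc, hd, e, H⟩
      have k1 : ∀ x ∈ I, deriv (deriv a) x = 0 ∧
          2 * deriv c x - deriv (deriv b) x + 3 * l * a x = 0 := by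
        intro x hx
        have := affine_eq_zero hJ hJ'.nonempty (α := 3 * deriv (deriv a) x)
          (β := 2 * deriv c x - deriv (deriv b) x + 3 * l * a x) fun y hy => by
            have := (H x hx y hy).1
            rw [hf y hy] at this
            linear_combination this
        exact ⟨by linarith [this.1], this.2⟩
      have ha3 := deriv_eq_zero_of_eqOn hI fun x hx => (k1 x hx).1
      have k2 : ∀ x ∈ I, deriv (deriv c) x = 0 ∧
          deriv (deriv d) x - l * (c x - 2 * deriv b x) = 0 := fun x hx =>
        affine_eq_zero hJ hJ'.nonempty fun y hy => by
          have := (H x hx y hy).2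
          rw [hf y hy, hf' y hy, ha3 x hx] at this
          linear_combination this
      obtain ⟨a₀, a₁, ha'⟩ := eq_affine_of_deriv2 hI hI' ha fun x hx => (k1 x hx).1
      obtain ⟨c₀, c₁, hc'⟩ := eq_affine_of_deriv2 hI hI' hc fun x hx => (k2 x hx).1
      have ha1 := deriv_congr_of_eqOn hI ha'
      have hc1 := deriv_congr_of_eqOn hI hc'
      rw [deriv_affine] at ha1 hc1
      obtain ⟨β₁, hb1⟩ := eq_add_of_deriv_eq hI hI' (contDiffOn_deriv hI hb)
        (contDiffOn_quartic 0 (2 * c₁ + 3 * l * a₀) (3 / 2 * l * a₁) 0 0) fun x hx => by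
          rw [deriv_quartic]
          have := (k1 x hx).2
          rw [ha' x hx, hc1 x hx] at this
          linear_combination -this
      obtain ⟨β₀, hb0⟩ := eq_add_of_deriv_eq hI hI' hb
        (contDiffOn_quartic 0 β₁ (c₁ + 3 / 2 * l * a₀) (l / 2 * a₁) 0) fun x hx => by
          rw [deriv_quartic, hb1 x hx]
          ring
      -- The coefficient of Y₃ is c₀ minus the share β₁/2 already supplied by Y₁. The quartic added
      -- to d cancels the x-only parts of the six fields, so that the remainder has zero second
      -- derivative.
      refine ⟨![β₀, β₁, c₁, c₀ - β₁ / 2, a₁, a₀], fun x => d x + (0 + 0 * x +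
          -(l * (c₀ - β₁ / 2) / 2 - 3 / 4 * l * β₁) * x ^ 2 +
          (l * c₁ / 2 + l ^ 2 * a₀) * x ^ 3 + (l ^ 2 / 4 * a₁) * x ^ 4),
        ⟨hd.add (contDiffOn_quartic _ _ _ _ _), fun x hx => ?_⟩, fun q hq => ?_⟩
      · rw [mul_one, iteratedDeriv_add_of_contDiffOn hI hd (contDiffOn_quartic _ _ _ _ _) _ x hx,
          iteratedDeriv_two_eq, iteratedDeriv_two_eq, deriv_quartic, deriv_quartic]
        have := (k2 x hx).2
        rw [hc' x hx, hb1 x hx] at this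
        linear_combination this
      · rw [e hq, constField_one_comb]
        dsimp only
        rw [ha' q.1 hq.1, ha1 q.1 hq.1, hb0 q.1 hq.1, hc' q.1 hq.1]
        refine Prod.ext ?_ ?_
        · dsimp
          ring
        · dsimp
          ring
    · rintro ⟨r, γ, hγ, e⟩
      refine ⟨fun x => r 5 + r 4 * x, _, fun x => (r 1 / 2 + r 3) + r 2 * x, _, ?_,
        contDiffOn_quartic (r 0) (r 1) (r 2 + 3 / 2 * l * r 5) (l / 2 * r 4) 0, ?_,
        (contDiffOn_quartic 0 0 (l * r 3 / 2 - 3 / 4 * l * r 1) (-(l * r 2 / 2 + l ^ 2 * r 5))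
          (-(l ^ 2 / 4 * r 4))).add hγ.1, e.trans fun q hq => ?_, fun x hx y hy => ?_⟩
      · apply ContDiff.contDiffOn
        fun_prop
      · apply ContDiff.contDiffOn
        fun_prop
      · rw [constField_one_comb, deriv_affine]
      · have h1 := hγ.2 x hx
        have h2 := iteratedDeriv_add_of_contDiffOn hI (contDiffOn_quartic 0 0
          (l * r 3 / 2 - 3 / 4 * l * r 1) (-(l * r 2 / 2 + l ^ 2 * r 5)) (-(l ^ 2 / 4 * r 4)))
          hγ.1 2 x hx
        rw [mul_one, iteratedDeriv_two_eq] at h1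
        simp only [iteratedDeriv_two_eq, deriv_quartic] at h2
        rw [h2, hf y hy, hf' y hy]
        simp only [deriv_quartic, deriv_affine, deriv_const']
        exact ⟨by ring, by linear_combination h1⟩

end

/-! ### Identification of the explicit fields and the final assembly -/

theorem trigField_sin (w : ℝ) : ![X₁, V₁, V₂ w, V₃ w, V₄ w, V₅ w] =
    trigField (-1) w (fun x => Real.sin (w * x)) (fun x => Real.cos (w * x))
      (fun x => Real.sin (2 * w * x)) (fun x => Real.cos (2 * w * x)) := by
  simp only [trigField, neg_one_mul]
  rfl

theorem trigField_sinh (w : ℝ) : ![X₁, V₁, H₂ w, H₃ w, H₄ w, H₅ w] =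
    trigField 1 w (fun x => Real.sinh (w * x)) (fun x => Real.cosh (w * x))
      (fun x => Real.sinh (2 * w * x)) (fun x => Real.cosh (2 * w * x)) := by
  simp only [trigField, one_mul]
  rfl

end LieSym

end

open LieSym in
theorem theorem1 (n : ℕ) (hn : 1 ≤ n) (I J : Set ℝ)
    (hI : IsOpen I) (hI' : IsConnected I) (hJ : IsOpen J) (hJ' : IsConnected J) :
    -- arbitrary `f`: the vector fields that are generators for every `f` are spanned by `∂/∂x`
    (∀ X : VField, (∀ f : ℝ → ℝ, ContDiffOn ℝ ∞ f J → IsGenerator n I J f X) ↔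
      ∃ c : ℝ, Set.EqOn X (c • X₁) (I ×ˢ J)) ∧
    -- there are generators other than the multiples of `∂/∂x` exactly for the special `f`
    (∀ f : ℝ → ℝ, ContDiffOn ℝ ∞ f J →
      (IsSymmetryBasis n I J f ![X₁] ↔
        ¬ (UpToEquiv n IsListed J f ∨ (n = 1 ∧ UpToEquiv n IsErmakovPinney J f)))) ∧
    -- `f(y) = l exp(a y)`
    (∀ (f : ℝ → ℝ) (l a : ℝ), l ≠ 0 → a ≠ 0 → (∀ y ∈ J, f y = l * Real.exp (a * y)) →
      IsSymmetryBasis n I J f ![X₁, D₁ n a]) ∧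
    -- `f(y) = l y ^ p`
    (∀ (f g : ℝ → ℝ) (l p : ℝ), l ≠ 0 → p ≠ 0 → p ≠ 1 → IsPowerBranch J p g →
      (∀ y ∈ J, f y = l * g y) →
      IsGenerator n I J f (Dp n p) ∧
      (p ≠ critExp n → IsSymmetryBasis n I J f ![X₁, Dp n p])) ∧
    -- `f(y) = l y ^ p` with the critical exponent `p = (1+2n)/(1-2n)`
    (∀ (f g : ℝ → ℝ) (l : ℝ), l ≠ 0 → IsPowerBranch J (critExp n) g →
      (∀ y ∈ J, f y = l * g y) →
      IsSymmetryBasis n I J f ![X₁, X₂ n, X₃ n]) ∧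
    -- `f(y) = l`
    (∀ (f : ℝ → ℝ) (l : ℝ), (∀ y ∈ J, f y = l) →
      (1 < n → IsSymmetryBasis n I J f
        (Sum.elim ![X₁, Y₁ n l, Y₂ n l, Y₃ n l] (fun j : Fin (2 * n) => Z j))) ∧
      (n = 1 → IsSymmetryBasis n I J f
        (Sum.elim ![X₁, Y₁ n l, Y₂ n l, Y₃ n l, Y₄ l, Y₅ l] (fun j : Fin 2 => Z j)))) ∧
    -- `f(y) = l y`
    (∀ (f : ℝ → ℝ) (l : ℝ), l ≠ 0 → (∀ y ∈ J, f y = l * y) →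
      ∀ (ι : Type) (b : ι → ℝ → ℝ), IsSolutionBasis n I l b →
      (1 < n → IsSymmetryBasis n I J f
        (Sum.elim ![X₁, V₁] (fun j : ι => Vβ (b j)))) ∧
      (n = 1 → 0 < l → IsSymmetryBasis n I J f
        (Sum.elim ![X₁, V₁, V₂ √l, V₃ √l, V₄ √l, V₅ √l] (fun j : ι => Vβ (b j)))) ∧
      (n = 1 → l < 0 → IsSymmetryBasis n I J f
        (Sum.elim ![X₁, V₁, H₂ √(-l), H₃ √(-l), H₄ √(-l), H₅ √(-l)]
          (fun j : ι => Vβ (b j))))) := by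
  refine ⟨fun X => isGenerator_forall_iff hI hI' hJ hJ' hn,
    fun f hf => isSymmetryBasis_X₁_iff_not_listed hI hI' hJ hJ' hn hf,
    fun f l a hl ha hf => isSymmetryBasis_exp hI hI' hJ hJ' hn hl ha hf,
    fun f g l p hl hp0 hp1 hg hf => ?_, fun f g l hl hg hf => ?_, fun f l hf => ⟨fun hn => ?_, ?_⟩,
    fun f l hl hf ι b hb => ⟨fun hn => ?_, ?_, ?_⟩⟩
  · have hom := hg.isHomogeneous hJ hl hf
    exact ⟨isGenerator_Dp hI hJ hJ' hn hp1 hom,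
      fun hp => isSymmetryBasis_power hI hI' hJ hJ' hn hp0 hp1 hom hp⟩
  · exact isSymmetryBasis_critExp hI hI' hJ hJ' hn (hg.isHomogeneous hJ hl hf)
  · exact isSymmetryBasis_const_of_one_lt hI hI' hJ hJ' hn hf
  · rintro rfl
    exact isSymmetryBasis_const_one hI hI' hJ hJ' hf
  · exact isSymmetryBasis_linear_of_one_lt hI hI' hJ hJ' hn hl hf hb
  · rintro rfl hpos
    rw [trigField_sin]
    refine isSymmetryBasis_linear_one hI hI' hJ hJ' (Real.sqrt_pos.2 hpos).ne' (isTrigPair_sin _)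
      (isTrigPair_sin _) ?_ hf hb
    rw [Real.sq_sqrt hpos.le]
    ring
  · rintro rfl hneg
    have hpos : 0 < -l := neg_pos.2 hneg
    rw [trigField_sinh]
    refine isSymmetryBasis_linear_one hI hI' hJ hJ' (Real.sqrt_pos.2 hpos).ne' (isTrigPair_sinh _)
      (isTrigPair_sinh _) ?_ hf hb
    rw [Real.sq_sqrt hpos.le]
    ring
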